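/- **Model.** For $T=[0,1]$ and a sequence of experiments with $M$ channels, $N$ sampling times and total sample size $n=NM\to\infty$, one observes $$y(u_l,t_i)=\int_0^1 g(u_l,t_i-x)f(x)\,dx+\xi_{li},\qquad l=1,\dots,M,\quad t_i=i/N,\ i=1,\dots,N,$$ where $u_l\in[a,b]$, $0<a\le b<\infty$, each $g(u,\cdot)$ is real, $1$-periodic and integrable over $[0,1]$, and the vectors $\xi^{(l)}=(\xi_{li})_{i\le N}$ are centered Gaussian, independent for different $l$, with covariance matrices $\Sigma^{(l)}$. Let $g_m(u)=\int_0^1 g(u,x)e^{-2\pi imx}dx$ and $\tau_1(m,n)=M^{-1}\sum_{l=1}^M N^{-2d_l}|g_m(u_l)|^2$. **A1.** There are constants $0<K_1\le K_2$ such that for all $n$ and $l$ one has $0\le d_l<1/2$ and all eigenvalues of $\Sigma^{(l)}$ lie in $[K_1N^{2d_l},K_2N^{2d_l}]$. **A2.** There are constants $\nu_1,\nu_2,\lambda_1,\lambda_2\in\mathbb R$, $K_3,K_4,\beta>0$ and either $\alpha_1,\alpha_2>0$ (super-smooth case) or $\alpha_1=\alpha_2=0$, $\nu_1=\nu_2=\nu>0$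 (regular-smooth case), and $\varepsilon_n>0$, such that for all $n$ and all integers $m$ with $|m|\ge2$ $$K_3\varepsilon_n|m|^{-2\nu_1}(\ln|m|)^{-\lambda_1}e^{-\alpha_1|m|^\beta}\le\tau_1(m,n)\le K_4\varepsilon_n|m|^{-2\nu_2}(\ln|m|)^{-\lambda_2}e^{-\alpha_2|m|^\beta},$$ and $\tau_1(m,n)\ge K_3\varepsilon_n$ for $|m|\le1$. Put $n^*=n\varepsilon_n$. **Growth and sampling.** In the regular-smooth case there are $h_1,h_2\in(0,1)$ with $-h_1\ln n\le\ln\varepsilon_n\le h_2\ln n$ for large $n$, and $2^J\le N$ for large $n$; in the super-smooth case $n^*\to\infty$ and $2^{j_0}/N\to0$. Here $j_0,J$ are the levels of the estimator: the integer parts of the solutions of $2^{j_0}=\ln n^*$, $2^J=(n^*)^{1/(2\nu+1)}$ in the regular-smooth case, and the integer part of the solution of $2^{j_0}=\frac{3}{8\pi}\left(\frac{\ln n^*}{2\alpha_1}\right)^{1/\beta}$, with $J=j_0$, in the super-smooth case. **Estimator.** Let $\varphi_{jk},\psi_{jk}$ ($0\le k<2^j$) be the $1$-periodized Meyer scaling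 functions and wavelets (built from a $C^\infty$ auxiliary function), with Fourier coefficients $\varphi_{mjk},\psi_{mjk}$. Let $y_m(u_l)=N^{-1}\sum_{i}e^{-2\pi imt_i}y(u_l,t_i)$, $$\hat f_m=\frac{\sum_lN^{-2d_l}\overline{g_m(u_l)}\,y_m(u_l)}{\sum_lN^{-2d_l}|g_m(u_l)|^2},\quad \hat a_{j_0k}=\sum_m\hat f_m\overline{\varphi_{mj_0k}},\quad \hat b_{jk}=\sum_m\hat f_m\overline{\psi_{mjk}},$$ $$\hat f_n=\sum_{k<2^{j_0}}\hat a_{j_0k}\varphi_{j_0k}+\sum_{j=j_0}^{J-1}\sum_{r}\sum_{k\in U_{jr}}\hat b_{jk}\,\mathbb I\Big(\sum_{k'\in U_{jr}}|\hat b_{jk'}|^2\ge\lambda_j\Big)\psi_{jk},$$ where the $U_{jr}$ are the consecutive blocks of length $\lfloor\ln n\rfloor$ of $\{0,\dots,2^j-1\}$ (the last one possibly shorter), and $\lambda_j=\mu^2(n^*)^{-1}\ln(n^*)\,2^{2\nu j}j^{\lambda_1}$ in the regular-smooth case (no threshold is used in the super-smooth case). **Besov ball.** For $1\le p,q\le\infty$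 put $p'=\min(p,2)$, $s'=s+\frac12-\frac1p$, $s^*=s+\frac12-\frac1{p'}$. $B^s_{p,q}(A)$ is the set of $f\in L^2(T)$ with $\big(\sum_k|a_{\ell k}|^p\big)^{1/p}+\big(\sum_{j\ge\ell}2^{js'q}(\sum_k|b_{jk}|^p)^{q/p}\big)^{1/q}\le A$ (usual changes if $p$ or $q$ is $\infty$), where $a_{\ell k}=\langle f,\varphi_{\ell k}\rangle$, $b_{jk}=\langle f,\psi_{jk}\rangle$; the coarsest level $\ell$ may be any level $\le j_0$. **Theorem.** In the regular-smooth case there is $\mu_0>0$, depending only on the constants in A1, A2, on $h_1,h_2$ and on the wavelet family (so not on $s,p,q,A$), such that the following holds for every $\mu\ge\mu_0$; in the super-smooth case no condition on $\mu$ is needed. For all $1\le p,q\le\infty$, $s>1/p'$ and $A>0$ there is $C>0$, independent of $n$ and $\ell$, such that for all large $n$ and all $\ell\le j_0$ $$\sup_{f\in B^s_{p,q}(A)}\mathbb E\|\hat f_n-f\|_{L^2(T)}^2\le\begin{cases}C(n^*)^{-\frac{2s}{2s+2\nu+1}}(\ln n)^{\varrho+\frac{2s\lambda_1}{2s+2\nu+1}},&\text{regular-smooth,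 }\nu(2-p)<ps^*,\\ C\left(\frac{\ln n}{n^*}\right)^{\frac{2s^*}{2s^*+2\nu}}(\ln n)^{\varrho+\frac{2s^*\lambda_1}{2s^*+2\nu}},&\text{regular-smooth, }\nu(2-p)\ge ps^*,\\ C(\ln n^*)^{-\frac{2s^*}{\beta}},&\text{super-smooth,}\end{cases}$$ where $\varrho=\frac{(2\nu+1)(2-p)_+}{p(2s+2\nu+1)}$, $\frac{(q-p)_+}{q}$ or $0$ according as $\nu(2-p)$ is less than, equal to or greater than $ps^*$ (for $p=\infty$ the first case applies, with $\varrho=0$; $(q-p)_+/q=1$ if $p<q=\infty$). -/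

import Mathlib

open MeasureTheory ProbabilityTheory Filter Topology
open scoped ENNReal NNReal FourierTransform ComplexConjugate

universe v

noncomputable section

namespace MultichannelDeconvolution

/-! ### Fourier coefficients on the unit interval -/

/-- The exponential `e_m(t) = exp(-2 π i m t)`. -/
def expMode (m : ℤ) (t : ℝ) : ℂ :=
  Complex.exp (-(2 * Real.pi * m * t : ℝ) * Complex.I)

/-- The `m`-th Fourier coefficient `∫_0^1 h(t) exp(-2 π i m t) dt`. -/
def fourierCoef (h : ℝ → ℂ) (m : ℤ) : ℂ :=
  ∫ t in (0 : ℝ)..1, expMode m t * h t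

/-! ### The periodized Meyer wavelet basis -/

/-- The smooth auxiliary functions from which Meyer wavelets are built. -/
structure IsMeyerAuxiliary (w : ℝ → ℝ) : Prop where
  smooth : ContDiff ℝ ((⊤ : ℕ∞) : WithTop ℕ∞) w
  eq_zero : ∀ x ≤ 0, w x = 0
  eq_one : ∀ x, 1 ≤ x → w x = 1
  symm : ∀ x, w x + w (1 - x) = 1

/-- Fourier transform (in the variable `ξ = ω / 2π`) of the Meyer scaling function: it equals `1`
for `|ξ| ≤ 1/3`, `cos (π/2 · w (3|ξ| - 1))` for `1/3 ≤ |ξ| ≤ 2/3` and `0` for `|ξ| ≥ 2/3`. -/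
def meyerScalingHat (w : ℝ → ℝ) (ξ : ℝ) : ℂ :=
  (Real.cos (Real.pi / 2 * w (3 * |ξ| - 1)) : ℝ)

/-- Fourier transform of the Meyer mother wavelet: up to the phase `exp (-i π ξ)`, it equals
`sin (π/2 · w (3|ξ| - 1))` for `1/3 ≤ |ξ| ≤ 2/3`, `cos (π/2 · w (3|ξ|/2 - 1))` for
`2/3 ≤ |ξ| ≤ 4/3`, and `0` elsewhere. -/
def meyerWaveletHat (w : ℝ → ℝ) (ξ : ℝ) : ℂ :=
  Complex.exp (-(Real.pi * ξ : ℝ) * Complex.I) *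
    (Real.sin (Real.pi / 2 * w (3 * |ξ| - 1)) * Real.cos (Real.pi / 2 * w (3 * |ξ| / 2 - 1)) : ℝ)

/-- The Meyer scaling function `φ*` on the line. -/
def meyerScaling (w : ℝ → ℝ) : ℝ → ℂ := 𝓕⁻ (meyerScalingHat w)

/-- The Meyer mother wavelet `ψ*` on the line. -/
def meyerWavelet (w : ℝ → ℝ) : ℝ → ℂ := 𝓕⁻ (meyerWaveletHat w)

/-- Dilated, translated and 1-periodized version `∑_i 2^{j/2} η(2^j (x + i) - k)` of `η`. -/
def periodized (η : ℝ → ℂ) (j k : ℕ) (x : ℝ) : ℂ :=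
  ∑' i : ℤ, ((2 : ℝ) ^ ((j : ℝ) / 2) : ℝ) * η ((2 : ℝ) ^ j * (x + i) - k)

/-- The periodized scaling functions `φ_{jk}`. -/
def phi (w : ℝ → ℝ) (j k : ℕ) : ℝ → ℂ := periodized (meyerScaling w) j k

/-- The periodized wavelets `ψ_{jk}`. -/
def psi (w : ℝ → ℝ) (j k : ℕ) : ℝ → ℂ := periodized (meyerWavelet w) j k

/-! ### Besov balls -/

/-- Inner product `⟨f, η⟩` in `L²([0,1])` of a real function `f` with `η`. -/
def innerCoef (f : ℝ → ℝ) (η : ℝ → ℂ) : ℂ :=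
  ∫ t in (0 : ℝ)..1, (f t : ℂ) * conj (η t)

/-- The `ℓ^p` norm, `1 ≤ p ≤ ∞`, of a family of elements of `[0, ∞]`. -/
def ellNorm {ι : Type} (p : ℝ≥0∞) (a : ι → ℝ≥0∞) : ℝ≥0∞ :=
  if p = ∞ then ⨆ i, a i else (∑' i, a i ^ p.toReal) ^ (1 / p.toReal)

/-- `s' = s + 1/2 - 1/p`. -/
def sPrime (s : ℝ) (p : ℝ≥0∞) : ℝ := s + 1 / 2 - (p⁻¹).toReal

/-- `s* = s + 1/2 - 1/p'` with `p' = min (p, 2)`. -/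
def sStar (s : ℝ) (p : ℝ≥0∞) : ℝ := s + 1 / 2 - ((min p 2)⁻¹).toReal

/-- Besov norm of `f`, read off from its wavelet coefficients with coarsest level `ℓ`:
`(∑_k |a_{ℓk}|^p)^{1/p} + (∑_{j ≥ ℓ} 2^{j s' q} (∑_k |b_{jk}|^p)^{q/p})^{1/q}`. -/
def besovNorm (w : ℝ → ℝ) (ℓ : ℕ) (s : ℝ) (p q : ℝ≥0∞) (f : ℝ → ℝ) : ℝ≥0∞ :=
  ellNorm p (fun k : Fin (2 ^ ℓ) => ‖innerCoef f (phi w ℓ k)‖ₑ) +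
    ellNorm q (fun i : ℕ =>
      ENNReal.ofReal ((2 : ℝ) ^ (((ℓ + i : ℕ) : ℝ) * sPrime s p)) *
        ellNorm p (fun k : Fin (2 ^ (ℓ + i)) => ‖innerCoef f (psi w (ℓ + i) k)‖ₑ))

/-- The Besov ball `B^s_{p,q}(A)` of functions in `L²([0,1])`. -/
def besovBall (w : ℝ → ℝ) (ℓ : ℕ) (s : ℝ) (p q : ℝ≥0∞) (A : ℝ) : Set (ℝ → ℝ) :=
  {f | MemLp f 2 (volume.restrict (Set.Icc (0 : ℝ) 1)) ∧ besovNorm w ℓ s p q f ≤ ENNReal.ofReal A}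

/-! ### The model -/

/-- A sequence (indexed by `k`) of multichannel deconvolution experiments: `M k` channels at points
`u k l` of `[a, b]`, `N k` equispaced sampling times, total sample size `n = N k * M k → ∞`, a
blurring kernel `g` that is 1-periodic and integrable over the period in its second variable, and
noise vectors `ξ k l` (one for each channel) that are centered Gaussian and independent for
different channels, with arbitrary dependence within a channel. The numbers `d k l` are the
long-memory parameters of the channels. -/
structure Model where
  a : ℝ
  b : ℝ
  a_pos : 0 < a
  a_le_b : a ≤ b
  g : ℝ → ℝ → ℝ
  g_periodic : ∀ u ∈ Set.Icc a b, Function.Periodic (g u) 1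
  g_integrable : ∀ u ∈ Set.Icc a b, IntegrableOn (g u) (Set.Icc 0 1)
  M : ℕ → ℕ
  N : ℕ → ℕ
  M_pos : ∀ k, 0 < M k
  N_pos : ∀ k, 0 < N k
  tendsto_size : Tendsto (fun k => N k * M k) atTop atTop
  u : ∀ k, Fin (M k) → ℝ
  u_mem : ∀ k l, u k l ∈ Set.Icc a b
  d : ∀ k, Fin (M k) → ℝ
  Ω : ℕ → Type v
  mΩ : ∀ k, MeasurableSpace (Ω k)
  P : ∀ k, Measure (Ω k)
  isProbabilityMeasure : ∀ k, IsProbabilityMeasure (P k)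
  ξ : ∀ k, Fin (M k) → Ω k → Fin (N k) → ℝ
  ξ_measurable : ∀ k l, Measurable (ξ k l)
  ξ_gaussian : ∀ k l, HasGaussianLaw (ξ k l) (P k)
  ξ_centered : ∀ k l i, ∫ ω, ξ k l ω i ∂(P k) = 0
  ξ_indep : ∀ k, iIndepFun (fun l => ξ k l) (P k)

namespace Model

variable (D : Model.{v})

/-- The total sample size `n = N M`, as a real number. -/
def n (k : ℕ) : ℝ := (D.N k : ℝ) * (D.M k : ℝ)

/-- The effective sample size `n* = n ε_n`. -/
def nStar (ε : ℕ → ℝ) (k : ℕ) : ℝ := D.n k * ε k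

/-- The sampling times `t_i = i / N`, `i = 1, …, N`. -/
def time (k : ℕ) (i : Fin (D.N k)) : ℝ := ((i : ℕ) + 1 : ℝ) / D.N k

/-- The covariance matrix `Σ^{(l)}` of the noise vector of channel `l`. -/
def noiseCov (k : ℕ) (l : Fin (D.M k)) : Matrix (Fin (D.N k)) (Fin (D.N k)) ℝ :=
  letI := D.mΩ k
  Matrix.of fun i i' => covariance (fun ω => D.ξ k l ω i) (fun ω => D.ξ k l ω i') (D.P k)

/-- Assumption A1: all eigenvalues of `Σ^{(l)}` lie between `K₁ N^{2 d_l}` and `K₂ N^{2 d_l}`. -/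
def AssumptionA1 (K₁ K₂ : ℝ) : Prop :=
  ∀ k l, 0 ≤ D.d k l ∧ D.d k l < 1 / 2 ∧
    ∀ x ∈ spectrum ℝ (D.noiseCov k l),
      K₁ * (D.N k : ℝ) ^ (2 * D.d k l) ≤ x ∧ x ≤ K₂ * (D.N k : ℝ) ^ (2 * D.d k l)

/-- Fourier coefficients `g_m(u_l)` of the blurring kernel. -/
def gCoef (k : ℕ) (l : Fin (D.M k)) (m : ℤ) : ℂ :=
  fourierCoef (fun x => (D.g (D.u k l) x : ℂ)) m

/-- `τ₁(m, n) = M⁻¹ ∑_l N^{-2 d_l} |g_m(u_l)|²`. -/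
def tau (k : ℕ) (m : ℤ) : ℝ :=
  (D.M k : ℝ)⁻¹ * ∑ l, (D.N k : ℝ) ^ (-2 * D.d k l) * ‖D.gCoef k l m‖ ^ 2

/-- Assumption A2. The two-sided bound is for `|m| ≥ 2`, where its terms make sense and are
nonzero; for the remaining frequencies `m = 0, ±1` only the lower bound `K₃ ε_n` is required. -/
def AssumptionA2 (ε : ℕ → ℝ) (K₃ K₄ ν₁ ν₂ lam₁ lam₂ α₁ α₂ β : ℝ) : Prop :=
  (∀ k, 0 < ε k) ∧
  (∀ k, ∀ m : ℤ, 2 ≤ |m| →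
    K₃ * ε k * |(m : ℝ)| ^ (-2 * ν₁) * Real.log |(m : ℝ)| ^ (-lam₁) *
        Real.exp (-α₁ * |(m : ℝ)| ^ β) ≤ D.tau k m ∧
    D.tau k m ≤ K₄ * ε k * |(m : ℝ)| ^ (-2 * ν₂) * Real.log |(m : ℝ)| ^ (-lam₂) *
        Real.exp (-α₂ * |(m : ℝ)| ^ β)) ∧
  (∀ k, ∀ m : ℤ, |m| ≤ 1 → K₃ * ε k ≤ D.tau k m)

/-- The observations `y(u_l, t_i) = ∫_0^1 g(u_l, t_i - x) f(x) dx + ξ_{li}`. -/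
def obs (f : ℝ → ℝ) (k : ℕ) (l : Fin (D.M k)) (i : Fin (D.N k)) (ω : D.Ω k) : ℝ :=
  (∫ x in (0 : ℝ)..1, D.g (D.u k l) (D.time k i - x) * f x) + D.ξ k l ω i

/-! ### The block-thresholding estimator

Everything in this part is a function of the array `y` of observations. -/

/-- Discrete Fourier coefficients `y_m(u_l) = N⁻¹ ∑_i e_m(t_i) y(u_l, t_i)` of the data. -/
def yCoef (k : ℕ) (y : Fin (D.M k) → Fin (D.N k) → ℝ) (l : Fin (D.M k)) (m : ℤ) : ℂ :=
  (D.N k : ℂ)⁻¹ * ∑ i, expMode m (D.time k i) * (y l i : ℂ)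

/-- `f̂_m = (∑_l N^{-2 d_l} conj (g_m(u_l)) y_m(u_l)) / (∑_l N^{-2 d_l} |g_m(u_l)|²)`. -/
def fHatCoef (k : ℕ) (y : Fin (D.M k) → Fin (D.N k) → ℝ) (m : ℤ) : ℂ :=
  (∑ l, ((D.N k : ℝ) ^ (-2 * D.d k l) : ℝ) * conj (D.gCoef k l m) * D.yCoef k y l m) /
    ((∑ l, (D.N k : ℝ) ^ (-2 * D.d k l) * ‖D.gCoef k l m‖ ^ 2 : ℝ) : ℂ)

/-- Estimated coefficient `∑_m f̂_m conj (η_m)` with respect to `η`; for `η = φ_{jk}, ψ_{jk}` only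
finitely many Fourier coefficients `η_m` are nonzero, so this is a finite sum. -/
def coefHat (k : ℕ) (y : Fin (D.M k) → Fin (D.N k) → ℝ) (η : ℝ → ℂ) : ℂ :=
  ∑ᶠ m : ℤ, D.fHatCoef k y m * conj (fourierCoef η m)

end Model

/-- The block `U_{jr}`, `r ≥ 1`: the indices `k < 2^j` with `(r - 1) L ≤ k ≤ r L - 1`. -/
def block (L j r : ℕ) : Finset ℕ :=
  (Finset.range (2 ^ j)).filter fun k => (r - 1) * L ≤ k ∧ k < r * L

/-- The index set `A_j` of the blocks of length `L` that cover `{0, …, 2^j - 1}`. -/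
def blockIndices (L j : ℕ) : Finset ℕ := Finset.Icc 1 ⌈(2 : ℝ) ^ j / (L : ℝ)⌉₊

/-- The coarsest level `j₀`, with `x` in the role of `n*`: the integer part of the solution of
`2^{j₀} = ln x` if `α₁ = 0`, and of `2^{j₀} = 3/(8π) (ln x / (2 α₁))^{1/β}` otherwise. -/
def coarseLevel (α₁ β x : ℝ) : ℕ :=
  if α₁ = 0 then ⌊Real.logb 2 (Real.log x)⌋₊
  else ⌊Real.logb 2 (3 / (8 * Real.pi) * (Real.log x / (2 * α₁)) ^ (1 / β))⌋₊

/-- The finest level `J`: the integer part of the solution of `2^J = x^{1/(2ν+1)}` if `α₁ = 0`,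
and `J = j₀` otherwise. -/
def fineLevel (ν α₁ β x : ℝ) : ℕ :=
  if α₁ = 0 then ⌊Real.logb 2 (x ^ (1 / (2 * ν + 1)))⌋₊ else coarseLevel α₁ β x

/-- The thresholds `λ_j = μ² x⁻¹ ln x 2^{2νj} j^{λ₁}`, with `x` in the role of `n*`. -/
def threshold (μ ν lam₁ x : ℝ) (j : ℕ) : ℝ :=
  μ ^ 2 * x⁻¹ * Real.log x * (2 : ℝ) ^ (2 * ν * j) * (j : ℝ) ^ lam₁

namespace Model

variable (D : Model.{v})

/-- The block-thresholding estimator with levels `j₀, J`, blocks of length `L` and thresholds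
`thr j`. -/
def blockEstimator (w : ℝ → ℝ) (j₀ J L : ℕ) (thr : ℕ → ℝ) (k : ℕ)
    (y : Fin (D.M k) → Fin (D.N k) → ℝ) (t : ℝ) : ℂ :=
  (∑ i ∈ Finset.range (2 ^ j₀), D.coefHat k y (phi w j₀ i) * phi w j₀ i t) +
    ∑ j ∈ Finset.Ico j₀ J, ∑ r ∈ blockIndices L j,
      if thr j ≤ ∑ i ∈ block L j r, ‖D.coefHat k y (psi w j i)‖ ^ 2 then
        ∑ i ∈ block L j r, D.coefHat k y (psi w j i) * psi w j i t
      else 0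

/-- The adaptive estimator `f̂_n`: levels and thresholds as above, blocks of length `⌊ln n⌋`. -/
def estimator (w : ℝ → ℝ) (ε : ℕ → ℝ) (μ ν lam₁ α₁ β : ℝ) (k : ℕ)
    (y : Fin (D.M k) → Fin (D.N k) → ℝ) : ℝ → ℂ :=
  D.blockEstimator w (coarseLevel α₁ β (D.nStar ε k)) (fineLevel ν α₁ β (D.nStar ε k))
    ⌊Real.log (D.n k)⌋₊ (threshold μ ν lam₁ (D.nStar ε k)) k y

/-- The risk `E ‖f̂ - f‖²` in `L²([0,1])` of an estimator (a function of the data). -/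
def risk (k : ℕ) (est : (Fin (D.M k) → Fin (D.N k) → ℝ) → ℝ → ℂ) (f : ℝ → ℝ) : ℝ≥0∞ :=
  letI := D.mΩ k
  ∫⁻ ω, ∫⁻ t in Set.Icc (0 : ℝ) 1,
    ‖est (fun l i => D.obs f k l i ω) t - (f t : ℂ)‖ₑ ^ 2 ∂volume ∂(D.P k)

end Model

/-! ### Rates

For `1 ≤ p < ∞`, `ν (2 - p) < p s*` is the same as `ν (2/p - 1) < s*`; the latter also makes sense
(and is true) for `p = ∞`. -/

/-- `ϱ = (2ν+1)(2-p)₊ / (p (2s+2ν+1))` if `ν(2-p) < p s*`, `ϱ = (q-p)₊ / q` if `ν(2-p) = p s*`,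
and `ϱ = 0` if `ν(2-p) > p s*`. -/
def rho (ν s : ℝ) (p q : ℝ≥0∞) : ℝ :=
  if ν * (2 * (p⁻¹).toReal - 1) < sStar s p then
    (2 * ν + 1) * max 0 (2 * (p⁻¹).toReal - 1) / (2 * s + 2 * ν + 1)
  else if ν * (2 * (p⁻¹).toReal - 1) = sStar s p then max 0 (1 - p.toReal * (q⁻¹).toReal)
  else 0

/-- The rate in the regular-smooth case, with `x` in the role of `n` and `y` in that of `n*`. -/
def regularRate (ν lam₁ s : ℝ) (p q : ℝ≥0∞) (x y : ℝ) : ℝ :=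
  if ν * (2 * (p⁻¹).toReal - 1) < sStar s p then
    y ^ (-(2 * s / (2 * s + 2 * ν + 1))) *
      Real.log x ^ (rho ν s p q + 2 * s * lam₁ / (2 * s + 2 * ν + 1))
  else
    (Real.log x / y) ^ (2 * sStar s p / (2 * sStar s p + 2 * ν)) *
      Real.log x ^ (rho ν s p q + 2 * sStar s p * lam₁ / (2 * sStar s p + 2 * ν))

/-- The rate in the super-smooth case, with `y` in the role of `n*`. -/
def superRate (β s : ℝ) (p : ℝ≥0∞) (y : ℝ) : ℝ :=
  Real.log y ^ (-(2 * sStar s p / β))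

end MultichannelDeconvolution

end

noncomputable section

namespace MultichannelDeconvolution

/-! ### Fourier series on the unit interval -/

/-! Everything is done on Fourier coefficients. A periodized Meyer function of level `j` is a
trigonometric polynomial with frequencies below `4/3 * 2^j`, so wavelet coefficients, true or
estimated, are finite sums over Fourier coefficients. The identity `meyer_refinement` gives `V_{j+1}
= V_j ⊕ W_j` on the Fourier side, and telescoping it gives `meyer_reconstruction`. Orthonormality is
not needed: Bessel inequalities with constant 5, from orthogonality of the characters mod `2^j`,
together with the fact that a frequency meets at most two wavelet levels, bound the `L²` error by 15
times the sum of the squared coefficient errors (`lintegral_multilevel_sub_le`).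

An estimated coefficient is truth plus aliasing plus noise (`coefHat_obs`).

Aliasing: sampling at `N` points folds together frequencies congruent mod `N`. Since `s > 1/p'`
means `s* > 1/2`, the sum of `|m|^{2κ} |f_m|²` over high frequencies is bounded for `1/2 < κ < s*`.
Cauchy-Schwarz over the channels costs a factor `√(τ₁(m')/τ₁(m))` per folded frequency, and
Cauchy-Schwarz over a residue class gives a total of order `N^{-2κ}` times the largest such ratio
(`sum_sq_aliasBias_le`). In the regular-smooth case `2^J ≤ N` makes this smaller than the threshold
on every level.

Noise: the weights `N^{-2d_l}` offset the covariances of size `N^{2d_l}`, so linear combinations of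
the noise coefficients of a level are sub-Gaussian with proxy of order `sup τ₁⁻¹ / n`, the supremum
being over the band of the level (`lintegral_exp_noiseCoef_le`). Writing `exp |X|²` as a Gaussian
average of exponentials of linear forms (`lintegral_exp_sq_le`) yields an exponential moment for the
energy `Z` of a block. It costs a factor `2^L ≤ n` for blocks of length `L = ⌊ln n⌋`, only a power
of `n*`, which a large `μ` beats (`RegularScale.sum_deviation_le`).

Thresholding: a deterministic case analysis (`block_loss_le`) bounds the loss of a block with true
energy `B` by `3 min(B, θ)` plus a multiple of `Z` on the event `Z ≥ θ/16`. The risk is then the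
coarse level, the sum of the `min(B, θ)`, the deviations, and the omitted fine levels.

The sum of the `min(B, θ)` on a level has three bounds: the noise level (number of blocks times
threshold), `θ^{1-p'/2}` times the `ℓ^{p'}` sum of the coefficients, and their `ℓ²` sum. Balancing
the first two gives the dense rate, the last two the sparse rate. On the boundary the second is flat
in `2^j`, all levels of order `ln n*` count, and `q` enters through Hölder over the levels. The
remaining terms are negligible because the exponent `e` of the rate satisfies `e < 1` and `e <
2s*/(2ν+1)`.

In the super-smooth case there are no wavelet levels. The choice of `j₀` keeps `τ₁ ≥ K₃ ε_n
(n*)^{-3/4}` on the resolved band, so aliasing and variance are of order `(n*)^{-1/4}` up to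
logarithms, and the rate is the tail `2^{-2 j₀ s*}`. -/

lemma norm_expMode (m : ℤ) (t : ℝ) : ‖expMode m t‖ = 1 := by
  unfold expMode
  rw [show (-((2 * Real.pi * m * t : ℝ) : ℂ) * Complex.I) =
    ((-(2 * Real.pi * m * t) : ℝ) : ℂ) * Complex.I by push_cast; ring]
  exact Complex.norm_exp_ofReal_mul_I _

lemma continuous_expMode (m : ℤ) : Continuous (expMode m) := by
  unfold expMode; fun_prop

lemma expMode_add_mode (m m' : ℤ) (t : ℝ) : expMode (m + m') t = expMode m t * expMode m' t := by
  unfold expMode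
  rw [← Complex.exp_add]; congr 1; push_cast; ring

lemma expMode_add_time (m : ℤ) (t t' : ℝ) : expMode m (t + t') = expMode m t * expMode m t' := by
  unfold expMode
  rw [← Complex.exp_add]; congr 1; push_cast; ring

lemma expMode_zero (t : ℝ) : expMode 0 t = 1 := by simp [expMode]

lemma expMode_int (m n : ℤ) : expMode m n = 1 := by
  unfold expMode
  rw [Complex.exp_eq_one_iff]
  exact ⟨-(m * n), by push_cast; ring⟩

lemma expMode_add_int (m : ℤ) (t : ℝ) (n : ℤ) : expMode m (t + n) = expMode m t := by
  rw [expMode_add_time, expMode_int, mul_one]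

lemma conj_expMode (m : ℤ) (t : ℝ) : conj (expMode m t) = expMode (-m) t := by
  unfold expMode
  rw [← Complex.exp_conj]; congr 1
  simp [-Complex.ofReal_mul]

lemma fourierCoef_eq_fourierCoeffOn (h : ℝ → ℂ) (m : ℤ) :
    fourierCoef h m = fourierCoeffOn (zero_lt_one' ℝ) h m := by
  rw [fourierCoeffOn_eq_integral]
  simp only [fourierCoef, sub_zero, one_div, inv_one, one_smul, smul_eq_mul, expMode]
  congr 1; ext t; congr 1
  rw [fourier_coe_apply]; congr 1; push_cast; ring

lemma parseval {h : ℝ → ℂ} (hh : MemLp h 2 (volume.restrict (Set.Icc (0 : ℝ) 1))) :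
    ∫⁻ t in Set.Icc (0 : ℝ) 1, ‖h t‖ₑ ^ 2 = ∑' m, ‖fourierCoef h m‖ₑ ^ 2 := by
  have hr : volume.restrict (Set.Icc (0 : ℝ) 1) = volume.restrict (Set.Ioc (0 : ℝ) 1) :=
    restrict_Ioc_eq_restrict_Icc.symm
  rw [hr] at hh ⊢
  have h1 := hasSum_sq_fourierCoeffOn (zero_lt_one' ℝ) hh
  simp only [← fourierCoef_eq_fourierCoeffOn, sub_zero, inv_one, one_smul] at h1
  rw [intervalIntegral.integral_of_le zero_le_one] at h1
  have h2 : Integrable (fun t => ‖h t‖ ^ 2) (volume.restrict (Set.Ioc (0 : ℝ) 1)) :=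
    hh.integrable_norm_pow (by norm_num)
  have h3 : ∀ z : ℂ, ‖z‖ₑ ^ 2 = ENNReal.ofReal (‖z‖ ^ 2) := fun z => by
    rw [ENNReal.ofReal_pow (norm_nonneg _), ofReal_norm]
  simp_rw [h3]
  rw [← ofReal_integral_eq_lintegral_ofReal h2 (ae_of_all _ fun _ => by positivity),
    ← ENNReal.ofReal_tsum_of_nonneg (fun _ => by positivity) h1.summable, h1.tsum_eq]

lemma intervalIntegrable_of_memLp {h : ℝ → ℂ}
    (hh : MemLp h 2 (volume.restrict (Set.Icc (0 : ℝ) 1))) :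
    IntervalIntegrable h volume 0 1 := by
  rw [intervalIntegrable_iff_integrableOn_Icc_of_le zero_le_one]
  exact hh.integrable (by norm_num)

lemma IntervalIntegrable.expMode_mul {h : ℝ → ℂ} (hh : IntervalIntegrable h volume 0 1) (m : ℤ) :
    IntervalIntegrable (fun t => expMode m t * h t) volume 0 1 :=
  hh.continuousOn_mul (continuous_expMode m).continuousOn

lemma fourierCoef_sub {h h' : ℝ → ℂ} (hh : IntervalIntegrable h volume 0 1)
    (hh' : IntervalIntegrable h' volume 0 1) (m : ℤ) :
    fourierCoef (fun t => h t - h' t) m = fourierCoef h m - fourierCoef h' m := by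
  unfold fourierCoef
  rw [← intervalIntegral.integral_sub (IntervalIntegrable.expMode_mul hh m)
    (IntervalIntegrable.expMode_mul hh' m)]
  congr 1; ext t; ring

lemma fourierCoef_finset_sum {ι : Type*} (S : Finset ι) {h : ι → ℝ → ℂ}
    (hh : ∀ i ∈ S, IntervalIntegrable (h i) volume 0 1) (m : ℤ) :
    fourierCoef (fun t => ∑ i ∈ S, h i t) m = ∑ i ∈ S, fourierCoef (h i) m := by
  unfold fourierCoef
  rw [← intervalIntegral.integral_finsetSum fun i hi =>
    IntervalIntegrable.expMode_mul (hh i hi) m]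
  congr 1; ext t; rw [Finset.mul_sum]

lemma fourierCoef_const_mul (c : ℂ) (h : ℝ → ℂ) (m : ℤ) :
    fourierCoef (fun t => c * h t) m = c * fourierCoef h m := by
  unfold fourierCoef
  rw [← intervalIntegral.integral_const_mul]
  congr 1; ext t; ring

lemma fourierCoef_expMode (m m' : ℤ) :
    fourierCoef (expMode (-m')) m = if m = m' then 1 else 0 := by
  have h : ∀ t, expMode m t * expMode (-m') t = expMode (m - m') t := fun t => by
    rw [← expMode_add_mode]; rfl
  simp only [fourierCoef, h]
  split_ifs with hm
  · subst hm; simp [expMode_zero]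
  · have hc : (-(2 * Real.pi * (m - m' : ℤ)) * Complex.I : ℂ) ≠ 0 := by
      have : (m : ℂ) - m' ≠ 0 := by exact_mod_cast sub_ne_zero.mpr hm
      simp [Real.pi_ne_zero, this]
    have h2 : ∀ t : ℝ, expMode (m - m') t =
        Complex.exp ((-(2 * Real.pi * (m - m' : ℤ)) * Complex.I : ℂ) * t) := fun t => by
      unfold expMode; congr 1; push_cast; ring
    simp only [h2]
    rw [integral_exp_mul_complex hc]
    have h3 := h2 1
    have h4 := expMode_int (m - m') 1
    simp only [Int.cast_one] at h4
    rw [h4] at h3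
    rw [← h3]
    simp

lemma integral_tsum_expMode {c : ℤ → ℂ} (hc : Summable fun m => ‖c m‖) (m : ℤ) :
    fourierCoef (fun t => ∑' m', c m' * expMode (-m') t) m = c m := by
  unfold fourierCoef
  have h1 : HasSum (fun m' => ∫ t in (0 : ℝ)..1, expMode m t * (c m' * expMode (-m') t))
      (∫ t in (0 : ℝ)..1, ∑' m', expMode m t * (c m' * expMode (-m') t)) := by
    refine intervalIntegral.hasSum_integral_of_dominated_convergence (fun m' _ => ‖c m'‖)
      (fun m' => ?_) (fun m' => ?_) ?_ ?_ ?_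
    · exact ((continuous_expMode m).mul (continuous_const.mul
        (continuous_expMode _))).aestronglyMeasurable
    · exact ae_of_all _ fun t _ => by simp [norm_expMode]
    · exact ae_of_all _ fun t _ => hc
    · exact intervalIntegrable_const
    · refine ae_of_all _ fun t _ => ?_
      refine Summable.hasSum (Summable.of_norm ?_)
      simpa [norm_expMode] using hc
  simp_rw [tsum_mul_left] at h1
  rw [← h1.tsum_eq]
  have h2 : ∀ m', ∫ t in (0 : ℝ)..1, expMode m t * (c m' * expMode (-m') t) =
      if m' = m then c m else 0 := fun m' => by
    have := fourierCoef_const_mul (c m') (expMode (-m')) m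
    rw [fourierCoef_expMode] at this
    rw [show (∫ t in (0 : ℝ)..1, expMode m t * (c m' * expMode (-m') t)) = _ from this]
    by_cases h : m' = m
    · subst h; simp
    · rw [if_neg h, if_neg (Ne.symm h), mul_zero]
  simp_rw [h2]
  rw [tsum_ite_eq]

lemma continuous_tsum_expMode {c : ℤ → ℂ} (hc : Summable fun m => ‖c m‖) :
    Continuous fun t => ∑' m, c m * expMode (-m) t :=
  continuous_tsum (fun m => continuous_const.mul (continuous_expMode _)) hc
    fun m t => by simp [norm_expMode]

lemma memLp_of_continuous {h : ℝ → ℂ} (hh : Continuous h) :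
    MemLp h 2 (volume.restrict (Set.Icc (0 : ℝ) 1)) := by
  obtain ⟨C, hC⟩ := (isCompact_Icc (a := (0 : ℝ)) (b := 1)).exists_bound_of_continuousOn
    hh.continuousOn
  refine MemLp.of_bound hh.aestronglyMeasurable C ?_
  exact (ae_restrict_iff' measurableSet_Icc).mpr (ae_of_all _ hC)

/-- A square integrable function with summable Fourier coefficients is a.e. equal to the sum of its
Fourier series. -/
lemma ae_eq_tsum_fourierCoef {h : ℝ → ℂ} (hh : MemLp h 2 (volume.restrict (Set.Icc (0 : ℝ) 1)))
    (hs : Summable fun m => ‖fourierCoef h m‖) :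
    h =ᵐ[volume.restrict (Set.Icc (0 : ℝ) 1)] fun t => ∑' m, fourierCoef h m * expMode (-m) t := by
  have hF := memLp_of_continuous (continuous_tsum_expMode hs)
  have h1 := parseval (hh.sub hF)
  -- All Fourier coefficients of the difference vanish, so Parseval makes its norm zero.
  have h2 : ∀ m, fourierCoef (h - fun t => ∑' m, fourierCoef h m * expMode (-m) t) m = 0 := by
    intro m
    have := fourierCoef_sub (intervalIntegrable_of_memLp hh) (intervalIntegrable_of_memLp hF) m
    rw [integral_tsum_expMode hs, sub_self] at this
    exact this
  simp only [h2, enorm_zero, ne_eq, OfNat.ofNat_ne_zero, not_false_eq_true, zero_pow,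
    tsum_zero] at h1
  have hm := (hh.sub hF).aestronglyMeasurable
  rw [lintegral_eq_zero_iff' (by fun_prop)] at h1
  filter_upwards [h1] with t ht
  have := pow_eq_zero_iff (two_ne_zero) |>.mp ht
  rw [enorm_eq_zero] at this
  exact sub_eq_zero.mp this

/-! ### Periodized band-limited functions -/

/-- Smooth kernels, bounded by one, that live on `|ξ| < 4/3`. -/
structure IsBandKernel (h : ℝ → ℂ) : Prop where
  smooth : ContDiff ℝ ((⊤ : ℕ∞) : WithTop ℕ∞) h
  eq_zero : ∀ ξ, 4 / 3 ≤ |ξ| → h ξ = 0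
  norm_le : ∀ ξ, ‖h ξ‖ ≤ 1

/-- The `m`-th Fourier coefficient of the periodized, dilated and translated kernel. -/
def modeCoef (h : ℝ → ℂ) (j k : ℕ) (m : ℤ) : ℂ :=
  ((2 : ℝ) ^ (-(j : ℝ) / 2) : ℝ) * h (m / 2 ^ j) * expMode m (k / 2 ^ j)

/-- A finite set of frequencies that carries all functions of level `j`. -/
def modes (j : ℕ) : Finset ℤ := Finset.Icc (-2 ^ (j + 1)) (2 ^ (j + 1))

lemma mem_modes {j : ℕ} {m : ℤ} : m ∈ modes j ↔ |m| ≤ 2 ^ (j + 1) := by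
  rw [modes, Finset.mem_Icc, abs_le]

lemma IsBandKernel.abs_lt {h : ℝ → ℂ} (hh : IsBandKernel h) {j : ℕ} {m : ℤ}
    (hm : h (m / 2 ^ j) ≠ 0) : |(m : ℝ)| < 4 / 3 * 2 ^ j := by
  by_contra! hc
  refine hm (hh.eq_zero _ ?_)
  rw [abs_div, abs_of_pos (by positivity : (0 : ℝ) < 2 ^ j), le_div_iff₀ (by positivity)]
  exact hc

lemma IsBandKernel.mem_modes {h : ℝ → ℂ} (hh : IsBandKernel h) {j : ℕ} {m : ℤ}
    (hm : h (m / 2 ^ j) ≠ 0) : m ∈ modes j := by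
  have h1 := hh.abs_lt hm
  rw [MultichannelDeconvolution.mem_modes]
  have : ((|m| : ℤ) : ℝ) ≤ ((2 ^ (j + 1) : ℤ) : ℝ) := by
    push_cast
    rw [pow_succ]; nlinarith [pow_pos (two_pos : (0 : ℝ) < 2) j]
  exact_mod_cast this

lemma IsBandKernel.modeCoef_eq_zero {h : ℝ → ℂ} (hh : IsBandKernel h) {j : ℕ} (k : ℕ) {m : ℤ}
    (hm : m ∉ modes j) : modeCoef h j k m = 0 := by
  have : h (m / 2 ^ j) = 0 := by
    by_contra hc
    exact hm (hh.mem_modes hc)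
  simp [modeCoef, this]

-- Poisson summation. Smoothness and compact support of the kernel make the dilated, modulated
-- transform a Schwartz function, and the support truncates the dual sum to `modes j`.
open scoped SchwartzMap in
lemma IsBandKernel.periodized_eq {h : ℝ → ℂ} (hh : IsBandKernel h) (j k : ℕ) (x : ℝ) :
    periodized (𝓕⁻ h) j k x = ∑ m ∈ modes j, modeCoef h j k m * expMode (-m) x := by
  set c : ℝ := (2 : ℝ) ^ (-(j : ℝ) / 2) with hc
  have h2j : (0 : ℝ) < 2 ^ j := by positivity
  -- Fourier transform of the dilate and translate: dilation by `2^j` rescales the argument,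
  -- translation by `k` produces the phase.
  set q : ℝ → ℂ := fun ξ => (c : ℂ) * h (ξ / 2 ^ j) *
    Complex.exp (-(2 * Real.pi * ξ * (k / 2 ^ j) : ℝ) * Complex.I) with hq
  have hq1 : ContDiff ℝ ((⊤ : ℕ∞) : WithTop ℕ∞) q := by
    refine (contDiff_const.mul (hh.smooth.comp (contDiff_id.div_const _))).mul ?_
    refine ContDiff.cexp ?_
    refine ContDiff.mul ?_ contDiff_const
    refine ContDiff.neg ?_
    exact Complex.ofRealCLM.contDiff.comp
      ((contDiff_const.mul contDiff_id).mul contDiff_const)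
  have hq2 : HasCompactSupport q := by
    refine HasCompactSupport.of_support_subset_isCompact
      (isCompact_Icc (a := -(4 / 3 * 2 ^ j : ℝ)) (b := 4 / 3 * 2 ^ j)) fun ξ hξ => ?_
    rw [Set.mem_Icc, ← abs_le]
    by_contra! hcc
    refine hξ ?_
    have : h (ξ / 2 ^ j) = 0 := hh.eq_zero _ (by
      rw [abs_div, abs_of_pos h2j, le_div_iff₀ h2j]; exact hcc.le)
    simp [hq, this]
  set Q : 𝓢(ℝ, ℂ) := hq2.toSchwartzMap hq1 with hQ
  have hQq : ∀ ξ, Q ξ = q ξ := fun ξ => rfl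
  have hinv : ∀ y : ℝ, (𝓕⁻ Q : 𝓢(ℝ, ℂ)) y =
      ((2 : ℝ) ^ ((j : ℝ) / 2) : ℝ) * (𝓕⁻ h) ((2 : ℝ) ^ j * y - k) := by
    intro y
    rw [SchwartzMap.fourierInv_coe, Real.fourierInv_eq', Real.fourierInv_eq']
    have e1 : ∀ v : ℝ, Complex.exp ((2 * Real.pi * inner ℝ v y : ℝ) * Complex.I) • Q v =
        (fun z : ℝ => (c : ℂ) * (Complex.exp ((2 * Real.pi * inner ℝ z (2 ^ j * y - k) : ℝ) *
          Complex.I) • h z)) (v / 2 ^ j) := by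
      intro v
      simp only [hQq, hq, smul_eq_mul]
      have : Complex.exp ((2 * Real.pi * inner ℝ v y : ℝ) * Complex.I) *
          Complex.exp (-(2 * Real.pi * v * (k / 2 ^ j) : ℝ) * Complex.I) =
          Complex.exp ((2 * Real.pi * inner ℝ (v / 2 ^ j) (2 ^ j * y - k) : ℝ) * Complex.I) := by
        rw [← Complex.exp_add]; congr 1
        have : (2 * Real.pi * inner ℝ (v / 2 ^ j) (2 ^ j * y - k) : ℝ) =
          2 * Real.pi * inner ℝ v y - 2 * Real.pi * v * (k / 2 ^ j) := by
          simp only [RCLike.inner_apply, conj_trivial]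
          field_simp
        rw [this]; push_cast; ring
      rw [← this]; ring
    simp_rw [e1]
    rw [Measure.integral_comp_div (fun z : ℝ => (c : ℂ) * (Complex.exp
      ((2 * Real.pi * inner ℝ z (2 ^ j * y - k) : ℝ) * Complex.I) • h z)) ((2 : ℝ) ^ j),
      integral_const_mul, abs_of_pos h2j, Complex.real_smul, ← mul_assoc]
    congr 1
    rw [← Complex.ofReal_mul, hc]
    congr 1
    rw [← Real.rpow_natCast, ← Real.rpow_add two_pos]
    congr 1; ring
  have hP := SchwartzMap.tsum_eq_tsum_fourier (𝓕⁻ Q) x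
  have h1 : periodized (𝓕⁻ h) j k x = ∑' n : ℤ, (𝓕⁻ Q : 𝓢(ℝ, ℂ)) (x + n) := by
    unfold periodized
    congr 1; ext n
    rw [hinv]
  rw [h1, hP, FourierTransform.fourier_fourierInv_eq]
  have h3 : ∀ m : ℤ, Q m = modeCoef h j k m := by
    intro m
    rw [hQq, modeCoef, expMode]
  rw [tsum_eq_sum (s := modes j)]
  · refine Finset.sum_congr rfl fun m _ => ?_
    rw [h3]; congr 1
    rw [fourier_coe_apply, expMode]; congr 1; push_cast; ring
  · intro m hm
    rw [h3, hh.modeCoef_eq_zero k hm, zero_mul]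

lemma IsBandKernel.continuous_periodized {h : ℝ → ℂ} (hh : IsBandKernel h) (j k : ℕ) :
    Continuous (periodized (𝓕⁻ h) j k) := by
  have : periodized (𝓕⁻ h) j k = fun x => ∑ m ∈ modes j, modeCoef h j k m * expMode (-m) x :=
    funext (hh.periodized_eq j k)
  rw [this]
  exact continuous_finsetSum _ fun m _ => continuous_const.mul (continuous_expMode _)

lemma IsBandKernel.fourierCoef_periodized {h : ℝ → ℂ} (hh : IsBandKernel h) (j k : ℕ) (m : ℤ) :
    fourierCoef (periodized (𝓕⁻ h) j k) m = modeCoef h j k m := by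
  have : periodized (𝓕⁻ h) j k = fun x => ∑ m ∈ modes j, modeCoef h j k m * expMode (-m) x :=
    funext (hh.periodized_eq j k)
  rw [this, fourierCoef_finset_sum (modes j)
    (h := fun m x => modeCoef h j k m * expMode (-m) x) fun m' _ =>
    (continuous_const.mul (continuous_expMode _)).intervalIntegrable _ _]
  simp_rw [fourierCoef_const_mul, fourierCoef_expMode]
  by_cases hm : m ∈ modes j
  · simp [hm]
  · simp [hm, hh.modeCoef_eq_zero k hm]

lemma IsBandKernel.innerCoef_periodized {h : ℝ → ℂ} (hh : IsBandKernel h) (j k : ℕ) {f : ℝ → ℝ}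
    (hf : MemLp f 2 (volume.restrict (Set.Icc (0 : ℝ) 1))) :
    innerCoef f (periodized (𝓕⁻ h) j k) =
      ∑ m ∈ modes j, fourierCoef (fun t => (f t : ℂ)) m * conj (modeCoef h j k m) := by
  unfold innerCoef
  have hf' : IntervalIntegrable (fun t => (f t : ℂ)) volume 0 1 :=
    intervalIntegrable_of_memLp hf.ofReal
  have h1 : ∀ t, (f t : ℂ) * conj (periodized (𝓕⁻ h) j k t) =
      ∑ m ∈ modes j, conj (modeCoef h j k m) * (expMode m t * f t) := by
    intro t
    rw [hh.periodized_eq, map_sum, Finset.mul_sum]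
    refine Finset.sum_congr rfl fun m _ => ?_
    rw [map_mul, conj_expMode, neg_neg]; ring
  simp_rw [h1]
  rw [intervalIntegral.integral_finsetSum fun m _ =>
    (IntervalIntegrable.expMode_mul hf' m).const_mul _]
  refine Finset.sum_congr rfl fun m _ => ?_
  rw [intervalIntegral.integral_const_mul, mul_comm, fourierCoef]

/-! ### Meyer kernels -/

/-- The kink of `|ξ|` at the origin is invisible, because `w` vanishes on the negative axis and the
argument is near `-1` there. -/
lemma IsMeyerAuxiliary.contDiff_comp_abs {w : ℝ → ℝ} (hw : IsMeyerAuxiliary w) (a : ℝ) :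
    ContDiff ℝ ((⊤ : ℕ∞) : WithTop ℕ∞) fun ξ : ℝ => w (a * |ξ| - 1) := by
  rw [contDiff_iff_contDiffAt]
  intro ξ
  by_cases hξ : ξ = 0
  · subst hξ
    have : (fun ξ : ℝ => w (a * |ξ| - 1)) =ᶠ[𝓝 0] fun _ => 0 := by
      have h1 : ∀ᶠ ξ : ℝ in 𝓝 0, a * |ξ| - 1 < 0 := by
        have : Tendsto (fun ξ : ℝ => a * |ξ| - 1) (𝓝 0) (𝓝 (a * |0| - 1)) := by
          apply Continuous.tendsto; fun_prop
        refine this.eventually_lt_const ?_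
        simp
      filter_upwards [h1] with ξ hξ using hw.eq_zero _ hξ.le
    exact contDiffAt_const.congr_of_eventuallyEq this
  · exact hw.smooth.contDiffAt.comp ξ
      ((contDiffAt_const.mul (contDiffAt_abs hξ)).sub contDiffAt_const)

lemma meyerScalingHat_of_le {w : ℝ → ℝ} (hw : IsMeyerAuxiliary w) {ξ : ℝ} (h : |ξ| ≤ 1 / 3) :
    meyerScalingHat w ξ = 1 := by
  simp [meyerScalingHat, hw.eq_zero (3 * |ξ| - 1) (by linarith)]

lemma meyerScalingHat_of_ge {w : ℝ → ℝ} (hw : IsMeyerAuxiliary w) {ξ : ℝ} (h : 2 / 3 ≤ |ξ|) :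
    meyerScalingHat w ξ = 0 := by
  simp [meyerScalingHat, hw.eq_one (3 * |ξ| - 1) (by linarith)]

lemma meyerWaveletHat_of_le {w : ℝ → ℝ} (hw : IsMeyerAuxiliary w) {ξ : ℝ} (h : |ξ| ≤ 1 / 3) :
    meyerWaveletHat w ξ = 0 := by
  simp [meyerWaveletHat, hw.eq_zero (3 * |ξ| - 1) (by linarith)]

lemma meyerWaveletHat_of_ge {w : ℝ → ℝ} (hw : IsMeyerAuxiliary w) {ξ : ℝ} (h : 4 / 3 ≤ |ξ|) :
    meyerWaveletHat w ξ = 0 := by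
  simp [meyerWaveletHat, hw.eq_one (3 * |ξ| / 2 - 1) (by linarith)]

lemma isBandKernel_meyerScalingHat {w : ℝ → ℝ} (hw : IsMeyerAuxiliary w) :
    IsBandKernel (meyerScalingHat w) where
  smooth := by
    unfold meyerScalingHat
    exact Complex.ofRealCLM.contDiff.comp
      (Real.contDiff_cos.comp (contDiff_const.mul (hw.contDiff_comp_abs 3)))
  eq_zero ξ h := meyerScalingHat_of_ge hw (by linarith)
  norm_le ξ := by
    unfold meyerScalingHat
    rw [Complex.norm_real]; exact Real.abs_cos_le_one _

lemma isBandKernel_meyerWaveletHat {w : ℝ → ℝ} (hw : IsMeyerAuxiliary w) :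
    IsBandKernel (meyerWaveletHat w) where
  smooth := by
    unfold meyerWaveletHat
    have h1 : ContDiff ℝ ((⊤ : ℕ∞) : WithTop ℕ∞) fun ξ : ℝ => w (3 * |ξ| / 2 - 1) := by
      have := hw.contDiff_comp_abs (3 / 2)
      convert this using 4; ring
    refine ContDiff.mul (ContDiff.cexp (ContDiff.mul (ContDiff.neg ?_) contDiff_const)) ?_
    · exact Complex.ofRealCLM.contDiff.comp (contDiff_const.mul contDiff_id)
    · exact Complex.ofRealCLM.contDiff.comp
        ((Real.contDiff_sin.comp (contDiff_const.mul (hw.contDiff_comp_abs 3))).mul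
        (Real.contDiff_cos.comp (contDiff_const.mul h1)))
  eq_zero ξ h := meyerWaveletHat_of_ge hw h
  norm_le ξ := by
    unfold meyerWaveletHat
    rw [norm_mul, Complex.norm_real, norm_mul,
      show (-((Real.pi * ξ : ℝ) : ℂ) * Complex.I) = ((-(Real.pi * ξ) : ℝ) : ℂ) * Complex.I by
        push_cast; ring, Complex.norm_exp_ofReal_mul_I, one_mul]
    exact mul_le_one₀ (Real.abs_sin_le_one _) (norm_nonneg _) (Real.abs_cos_le_one _)

/-- The phases `exp(-iπξ)` of two points at integer distance `r` differ by the sign `(-1)^r`, which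
makes the odd cross terms of the refinement identity cancel. -/
lemma meyerWaveletHat_mul_conj (w : ℝ → ℝ) (ξ : ℝ) (r : ℤ) :
    meyerWaveletHat w ξ * conj (meyerWaveletHat w (ξ + r)) =
      (-1) ^ r * (Real.sin (Real.pi / 2 * w (3 * |ξ| - 1)) *
        Real.cos (Real.pi / 2 * w (3 * |ξ| / 2 - 1)) *
        (Real.sin (Real.pi / 2 * w (3 * |ξ + r| - 1)) *
        Real.cos (Real.pi / 2 * w (3 * |ξ + r| / 2 - 1))) : ℝ) := by
  unfold meyerWaveletHat
  rw [map_mul, Complex.conj_ofReal, ← Complex.exp_conj]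
  have h1 : Complex.exp (-((Real.pi * ξ : ℝ) : ℂ) * Complex.I) *
      Complex.exp (conj (-((Real.pi * (ξ + r) : ℝ) : ℂ) * Complex.I)) = (-1) ^ r := by
    rw [← Complex.exp_add, ← Complex.exp_pi_mul_I, ← Complex.exp_int_mul]
    congr 1
    rw [map_mul, map_neg, Complex.conj_ofReal, Complex.conj_I]
    push_cast; ring
  rw [mul_mul_mul_comm, h1, ← Complex.ofReal_mul]

/-- For `r = 0` this is `sin² + cos² = 1`. For `r = ±1` in the overlap of the transition zones the
two angles are complementary, and the sign `-1` cancels the products. In all other cases supports or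
plateaus decide. -/
lemma meyer_refinement_real {w : ℝ → ℝ} (hw : IsMeyerAuxiliary w) (ξ : ℝ) (r : ℤ) :
    Real.cos (Real.pi / 2 * w (3 * |ξ| - 1)) * Real.cos (Real.pi / 2 * w (3 * |ξ + r| - 1)) +
      (-1) ^ r * (Real.sin (Real.pi / 2 * w (3 * |ξ| - 1)) *
        Real.cos (Real.pi / 2 * w (3 * |ξ| / 2 - 1)) *
        (Real.sin (Real.pi / 2 * w (3 * |ξ + r| - 1)) *
        Real.cos (Real.pi / 2 * w (3 * |ξ + r| / 2 - 1)))) =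
    if Even r then Real.cos (Real.pi / 2 * w (3 * |ξ| / 2 - 1)) *
      Real.cos (Real.pi / 2 * w (3 * |ξ + r| / 2 - 1)) else 0 := by
  have c2 : ∀ y : ℝ, y ≤ 2 / 3 → Real.cos (Real.pi / 2 * w (3 * y / 2 - 1)) = 1 := fun y hy => by
    rw [hw.eq_zero _ (by linarith)]; simp
  have c20 : ∀ y : ℝ, 4 / 3 ≤ y → Real.cos (Real.pi / 2 * w (3 * y / 2 - 1)) = 0 := fun y hy => by
    rw [hw.eq_one _ (by linarith)]; simp
  have c0 : ∀ y : ℝ, 2 / 3 ≤ y → Real.cos (Real.pi / 2 * w (3 * y - 1)) = 0 := fun y hy => by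
    rw [hw.eq_one _ (by linarith)]; simp
  have s1 : ∀ y : ℝ, 2 / 3 ≤ y → Real.sin (Real.pi / 2 * w (3 * y - 1)) = 1 := fun y hy => by
    rw [hw.eq_one _ (by linarith)]; simp
  have s0 : ∀ y : ℝ, y ≤ 1 / 3 → Real.sin (Real.pi / 2 * w (3 * y - 1)) = 0 := fun y hy => by
    rw [hw.eq_zero _ (by linarith)]; simp
  -- By `w(x) + w(1-x) = 1` the two angles add up to `π/2`, where the cosine of the sum vanishes.
  have anti : ∀ y z : ℝ, y + z = 1 → Real.cos (Real.pi / 2 * w (3 * y - 1)) *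
      Real.cos (Real.pi / 2 * w (3 * z - 1)) = Real.sin (Real.pi / 2 * w (3 * y - 1)) *
      Real.sin (Real.pi / 2 * w (3 * z - 1)) := fun y z h => by
    have h1 := hw.symm (3 * y - 1)
    rw [show 1 - (3 * y - 1) = 3 * z - 1 by linarith] at h1
    have h2 := Real.cos_add (Real.pi / 2 * w (3 * y - 1)) (Real.pi / 2 * w (3 * z - 1))
    rw [← mul_add, h1, mul_one, Real.cos_pi_div_two] at h2
    linarith
  rcases Int.even_or_odd r with he | ho
  · rw [if_pos he, he.neg_one_zpow]
    by_cases h0 : r = 0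
    · subst h0
      simp only [Int.cast_zero, add_zero]
      rcases le_total |ξ| (2 / 3) with h | h
      · rw [c2 _ h]
        nlinarith [Real.sin_sq_add_cos_sq (Real.pi / 2 * w (3 * |ξ| - 1))]
      · rw [c0 _ h, s1 _ h]; ring
    · have hr : (2 : ℝ) ≤ |(r : ℝ)| := by
        obtain ⟨q, rfl⟩ := he
        have : 1 ≤ |q| := Int.one_le_abs (by omega)
        have h2 : (2 : ℤ) ≤ |q + q| := by
          rcases abs_cases q with h | h <;> rcases abs_cases (q + q) with h' | h' <;> omega
        exact_mod_cast h2
      have ht : |(r : ℝ)| ≤ |ξ| + |ξ + r| := by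
        have := abs_sub (ξ + r) ξ
        rw [add_sub_cancel_left] at this; linarith
      rcases le_total |ξ| (2 / 3) with h | h
      · rw [c20 |ξ + r| (by linarith), c0 |ξ + r| (by linarith)]; ring
      · rw [c0 _ h, s1 _ h]
        rcases le_total |ξ + r| (2 / 3) with h' | h'
        · rw [c20 |ξ| (by linarith)]; ring
        · rw [s1 _ h']; ring
  · rw [if_neg (Int.not_even_iff_odd.mpr ho), ho.neg_one_zpow]
    -- An odd shift cannot carry the inner transition zone `1/3 < |ξ| ≤ 2/3` into `2/3 ≤ |ξ + r| <
    -- 4/3`, so one factor of the sine-cosine product is always zero.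
    have key : ∀ (ξ : ℝ) (r : ℤ), Odd r → |ξ| ≤ 2 / 3 → 2 / 3 ≤ |ξ + r| →
        |ξ| ≤ 1 / 3 ∨ 4 / 3 ≤ |ξ + r| := by
      intro ξ r ho h h'
      by_contra! hc
      obtain ⟨hc, hc'⟩ := hc
      obtain ⟨q, rfl⟩ := ho
      have hq : q = 0 ∨ q = -1 ∨ 1 ≤ q ∨ q ≤ -2 := by omega
      rcases hq with rfl | rfl | hq | hq
      · rw [show ((2 * 0 + 1 : ℤ) : ℝ) = 1 by norm_num] at h' hc'
        rcases abs_cases ξ with ⟨h1, h1'⟩ | ⟨h1, h1'⟩ <;>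
          rcases abs_cases (ξ + 1) with ⟨h2, h2'⟩ | ⟨h2, h2'⟩ <;>
          linarith
      · rw [show ((2 * -1 + 1 : ℤ) : ℝ) = -1 by norm_num] at h' hc'
        rcases abs_cases ξ with ⟨h1, h1'⟩ | ⟨h1, h1'⟩ <;>
          rcases abs_cases (ξ + -1) with ⟨h2, h2'⟩ | ⟨h2, h2'⟩ <;>
          linarith
      · have : (1 : ℝ) ≤ q := by exact_mod_cast hq
        push_cast at hc' h'
        linarith [le_abs_self (ξ + (2 * (q : ℝ) + 1)), neg_abs_le ξ]
      · have : (q : ℝ) ≤ -2 := by exact_mod_cast hq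
        push_cast at hc' h'
        linarith [neg_abs_le (ξ + (2 * (q : ℝ) + 1)), le_abs_self ξ]
    rcases le_total |ξ| (2 / 3) with h | h
    · rcases le_total |ξ + r| (2 / 3) with h' | h'
      · have hz : |ξ| + |ξ + r| = 1 := by
          have ht : |(r : ℝ)| ≤ |ξ| + |ξ + r| := by
            have := abs_sub (ξ + r) ξ
            rw [add_sub_cancel_left] at this; linarith
          have h2 : |(r : ℝ)| < 2 := by linarith
          have h3 : |r| < 2 := by exact_mod_cast h2
          have h4 : r = 1 ∨ r = -1 := by
            obtain ⟨q, rfl⟩ := ho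
            rw [abs_lt] at h3; omega
          rcases h4 with rfl | rfl
          · rw [show ((1 : ℤ) : ℝ) = 1 by norm_num] at *
            rw [abs_one] at ht
            rcases abs_cases ξ with ⟨h5, h5'⟩ | ⟨h5, h5'⟩ <;> rcases abs_cases (ξ + 1) with ⟨h6, h6'⟩ | ⟨h6, h6'⟩ <;> linarith
          · rw [show ((-1 : ℤ) : ℝ) = -1 by norm_num] at *
            rw [abs_neg, abs_one] at ht
            rcases abs_cases ξ with ⟨h5, h5'⟩ | ⟨h5, h5'⟩ <;> rcases abs_cases (ξ + -1) with ⟨h6, h6'⟩ | ⟨h6, h6'⟩ <;> linarith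
        rw [anti _ _ hz, c2 _ h, c2 _ h']; ring
      · rw [c0 _ h']
        rcases key ξ r ho h h' with h5 | h5
        · rw [s0 _ h5]; ring
        · rw [c20 _ h5]; ring
    · rcases le_total |ξ + r| (2 / 3) with h' | h'
      · rw [c0 _ h]
        have := key (ξ + r) (-r) ho.neg h' (by push_cast; simpa using h)
        push_cast at this
        rw [add_neg_cancel_right] at this
        rcases this with h5 | h5
        · rw [s0 _ h5]; ring
        · rw [c20 _ h5]; ring
      · rw [c0 _ h]
        by_cases h5 : 4 / 3 ≤ |ξ|
        · rw [c20 _ h5]; ring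
        by_cases h6 : 4 / 3 ≤ |ξ + r|
        · rw [c20 _ h6]; ring
        -- Two points with modulus in `[2/3, 4/3)` are at distance less than `2/3` if they have the
        -- same sign and in `[4/3, 8/3)` otherwise; no odd integer fits.
        exfalso
        push Not at h5 h6
        obtain ⟨q, rfl⟩ := ho
        have hq : q = 0 ∨ q = -1 ∨ 1 ≤ q ∨ q ≤ -2 := by omega
        rcases hq with rfl | rfl | hq | hq
        · rw [show ((2 * 0 + 1 : ℤ) : ℝ) = 1 by norm_num] at h' h6
          rcases abs_cases ξ with ⟨h1, h1'⟩ | ⟨h1, h1'⟩ <;>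
            rcases abs_cases (ξ + 1) with ⟨h2, h2'⟩ | ⟨h2, h2'⟩ <;>
            linarith
        · rw [show ((2 * -1 + 1 : ℤ) : ℝ) = -1 by norm_num] at h' h6
          rcases abs_cases ξ with ⟨h1, h1'⟩ | ⟨h1, h1'⟩ <;>
            rcases abs_cases (ξ + -1) with ⟨h2, h2'⟩ | ⟨h2, h2'⟩ <;>
            linarith
        · have : (1 : ℝ) ≤ q := by exact_mod_cast hq
          push_cast at h' h6
          linarith [le_abs_self (ξ + (2 * (q : ℝ) + 1)), neg_abs_le ξ]
        · have : (q : ℝ) ≤ -2 := by exact_mod_cast hq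
          push_cast at h' h6
          linarith [neg_abs_le (ξ + (2 * (q : ℝ) + 1)), le_abs_self ξ]

/-- The identity behind the refinement `V_{j+1} = V_j ⊕ W_j` of a Meyer multiresolution. -/
lemma meyer_refinement {w : ℝ → ℝ} (hw : IsMeyerAuxiliary w) (ξ : ℝ) (r : ℤ) :
    meyerScalingHat w ξ * conj (meyerScalingHat w (ξ + r)) +
      meyerWaveletHat w ξ * conj (meyerWaveletHat w (ξ + r)) =
    if Even r then meyerScalingHat w (ξ / 2) * conj (meyerScalingHat w ((ξ + r) / 2)) else 0 := by
  rw [meyerWaveletHat_mul_conj]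
  unfold meyerScalingHat
  simp only [Complex.conj_ofReal, abs_div, abs_two, ← mul_div_assoc]
  have h := meyer_refinement_real hw ξ r
  split_ifs at h ⊢ with he
  · rw [← Complex.ofReal_mul, ← Complex.ofReal_mul, ← h]; push_cast; ring
  · rw [← Complex.ofReal_mul, ← Complex.ofReal_zero, ← h]; push_cast; ring

/-! ### Character sums and reconstruction -/

lemma expMode_one_div_eq_one_iff {N : ℕ} (hN : 0 < N) (m : ℤ) :
    expMode m (1 / N) = 1 ↔ (N : ℤ) ∣ m := by
  unfold expMode
  rw [Complex.exp_eq_one_iff]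
  have hN' : (N : ℂ) ≠ 0 := by exact_mod_cast hN.ne'
  have hp : (2 * Real.pi * Complex.I : ℂ) ≠ 0 := by simp [Real.pi_ne_zero]
  constructor
  · rintro ⟨n, hn⟩
    have h1 : (2 * Real.pi * Complex.I : ℂ) * (-(m / N)) = (2 * Real.pi * Complex.I : ℂ) * n := by
      rw [mul_comm _ (n : ℂ), ← hn]; push_cast; ring
    have h2 := mul_left_cancel₀ hp h1
    have h3 : (m : ℂ) = N * (-n) := by
      field_simp at h2
      linear_combination -h2
    exact ⟨-n, by exact_mod_cast h3⟩
  · rintro ⟨n, rfl⟩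
    refine ⟨-n, ?_⟩
    push_cast
    field_simp

lemma expMode_nat_mul (m : ℤ) (i : ℕ) (t : ℝ) : expMode m (i * t) = expMode m t ^ i := by
  unfold expMode
  rw [← Complex.exp_nat_mul]; congr 1; push_cast; ring

lemma sum_expMode {N : ℕ} (hN : 0 < N) (m : ℤ) :
    ∑ i ∈ Finset.range N, expMode m (i / N) = if (N : ℤ) ∣ m then (N : ℂ) else 0 := by
  have h1 : ∀ i : ℕ, expMode m (i / N) = expMode m (1 / N) ^ i := fun i => by
    rw [← expMode_nat_mul]; congr 1; ring
  simp_rw [h1]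
  split_ifs with h
  · rw [(expMode_one_div_eq_one_iff hN m).mpr h]; simp
  · rw [geom_sum_eq (fun hc => h ((expMode_one_div_eq_one_iff hN m).mp hc)),
      ← expMode_nat_mul]
    have : ((N : ℝ) * (1 / N)) = ((1 : ℤ) : ℝ) := by
      have : (N : ℝ) ≠ 0 := by exact_mod_cast hN.ne'
      field_simp; simp
    rw [this, expMode_int]; simp

/-- The coefficient of the sequence `c` of Fourier coefficients against level `j`, position `k`. -/
def coefOf (h : ℝ → ℂ) (c : ℤ → ℂ) (j k : ℕ) : ℂ :=
  ∑ m ∈ modes j, c m * conj (modeCoef h j k m)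

lemma modeCoef_mul_conj (h : ℝ → ℂ) (j k : ℕ) (m m' : ℤ) :
    modeCoef h j k m * conj (modeCoef h j k m') =
      (((2 : ℝ) ^ j)⁻¹ : ℝ) * (h (m / 2 ^ j) * conj (h (m' / 2 ^ j))) *
        expMode (m - m') (k / ((2 ^ j : ℕ) : ℝ)) := by
  unfold modeCoef
  rw [map_mul, map_mul, Complex.conj_ofReal, conj_expMode, sub_eq_add_neg, expMode_add_mode]
  have h1 : ((2 : ℝ) ^ (-(j : ℝ) / 2) : ℝ) * ((2 : ℝ) ^ (-(j : ℝ) / 2) : ℝ) =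
      ((2 : ℝ) ^ j : ℝ)⁻¹ := by
    rw [← Real.rpow_add two_pos, ← Real.rpow_natCast, ← Real.rpow_neg two_pos.le]
    congr 1; ring
  rw [← h1]
  push_cast; ring

/-- Summation over the `2^j` positions is a character sum, so only frequencies congruent mod `2^j`
interact. -/
lemma sum_coefOf_mul_modeCoef (h : ℝ → ℂ) (c : ℤ → ℂ) (j : ℕ) (m : ℤ) :
    ∑ k ∈ Finset.range (2 ^ j), coefOf h c j k * modeCoef h j k m =
      ∑ m' ∈ modes j, if (2 ^ j : ℤ) ∣ m - m' then
        c m' * (h (m / 2 ^ j) * conj (h (m' / 2 ^ j))) else 0 := by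
  simp_rw [coefOf, Finset.sum_mul]
  rw [Finset.sum_comm]
  refine Finset.sum_congr rfl fun m' _ => ?_
  have h1 : ∀ k : ℕ, c m' * conj (modeCoef h j k m') * modeCoef h j k m =
      c m' * ((((2 : ℝ) ^ j)⁻¹ : ℝ) * (h (m / 2 ^ j) * conj (h (m' / 2 ^ j)))) *
        expMode (m - m') (k / ((2 ^ j : ℕ) : ℝ)) := fun k => by
    rw [mul_assoc, mul_comm (conj _), modeCoef_mul_conj, ← mul_assoc]
  simp_rw [h1]
  rw [← Finset.mul_sum, sum_expMode (by positivity)]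
  push_cast
  split_ifs
  · field_simp
  · simp

lemma modes_subset (j : ℕ) : modes j ⊆ modes (j + 1) := fun m hm => by
  rw [mem_modes] at hm ⊢
  exact hm.trans (by gcongr <;> simp)

/-- Frequencies at distance `2^j r` interact on level `j`, and on level `j + 1` exactly when `r` is
even; this is the dichotomy in `meyer_refinement`, applied at `m / 2^j`. -/
lemma projection_succ {w : ℝ → ℝ} (hw : IsMeyerAuxiliary w) (c : ℤ → ℂ) (j : ℕ) (m : ℤ) :
    ∑ k ∈ Finset.range (2 ^ (j + 1)), coefOf (meyerScalingHat w) c (j + 1) k *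
        modeCoef (meyerScalingHat w) (j + 1) k m =
      ∑ k ∈ Finset.range (2 ^ j), coefOf (meyerScalingHat w) c j k *
        modeCoef (meyerScalingHat w) j k m +
      ∑ k ∈ Finset.range (2 ^ j), coefOf (meyerWaveletHat w) c j k *
        modeCoef (meyerWaveletHat w) j k m := by
  have ext : ∀ h : ℝ → ℂ, IsBandKernel h →
      ∑ k ∈ Finset.range (2 ^ j), coefOf h c j k * modeCoef h j k m =
      ∑ m' ∈ modes (j + 1), if (2 ^ j : ℤ) ∣ m - m' then
        c m' * (h (m / 2 ^ j) * conj (h (m' / 2 ^ j))) else 0 := fun h hh => by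
    rw [sum_coefOf_mul_modeCoef]
    refine Finset.sum_subset (modes_subset j) fun m' _ hm' => ?_
    have : h (m' / 2 ^ j) = 0 := by
      by_contra hc
      exact hm' (hh.mem_modes hc)
    simp [this]
  rw [ext _ (isBandKernel_meyerScalingHat hw), ext _ (isBandKernel_meyerWaveletHat hw),
    sum_coefOf_mul_modeCoef, ← Finset.sum_add_distrib]
  refine Finset.sum_congr rfl fun m' _ => ?_
  by_cases hd : (2 ^ j : ℤ) ∣ m - m'
  · rw [if_pos hd, if_pos hd, ← mul_add]
    obtain ⟨r, hr⟩ := hd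
    have hm' : (m' : ℝ) / 2 ^ j = m / 2 ^ j + ((-r : ℤ) : ℝ) := by
      have : (m : ℝ) - m' = 2 ^ j * r := by exact_mod_cast hr
      push_cast
      field_simp
      linarith
    rw [hm', meyer_refinement hw]
    simp only [even_neg]
    have hdiv : (2 ^ (j + 1) : ℤ) ∣ m - m' ↔ Even r := by
      rw [hr, pow_succ, mul_dvd_mul_iff_left (by positivity), even_iff_two_dvd]
    simp_rw [hdiv, ← hm', div_div, ← pow_succ]
    split_ifs <;> simp
  · have hd' : ¬ (2 ^ (j + 1) : ℤ) ∣ m - m' := fun h =>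
      hd ((pow_dvd_pow 2 (Nat.le_succ j)).trans h)
    rw [if_neg hd, if_neg hd, if_neg hd', add_zero]

/-- The scaling kernel equals one at `m / 2^j`, and every other frequency congruent to `m` has
modulus at least `2/3 * 2^j`, where the kernel vanishes. -/
lemma projection_eq_of_le {w : ℝ → ℝ} (hw : IsMeyerAuxiliary w) (c : ℤ → ℂ) {j : ℕ} {m : ℤ}
    (hm : 3 * |(m : ℝ)| ≤ 2 ^ j) :
    ∑ k ∈ Finset.range (2 ^ j), coefOf (meyerScalingHat w) c j k *
        modeCoef (meyerScalingHat w) j k m = c m := by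
  have h2j : (0 : ℝ) < 2 ^ j := by positivity
  have hH : meyerScalingHat w (m / 2 ^ j) = 1 := by
    refine meyerScalingHat_of_le hw ?_
    rw [abs_div, abs_of_pos h2j, div_le_iff₀ h2j]; linarith
  rw [sum_coefOf_mul_modeCoef, Finset.sum_eq_single m]
  · simp [hH]
  · intro m' _ hne
    rw [ite_eq_right_iff]
    rintro ⟨r, hr⟩
    have hr0 : r ≠ 0 := by
      rintro rfl
      exact hne (by linarith)
    have : meyerScalingHat w (m' / 2 ^ j) = 0 := by
      refine meyerScalingHat_of_ge hw ?_
      rw [abs_div, abs_of_pos h2j, le_div_iff₀ h2j]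
      have h1 : (1 : ℝ) ≤ |(r : ℝ)| := by exact_mod_cast Int.one_le_abs hr0
      have h2 : |(m : ℝ) - m'| = 2 ^ j * |(r : ℝ)| := by
        rw [show (m : ℝ) - m' = 2 ^ j * r by exact_mod_cast hr, abs_mul, abs_of_pos h2j]
      have h3 := abs_sub (m : ℝ) m'
      nlinarith
    simp [this]
  · intro hc
    exact absurd ((isBandKernel_meyerScalingHat hw).mem_modes (by rw [hH]; exact one_ne_zero)) hc

/-- Expansion of a Fourier coefficient over the Meyer levels. -/
lemma meyer_reconstruction {w : ℝ → ℝ} (hw : IsMeyerAuxiliary w) (c : ℤ → ℂ) {j₀ j₁ : ℕ}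
    (hj : j₀ ≤ j₁) {m : ℤ} (hm : 3 * |(m : ℝ)| ≤ 2 ^ j₁) :
    c m = ∑ k ∈ Finset.range (2 ^ j₀), coefOf (meyerScalingHat w) c j₀ k *
        modeCoef (meyerScalingHat w) j₀ k m +
      ∑ j ∈ Finset.Ico j₀ j₁, ∑ k ∈ Finset.range (2 ^ j), coefOf (meyerWaveletHat w) c j k *
        modeCoef (meyerWaveletHat w) j k m := by
  rw [← projection_eq_of_le hw c hm]
  clear hm
  induction j₁, hj using Nat.le_induction with
  | base => simp
  | succ j hj ih => rw [projection_succ hw, ih, Finset.sum_Ico_succ_top hj, add_assoc]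

/-! ### Bessel inequalities -/

/-- An operator and its adjoint have the same norm: `‖A*v‖² = ⟨v, AA*v⟩`, and Cauchy-Schwarz bounds
this by `‖v‖ · √C · ‖A*v‖`. -/
lemma bessel_dual {ι κ : Type*} (S : Finset ι) (T : Finset κ) (A : ι → κ → ℂ) {C : ℝ} (hC : 0 ≤ C)
    (hA : ∀ x : κ → ℂ, ∑ i ∈ S, ‖∑ m ∈ T, A i m * x m‖ ^ 2 ≤ C * ∑ m ∈ T, ‖x m‖ ^ 2)
    (v : ι → ℂ) :
    ∑ m ∈ T, ‖∑ i ∈ S, conj (A i m) * v i‖ ^ 2 ≤ C * ∑ i ∈ S, ‖v i‖ ^ 2 := by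
  set x : κ → ℂ := fun m => ∑ i ∈ S, conj (A i m) * v i with hx
  set y : ι → ℂ := fun i => ∑ m ∈ T, A i m * x m with hy
  set Q : ℝ := ∑ m ∈ T, ‖x m‖ ^ 2 with hQ
  set V : ℝ := ∑ i ∈ S, ‖v i‖ ^ 2 with hV
  have hQ0 : 0 ≤ Q := Finset.sum_nonneg fun _ _ => by positivity
  have hV0 : 0 ≤ V := Finset.sum_nonneg fun _ _ => by positivity
  have h1 : (Q : ℂ) = ∑ i ∈ S, v i * conj (y i) := by
    have : ∀ m, ((‖x m‖ ^ 2 : ℝ) : ℂ) = ∑ i ∈ S, v i * (conj (A i m) * conj (x m)) := fun m => by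
      rw [Complex.ofReal_pow, ← Complex.mul_conj', hx, Finset.sum_mul]
      exact Finset.sum_congr rfl fun i _ => by ring
    rw [hQ, Complex.ofReal_sum]
    simp_rw [this]
    rw [Finset.sum_comm]
    refine Finset.sum_congr rfl fun i _ => ?_
    rw [← Finset.mul_sum, hy, map_sum]
    simp_rw [map_mul]
  have h2 : Q ≤ ∑ i ∈ S, ‖v i‖ * ‖y i‖ := by
    have : Q = ‖(Q : ℂ)‖ := by rw [Complex.norm_real, Real.norm_of_nonneg hQ0]
    rw [this, h1]
    refine (norm_sum_le _ _).trans (Finset.sum_le_sum fun i _ => ?_)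
    rw [norm_mul, RCLike.norm_conj]
  have h3 := Finset.sum_mul_sq_le_sq_mul_sq S (fun i => ‖v i‖) (fun i => ‖y i‖)
  have h4 := hA x
  have h5 : Q ^ 2 ≤ V * (C * Q) := by
    calc Q ^ 2 ≤ (∑ i ∈ S, ‖v i‖ * ‖y i‖) ^ 2 := by gcongr
      _ ≤ _ := h3
      _ ≤ _ := by gcongr
  rcases hQ0.eq_or_lt with h0 | h0
  · rw [← h0]; positivity
  · nlinarith

/-- Within a residue class a frequency is determined by its integer quotient by `N`, which is one of
`-2, …, 2`. -/
lemma card_residue_le {N : ℕ} (hN : 0 < N) {F : Finset ℤ} (hF : ∀ m ∈ F, |m| ≤ 2 * N) (m : ℤ) :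
    (F.filter fun m' => (N : ℤ) ∣ m - m').card ≤ 5 := by
  change _ ≤ (Finset.Icc (-2 : ℤ) 2).card
  refine Finset.card_le_card_of_injOn (fun m' => m' / N) (fun m' hm' => ?_) ?_
  · have h2 := hF m' (Finset.mem_filter.mp hm').1
    rw [abs_le] at h2
    have hN' : (0 : ℤ) < N := by exact_mod_cast hN
    simp only [Finset.coe_Icc, Set.mem_Icc]
    constructor
    · rw [Int.le_ediv_iff_mul_le hN']; linarith
    · refine Int.ediv_le_of_le_mul hN' (by linarith)
  · intro a ha b hb hab
    have ha' := (Finset.mem_filter.mp ha).2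
    have hb' := (Finset.mem_filter.mp hb).2
    have hd : (N : ℤ) ∣ b - a := by
      have := dvd_sub ha' hb'
      rwa [sub_sub_sub_cancel_left] at this
    have he : a % N = b % N := Int.modEq_iff_dvd.mpr hd
    simp only at hab
    rw [← Int.mul_ediv_add_emod a N, ← Int.mul_ediv_add_emod b N, hab, he]

/-- Expanding the square, orthogonality of characters leaves pairs congruent mod `N`. By `2ab ≤ a² +
b²` each frequency is counted at most five times. -/
lemma dft_bessel {N : ℕ} (hN : 0 < N) {F : Finset ℤ} (hF : ∀ m ∈ F, |m| ≤ 2 * N) (x : ℤ → ℂ) :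
    ∑ i ∈ Finset.range N, ‖∑ m ∈ F, expMode m (i / N) * x m‖ ^ 2 ≤
      5 * N * ∑ m ∈ F, ‖x m‖ ^ 2 := by
  have hcard : ∀ m : ℤ, ((F.filter fun m' => (N : ℤ) ∣ m - m').card : ℝ) ≤ 5 := fun m => by
    exact_mod_cast card_residue_le hN hF m
  have hexp : ∀ i : ℕ, ((‖∑ m ∈ F, expMode m (i / N) * x m‖ ^ 2 : ℝ) : ℂ) =
      ∑ m ∈ F, ∑ m' ∈ F, x m * conj (x m') * expMode (m - m') (i / N) := fun i => by
    rw [Complex.ofReal_pow, ← Complex.mul_conj', map_sum, Finset.sum_mul_sum]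
    refine Finset.sum_congr rfl fun m _ => Finset.sum_congr rfl fun m' _ => ?_
    rw [map_mul, conj_expMode, sub_eq_add_neg, expMode_add_mode]; ring
  set R : ℝ := ∑ i ∈ Finset.range N, ‖∑ m ∈ F, expMode m (i / N) * x m‖ ^ 2 with hR
  have h2 : (R : ℂ) = ∑ m ∈ F, ∑ m' ∈ F,
      if (N : ℤ) ∣ m - m' then N * (x m * conj (x m')) else 0 := by
    rw [hR, Complex.ofReal_sum]
    simp_rw [hexp]
    rw [Finset.sum_comm]
    refine Finset.sum_congr rfl fun m _ => ?_
    rw [Finset.sum_comm]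
    refine Finset.sum_congr rfl fun m' _ => ?_
    rw [← Finset.mul_sum, sum_expMode hN]
    split_ifs <;> ring
  have hR0 : 0 ≤ R := Finset.sum_nonneg fun _ _ => by positivity
  have h3 : R ≤ ∑ m ∈ F, ∑ m' ∈ F,
      if (N : ℤ) ∣ m - m' then N * (‖x m‖ ^ 2 / 2) + N * (‖x m'‖ ^ 2 / 2) else 0 := by
    have : R = ‖(R : ℂ)‖ := by rw [Complex.norm_real, Real.norm_of_nonneg hR0]
    rw [this, h2]
    refine (norm_sum_le _ _).trans (Finset.sum_le_sum fun m _ => (norm_sum_le _ _).trans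
      (Finset.sum_le_sum fun m' _ => ?_))
    split_ifs
    · rw [norm_mul, norm_mul, RCLike.norm_conj, Complex.norm_natCast, ← mul_add]
      gcongr
      nlinarith [sq_nonneg (‖x m‖ - ‖x m'‖)]
    · simp
  have h4 : ∑ m ∈ F, ∑ m' ∈ F, (if (N : ℤ) ∣ m - m' then (N : ℝ) * (‖x m‖ ^ 2 / 2) else 0) ≤
      ∑ m ∈ F, 5 * ((N : ℝ) * (‖x m‖ ^ 2 / 2)) := by
    refine Finset.sum_le_sum fun m _ => ?_
    rw [← Finset.sum_filter, Finset.sum_const, nsmul_eq_mul]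
    gcongr
    exact hcard m
  have h5 : ∑ m ∈ F, ∑ m' ∈ F, (if (N : ℤ) ∣ m - m' then (N : ℝ) * (‖x m'‖ ^ 2 / 2) else 0) ≤
      ∑ m ∈ F, 5 * ((N : ℝ) * (‖x m‖ ^ 2 / 2)) := by
    rw [Finset.sum_comm]
    simp_rw [dvd_sub_comm (b := (_ : ℤ))]
    exact h4
  have h6 : ∑ m ∈ F, ∑ m' ∈ F,
      (if (N : ℤ) ∣ m - m' then N * (‖x m‖ ^ 2 / 2) + N * (‖x m'‖ ^ 2 / 2) else 0) =
      ∑ m ∈ F, ∑ m' ∈ F, (if (N : ℤ) ∣ m - m' then (N : ℝ) * (‖x m‖ ^ 2 / 2) else 0) +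
      ∑ m ∈ F, ∑ m' ∈ F, (if (N : ℤ) ∣ m - m' then (N : ℝ) * (‖x m'‖ ^ 2 / 2) else 0) := by
    rw [← Finset.sum_add_distrib]
    refine Finset.sum_congr rfl fun m _ => ?_
    rw [← Finset.sum_add_distrib]
    refine Finset.sum_congr rfl fun m' _ => ?_
    split_ifs <;> simp
  rw [h6] at h3
  have h7 : ∑ m ∈ F, 5 * ((N : ℝ) * (‖x m‖ ^ 2 / 2)) + ∑ m ∈ F, 5 * ((N : ℝ) * (‖x m‖ ^ 2 / 2)) =
      5 * N * ∑ m ∈ F, ‖x m‖ ^ 2 := by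
    rw [← Finset.sum_add_distrib, Finset.mul_sum]
    exact Finset.sum_congr rfl fun m _ => by ring
  linarith

/-- The normalization `2^{-j/2}` cancels the factor `2^j` of the discrete transform, and the kernel
is bounded by one. -/
lemma IsBandKernel.analysis_bessel {h : ℝ → ℂ} (hh : IsBandKernel h) (j : ℕ) (x : ℤ → ℂ) :
    ∑ k ∈ Finset.range (2 ^ j), ‖∑ m ∈ modes j, conj (modeCoef h j k m) * x m‖ ^ 2 ≤
      5 * ∑ m ∈ modes j, ‖x m‖ ^ 2 := by
  have h1 := dft_bessel (N := 2 ^ j) (by positivity) (F := modes j)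
    (fun m hm => by
      rw [MultichannelDeconvolution.mem_modes] at hm; push_cast; rwa [pow_succ, mul_comm] at hm)
    (fun m => ((2 : ℝ) ^ (-(j : ℝ) / 2) : ℝ) * h (m / 2 ^ j) * conj (x m))
  have h2 : ∀ k : ℕ, ‖∑ m ∈ modes j, conj (modeCoef h j k m) * x m‖ =
      ‖∑ m ∈ modes j, expMode m (k / (2 ^ j : ℕ)) *
        (((2 : ℝ) ^ (-(j : ℝ) / 2) : ℝ) * h (m / 2 ^ j) * conj (x m))‖ := fun k => by
    rw [← RCLike.norm_conj, map_sum]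
    congr 1
    refine Finset.sum_congr rfl fun m _ => ?_
    rw [map_mul, Complex.conj_conj, modeCoef]; push_cast; ring
  simp_rw [h2]
  refine h1.trans ?_
  rw [mul_assoc, Finset.mul_sum, Finset.mul_sum, Finset.mul_sum]
  refine Finset.sum_le_sum fun m _ => ?_
  gcongr
  rw [norm_mul, norm_mul, RCLike.norm_conj, Complex.norm_real, mul_pow, mul_pow, Real.norm_eq_abs,
    sq_abs, ← Real.rpow_natCast (_ ^ _), ← Real.rpow_mul two_pos.le]
  have h3 : ((2 ^ j : ℕ) : ℝ) * (2 : ℝ) ^ (-(j : ℝ) / 2 * ((2 : ℕ) : ℝ)) = 1 := by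
    push_cast
    rw [div_mul_cancel₀ _ two_ne_zero, Real.rpow_neg two_pos.le, Real.rpow_natCast]
    field_simp
  rw [← mul_assoc, ← mul_assoc, h3, one_mul]
  have h4 : ‖h (m / 2 ^ j)‖ ^ 2 ≤ 1 := pow_le_one₀ (norm_nonneg _) (hh.norm_le _)
  nlinarith [sq_nonneg ‖x m‖]

lemma IsBandKernel.synthesis_bessel {h : ℝ → ℂ} (hh : IsBandKernel h) (j : ℕ) (v : ℕ → ℂ) :
    ∑ m ∈ modes j, ‖∑ k ∈ Finset.range (2 ^ j), v k * modeCoef h j k m‖ ^ 2 ≤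
      5 * ∑ k ∈ Finset.range (2 ^ j), ‖v k‖ ^ 2 := by
  have h1 := bessel_dual (Finset.range (2 ^ j)) (modes j)
    (fun k m => conj (modeCoef h j k m)) (by norm_num) (hh.analysis_bessel j) v
  simpa [mul_comm] using h1

/-- The restriction to the band matters: aliasing errors are controlled only at frequencies that the
sampling rate resolves. -/
lemma IsBandKernel.sum_sq_coefOf_le {h : ℝ → ℂ} (hh : IsBandKernel h) (j : ℕ) (x : ℤ → ℂ) :
    ∑ k ∈ Finset.range (2 ^ j), ‖coefOf h x j k‖ ^ 2 ≤
      5 * ∑ m ∈ (modes j).filter (fun m : ℤ => h (m / 2 ^ j) ≠ 0), ‖x m‖ ^ 2 := by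
  have h1 := hh.analysis_bessel j fun m => if h (m / 2 ^ j) ≠ 0 then x m else 0
  have h2 : ∀ k, coefOf h x j k = ∑ m ∈ modes j, conj (modeCoef h j k m) *
      (if h (m / 2 ^ j) ≠ 0 then x m else 0) := fun k => by
    refine Finset.sum_congr rfl fun m _ => ?_
    split_ifs with h3
    · ring
    · push Not at h3
      simp [modeCoef, h3]
  simp_rw [h2]
  refine h1.trans (le_of_eq ?_)
  rw [Finset.sum_filter]
  congr 1
  refine Finset.sum_congr rfl fun m _ => ?_
  split_ifs <;> simp

/-! ### Square norms of multilevel expansions -/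

lemma meyerWaveletHat_support {w : ℝ → ℝ} (hw : IsMeyerAuxiliary w) {j : ℕ} {m : ℤ}
    (h : meyerWaveletHat w (m / 2 ^ j) ≠ 0) :
    (2 : ℝ) ^ j < 3 * |(m : ℝ)| ∧ 3 * |(m : ℝ)| < 4 * 2 ^ j := by
  have h2j : (0 : ℝ) < 2 ^ j := by positivity
  constructor
  · by_contra! hc
    refine h (meyerWaveletHat_of_le hw ?_)
    rw [abs_div, abs_of_pos h2j, div_le_iff₀ h2j]; linarith
  · have := (isBandKernel_meyerWaveletHat hw).abs_lt h
    linarith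

lemma meyerScalingHat_support {w : ℝ → ℝ} (hw : IsMeyerAuxiliary w) {j : ℕ} {m : ℤ}
    (h : meyerScalingHat w (m / 2 ^ j) ≠ 0) : 3 * |(m : ℝ)| < 2 * 2 ^ j := by
  have h2j : (0 : ℝ) < 2 ^ j := by positivity
  by_contra! hc
  refine h (meyerScalingHat_of_ge hw ?_)
  rw [abs_div, abs_of_pos h2j, le_div_iff₀ h2j]; linarith

lemma sum_mul_modeCoef_eq_zero {h : ℝ → ℂ} {j : ℕ} {m : ℤ} (hm : h (m / 2 ^ j) = 0) (S : Finset ℕ)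
    (v : ℕ → ℂ) : ∑ k ∈ S, v k * modeCoef h j k m = 0 :=
  Finset.sum_eq_zero fun k _ => by simp [modeCoef, hm]

/-- The band of level `j` is `2^j < 3|m| < 4 * 2^j`, so only the smallest level that contains `m`
and the next one qualify. -/
lemma card_levels_le {w : ℝ → ℝ} (hw : IsMeyerAuxiliary w) (S : Finset ℕ) (m : ℤ) :
    (S.filter fun j => meyerWaveletHat w (m / 2 ^ j) ≠ 0).card ≤ 2 := by
  set T := S.filter fun j => meyerWaveletHat w (m / 2 ^ j) ≠ 0 with hT
  rcases T.eq_empty_or_nonempty with h | h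
  · simp [h]
  · have hsub : T ⊆ {T.min' h, T.min' h + 1} := by
      intro j hj
      have h1 := T.min'_le j hj
      have h2 := (meyerWaveletHat_support hw (Finset.mem_filter.mp hj).2).1
      have h3 := (meyerWaveletHat_support hw (Finset.mem_filter.mp (T.min'_mem h)).2).2
      have h4 : (2 : ℝ) ^ j < 2 ^ (T.min' h + 2) := by rw [pow_add]; linarith
      have h5 : j < T.min' h + 2 := (pow_lt_pow_iff_right₀ one_lt_two).mp h4
      simp only [Finset.mem_insert, Finset.mem_singleton]
      omega
    exact (Finset.card_le_card hsub).trans Finset.card_le_two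

/-- With at most two active levels, `‖b‖² ≤ 2 Σ ‖b_j‖²` for the wavelet part `b`; combined with `(x
+ y)² ≤ 3x² + 3/2 y²` this gives the constant 3. -/
lemma sq_norm_multilevel_le {w : ℝ → ℝ} (hw : IsMeyerAuxiliary w) (S : Finset ℕ) (m : ℤ) (a : ℂ)
    (v : ℕ → ℕ → ℂ) :
    ‖a + ∑ j ∈ S, ∑ k ∈ Finset.range (2 ^ j), v j k * modeCoef (meyerWaveletHat w) j k m‖ ^ 2 ≤
      3 * (‖a‖ ^ 2 + ∑ j ∈ S, ‖∑ k ∈ Finset.range (2 ^ j),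
        v j k * modeCoef (meyerWaveletHat w) j k m‖ ^ 2) := by
  set B : ℕ → ℂ := fun j => ∑ k ∈ Finset.range (2 ^ j),
    v j k * modeCoef (meyerWaveletHat w) j k m with hB
  set T := S.filter fun j => meyerWaveletHat w (m / 2 ^ j) ≠ 0 with hT
  have h1 : ∑ j ∈ S, B j = ∑ j ∈ T, B j := by
    rw [hT, Finset.sum_filter_of_ne]
    intro j _ hj hc
    exact hj (sum_mul_modeCoef_eq_zero hc _ _)
  have h2 : ‖∑ j ∈ T, B j‖ ^ 2 ≤ 2 * ∑ j ∈ S, ‖B j‖ ^ 2 := by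
    calc ‖∑ j ∈ T, B j‖ ^ 2 ≤ (∑ j ∈ T, ‖B j‖) ^ 2 := by gcongr; exact norm_sum_le _ _
      _ ≤ T.card * ∑ j ∈ T, ‖B j‖ ^ 2 := sq_sum_le_card_mul_sum_sq
      _ ≤ 2 * ∑ j ∈ S, ‖B j‖ ^ 2 := by
        gcongr
        · have := card_levels_le hw S m
          rw [← hT] at this
          exact_mod_cast this
        · exact Finset.filter_subset _ _
  change ‖a + ∑ j ∈ S, B j‖ ^ 2 ≤ 3 * (‖a‖ ^ 2 + ∑ j ∈ S, ‖B j‖ ^ 2)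
  rw [h1]
  have h3 := norm_add_le a (∑ j ∈ T, B j)
  have h4 : ‖a + ∑ j ∈ T, B j‖ ^ 2 ≤ (‖a‖ + ‖∑ j ∈ T, B j‖) ^ 2 := by gcongr
  nlinarith [sq_nonneg (2 * ‖a‖ - ‖∑ j ∈ T, B j‖), norm_nonneg a]

lemma enorm_sq_eq_ofReal (z : ℂ) : ‖z‖ₑ ^ 2 = ENNReal.ofReal (‖z‖ ^ 2) := by
  rw [ENNReal.ofReal_pow (norm_nonneg _), ofReal_norm]

lemma IsBandKernel.tsum_synthesis_le {h : ℝ → ℂ} (hh : IsBandKernel h) (j : ℕ) (v : ℕ → ℂ) :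
    ∑' m : ℤ, ‖∑ k ∈ Finset.range (2 ^ j), v k * modeCoef h j k m‖ₑ ^ 2 ≤
      5 * ENNReal.ofReal (∑ k ∈ Finset.range (2 ^ j), ‖v k‖ ^ 2) := by
  rw [tsum_eq_sum (s := modes j)]
  · simp_rw [enorm_sq_eq_ofReal]
    rw [← ENNReal.ofReal_sum_of_nonneg fun _ _ => by positivity,
      show (5 : ℝ≥0∞) = ENNReal.ofReal 5 by simp, ← ENNReal.ofReal_mul (by norm_num)]
    exact ENNReal.ofReal_le_ofReal (hh.synthesis_bessel j v)
  · intro m hm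
    rw [Finset.sum_eq_zero]
    · simp
    · intro k _
      rw [hh.modeCoef_eq_zero k hm, mul_zero]

lemma fourierCoef_add {h h' : ℝ → ℂ} (hh : IntervalIntegrable h volume 0 1)
    (hh' : IntervalIntegrable h' volume 0 1) (m : ℤ) :
    fourierCoef (fun t => h t + h' t) m = fourierCoef h m + fourierCoef h' m := by
  unfold fourierCoef
  rw [← intervalIntegral.integral_add (IntervalIntegrable.expMode_mul hh m)
    (IntervalIntegrable.expMode_mul hh' m)]
  congr 1; ext t; ring

lemma fourierCoef_sum_mul {ι : Type*} (S : Finset ι) (c : ι → ℂ) {h : ι → ℝ → ℂ}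
    (hh : ∀ i, Continuous (h i)) (m : ℤ) :
    fourierCoef (fun t => ∑ i ∈ S, c i * h i t) m = ∑ i ∈ S, c i * fourierCoef (h i) m := by
  rw [fourierCoef_finset_sum S (h := fun i t => c i * h i t)
    fun i _ => (continuous_const.mul (hh i)).intervalIntegrable _ _]
  simp_rw [fourierCoef_const_mul]

/-- Error of a multilevel expansion with coefficients `α` and `β` in terms of the errors of its
coefficients. -/
lemma lintegral_multilevel_sub_le {w : ℝ → ℝ} (hw : IsMeyerAuxiliary w) {f : ℝ → ℝ}
    (hf : MemLp f 2 (volume.restrict (Set.Icc (0 : ℝ) 1))) {j₀ J : ℕ} (hJ : j₀ ≤ J)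
    (α : ℕ → ℂ) (β : ℕ → ℕ → ℂ) :
    ∫⁻ t in Set.Icc (0 : ℝ) 1, ‖(∑ k ∈ Finset.range (2 ^ j₀), α k * phi w j₀ k t +
        ∑ j ∈ Finset.Ico j₀ J, ∑ k ∈ Finset.range (2 ^ j), β j k * psi w j k t) - (f t : ℂ)‖ₑ ^ 2 ≤
      15 * (ENNReal.ofReal (∑ k ∈ Finset.range (2 ^ j₀), ‖α k - innerCoef f (phi w j₀ k)‖ ^ 2) +
        (∑ j ∈ Finset.Ico j₀ J, ENNReal.ofReal (∑ k ∈ Finset.range (2 ^ j),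
          ‖β j k - innerCoef f (psi w j k)‖ ^ 2) +
        ∑' i, ENNReal.ofReal (∑ k ∈ Finset.range (2 ^ (J + i)),
          ‖innerCoef f (psi w (J + i) k)‖ ^ 2))) := by
  have hH := isBandKernel_meyerScalingHat hw
  have hG := isBandKernel_meyerWaveletHat hw
  set c : ℤ → ℂ := fourierCoef (fun t => (f t : ℂ)) with hc
  set a : ℕ → ℂ := fun k => innerCoef f (phi w j₀ k) with ha
  set b : ℕ → ℕ → ℂ := fun j k => innerCoef f (psi w j k) with hb
  have ha' : ∀ k, a k = coefOf (meyerScalingHat w) c j₀ k :=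
    fun k => hH.innerCoef_periodized j₀ k hf
  have hb' : ∀ j k, b j k = coefOf (meyerWaveletHat w) c j k :=
    fun j k => hG.innerCoef_periodized j k hf
  have hphi : ∀ k, Continuous (phi w j₀ k) := fun k => hH.continuous_periodized j₀ k
  have hpsi : ∀ j k, Continuous (psi w j k) := fun j k => hG.continuous_periodized j k
  have hphi' : ∀ k m, fourierCoef (phi w j₀ k) m = modeCoef (meyerScalingHat w) j₀ k m :=
    fun k m => hH.fourierCoef_periodized j₀ k m
  have hpsi' : ∀ j k m, fourierCoef (psi w j k) m = modeCoef (meyerWaveletHat w) j k m :=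
    fun j k m => hG.fourierCoef_periodized j k m
  set e₁ : ℝ → ℂ := fun t => ∑ k ∈ Finset.range (2 ^ j₀), α k * phi w j₀ k t with he₁
  set e₂ : ℝ → ℂ := fun t =>
    ∑ j ∈ Finset.Ico j₀ J, ∑ k ∈ Finset.range (2 ^ j), β j k * psi w j k t with he₂
  have he₁c : Continuous e₁ := continuous_finsetSum _ fun k _ => continuous_const.mul (hphi k)
  have he₂c : Continuous e₂ := continuous_finsetSum _ fun j _ => continuous_finsetSum _
    fun k _ => continuous_const.mul (hpsi j k)
  have hmem : MemLp (fun t => (e₁ t + e₂ t) - (f t : ℂ)) 2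
      (volume.restrict (Set.Icc (0 : ℝ) 1)) :=
    (memLp_of_continuous (he₁c.add he₂c)).sub hf.ofReal
  have hpar := parseval hmem
  have hest : ∀ m, fourierCoef (fun t => e₁ t + e₂ t) m =
      ∑ k ∈ Finset.range (2 ^ j₀), α k * modeCoef (meyerScalingHat w) j₀ k m +
      ∑ j ∈ Finset.Ico j₀ J, ∑ k ∈ Finset.range (2 ^ j),
        β j k * modeCoef (meyerWaveletHat w) j k m := fun m => by
    rw [fourierCoef_add (he₁c.intervalIntegrable 0 1) (he₂c.intervalIntegrable 0 1), he₁, he₂,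
      fourierCoef_sum_mul _ _ hphi, fourierCoef_finset_sum (Finset.Ico j₀ J)
      (h := fun j t => ∑ k ∈ Finset.range (2 ^ j), β j k * psi w j k t) fun j _ =>
      (continuous_finsetSum _ fun k _ => continuous_const.mul (hpsi j k)).intervalIntegrable _ _]
    simp_rw [fourierCoef_sum_mul _ _ (hpsi _), hphi', hpsi']
  -- Coefficient errors on all levels at once; from level `J` on the estimator is zero and the error
  -- is minus the true coefficient.
  set D : ℕ → ℕ → ℂ := fun j k => if j < J then β j k - b j k else - b j k with hD
  have hdiff : ∀ m : ℤ, ∀ j₁, J ≤ j₁ → 3 * |(m : ℝ)| ≤ 2 ^ j₁ →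
      fourierCoef (fun t => (e₁ t + e₂ t) - (f t : ℂ)) m =
      ∑ k ∈ Finset.range (2 ^ j₀), (α k - a k) * modeCoef (meyerScalingHat w) j₀ k m +
      ∑ j ∈ Finset.Ico j₀ j₁, ∑ k ∈ Finset.range (2 ^ j),
        D j k * modeCoef (meyerWaveletHat w) j k m := fun m j₁ hj₁ hm => by
    have hfi : IntervalIntegrable (fun t => (f t : ℂ)) volume 0 1 :=
      intervalIntegrable_of_memLp hf.ofReal
    rw [fourierCoef_sub (h := fun t => e₁ t + e₂ t) ((he₁c.add he₂c).intervalIntegrable 0 1)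
      hfi, hest]
    have := meyer_reconstruction hw c (hJ.trans hj₁) hm
    rw [show fourierCoef (fun t => (f t : ℂ)) m = c m from rfl, this]
    simp_rw [← ha', ← hb', sub_mul, Finset.sum_sub_distrib]
    have h3 : ∑ j ∈ Finset.Ico j₀ j₁, ∑ k ∈ Finset.range (2 ^ j),
        D j k * modeCoef (meyerWaveletHat w) j k m =
        ∑ j ∈ Finset.Ico j₀ J, ∑ k ∈ Finset.range (2 ^ j),
          β j k * modeCoef (meyerWaveletHat w) j k m -
        ∑ j ∈ Finset.Ico j₀ j₁, ∑ k ∈ Finset.range (2 ^ j),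
          b j k * modeCoef (meyerWaveletHat w) j k m := by
      have h4 : ∀ F : ℕ → ℂ, ∑ j ∈ Finset.Ico j₀ J, F j =
          ∑ j ∈ Finset.Ico j₀ j₁, if j < J then F j else 0 := fun F => by
        rw [← Finset.sum_filter]
        congr 1; ext j
        simp only [Finset.mem_Ico, Finset.mem_filter]; omega
      rw [h4, ← Finset.sum_sub_distrib]
      refine Finset.sum_congr rfl fun j _ => ?_
      by_cases hj : j < J
      · simp only [hD, hj, if_true, sub_mul, Finset.sum_sub_distrib]
      · simp [hD, hj]
    rw [h3]; ring
  have hbound : ∀ m : ℤ, ‖fourierCoef (fun t => (e₁ t + e₂ t) - (f t : ℂ)) m‖ₑ ^ 2 ≤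
      3 * (‖∑ k ∈ Finset.range (2 ^ j₀), (α k - a k) *
        modeCoef (meyerScalingHat w) j₀ k m‖ₑ ^ 2 +
      ∑' i, ‖∑ k ∈ Finset.range (2 ^ (j₀ + i)),
        D (j₀ + i) k * modeCoef (meyerWaveletHat w) (j₀ + i) k m‖ₑ ^ 2) := fun m => by
    -- The level at which `m` is fully reconstructed depends on `m`; the bound by the sum over all
    -- levels does not.
    obtain ⟨n, hn⟩ := pow_unbounded_of_one_lt (3 * |(m : ℝ)|) (one_lt_two (α := ℝ))
    have hn' : 3 * |(m : ℝ)| ≤ 2 ^ (max J n) :=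
      hn.le.trans (pow_le_pow_right₀ one_le_two (le_max_right _ _))
    rw [hdiff m _ (le_max_left J n) hn', enorm_sq_eq_ofReal]
    refine (ENNReal.ofReal_le_ofReal (sq_norm_multilevel_le hw _ m _ D)).trans ?_
    rw [ENNReal.ofReal_mul (by norm_num), ENNReal.ofReal_add (by positivity)
      (Finset.sum_nonneg fun _ _ => by positivity),
      ENNReal.ofReal_sum_of_nonneg fun _ _ => by positivity]
    simp_rw [← enorm_sq_eq_ofReal]
    rw [show ENNReal.ofReal 3 = 3 by simp, Finset.sum_Ico_eq_sum_range]
    gcongr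
    exact ENNReal.sum_le_tsum _
  change ∫⁻ t in Set.Icc (0 : ℝ) 1, ‖(e₁ t + e₂ t) - (f t : ℂ)‖ₑ ^ 2 ≤ _
  rw [hpar]
  refine (ENNReal.tsum_le_tsum hbound).trans ?_
  rw [ENNReal.tsum_mul_left, ENNReal.tsum_add, ENNReal.tsum_comm]
  have h5 : ∑' i, ∑' m : ℤ, ‖∑ k ∈ Finset.range (2 ^ (j₀ + i)),
        D (j₀ + i) k * modeCoef (meyerWaveletHat w) (j₀ + i) k m‖ₑ ^ 2 ≤
      5 * ∑' i, ENNReal.ofReal (∑ k ∈ Finset.range (2 ^ (j₀ + i)), ‖D (j₀ + i) k‖ ^ 2) := by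
    rw [← ENNReal.tsum_mul_left]
    exact ENNReal.tsum_le_tsum fun i => hG.tsum_synthesis_le _ _
  have h6 : ∑' i, ENNReal.ofReal (∑ k ∈ Finset.range (2 ^ (j₀ + i)), ‖D (j₀ + i) k‖ ^ 2) =
      ∑ j ∈ Finset.Ico j₀ J, ENNReal.ofReal (∑ k ∈ Finset.range (2 ^ j), ‖β j k - b j k‖ ^ 2) +
        ∑' i, ENNReal.ofReal (∑ k ∈ Finset.range (2 ^ (J + i)), ‖b (J + i) k‖ ^ 2) := by
    rw [← ENNReal.summable.sum_add_tsum_nat_add' (k := J - j₀), Finset.sum_Ico_eq_sum_range]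
    congr 1
    · refine Finset.sum_congr rfl fun i hi => ?_
      have : j₀ + i < J := by have := Finset.mem_range.mp hi; omega
      simp [hD, this]
    · refine tsum_congr fun i => ?_
      have h7 : j₀ + (i + (J - j₀)) = J + i := by omega
      rw [h7]
      simp [hD]
  rw [h6] at h5
  calc _ ≤ 3 * (5 * ENNReal.ofReal (∑ k ∈ Finset.range (2 ^ j₀), ‖α k - a k‖ ^ 2) +
      5 * (∑ j ∈ Finset.Ico j₀ J, ENNReal.ofReal (∑ k ∈ Finset.range (2 ^ j),
          ‖β j k - b j k‖ ^ 2) +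
        ∑' i, ENNReal.ofReal (∑ k ∈ Finset.range (2 ^ (J + i)), ‖b (J + i) k‖ ^ 2))) := by
        gcongr
        exact hH.tsum_synthesis_le _ _
    _ = _ := by rw [← mul_add, ← mul_assoc, show (3 : ℝ≥0∞) * 5 = 15 by norm_num]

/-! ### Decay of Fourier coefficients -/

lemma geom_rpow_sum_le {δ : ℝ} (hδ : 0 < δ) (S : Finset ℕ) :
    ∑ j ∈ S, (2 : ℝ) ^ (-((j : ℝ) * δ)) ≤ (1 - (2 : ℝ) ^ (-δ))⁻¹ := by
  have h1 : ∀ j : ℕ, (2 : ℝ) ^ (-((j : ℝ) * δ)) = ((2 : ℝ) ^ (-δ)) ^ j := fun j => by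
    rw [← Real.rpow_natCast, ← Real.rpow_mul two_pos.le]; congr 1; ring
  simp_rw [h1]
  have h2 : (2 : ℝ) ^ (-δ) < 1 := Real.rpow_lt_one_of_one_lt_of_neg one_lt_two (by linarith)
  have h3 : (0 : ℝ) ≤ (2 : ℝ) ^ (-δ) := by positivity
  rw [← tsum_geometric_of_lt_one h3 h2]
  exact (summable_geometric_of_lt_one h3 h2).sum_le_tsum _ fun _ _ => by positivity

lemma IsBandKernel.sum_synthesis_le {h : ℝ → ℂ} (hh : IsBandKernel h) (j : ℕ) (v : ℕ → ℂ)
    (F : Finset ℤ) :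
    ∑ m ∈ F, ‖∑ k ∈ Finset.range (2 ^ j), v k * modeCoef h j k m‖ ^ 2 ≤
      5 * ∑ k ∈ Finset.range (2 ^ j), ‖v k‖ ^ 2 := by
  refine le_trans ?_ (hh.synthesis_bessel j v)
  have h0 : ∀ m ∉ modes j, ‖∑ k ∈ Finset.range (2 ^ j), v k * modeCoef h j k m‖ ^ 2 = 0 := by
    intro m hm
    rw [Finset.sum_eq_zero fun k _ => by rw [hh.modeCoef_eq_zero k hm, mul_zero]]
    simp
  rw [← Finset.sum_subset (Finset.inter_subset_left (s₁ := F) (s₂ := modes j))]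
  · exact Finset.sum_le_sum_of_subset_of_nonneg Finset.inter_subset_right
      fun _ _ _ => by positivity
  · intro m hm hm'
    exact h0 m fun hc => hm' (Finset.mem_inter.mpr ⟨hm, hc⟩)

/-- The constant in the weighted summation of high-frequency Fourier coefficients. -/
def decayConst (κ s : ℝ) : ℝ := 15 * 2 ^ (2 * κ) * (1 - (2 : ℝ) ^ (-(2 * (s - κ))))⁻¹

lemma decayConst_pos {κ s : ℝ} (h : κ < s) : 0 < decayConst κ s := by
  unfold decayConst
  have : (2 : ℝ) ^ (-(2 * (s - κ))) < 1 :=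
    Real.rpow_lt_one_of_one_lt_of_neg one_lt_two (by linarith)
  have : 0 < 1 - (2 : ℝ) ^ (-(2 * (s - κ))) := by linarith
  positivity

/-- High-frequency part of a fractional Sobolev norm in terms of wavelet coefficients. -/
lemma sum_weighted_sq_fourierCoef_le {w : ℝ → ℝ} (hw : IsMeyerAuxiliary w) {f : ℝ → ℝ}
    (hf : MemLp f 2 (volume.restrict (Set.Icc (0 : ℝ) 1))) {j₀ : ℕ} {κ s B : ℝ} (hκ : 0 ≤ κ)
    (hκs : κ < s) (hb : ∀ j, j₀ ≤ j → ∑ k ∈ Finset.range (2 ^ j), ‖innerCoef f (psi w j k)‖ ^ 2 ≤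
      B * (2 : ℝ) ^ (-(2 * j * s))) {F : Finset ℤ}
    (hF : ∀ m ∈ F, 2 * (2 : ℝ) ^ j₀ ≤ 3 * |(m : ℝ)|) :
    ∑ m ∈ F, |(m : ℝ)| ^ (2 * κ) * ‖fourierCoef (fun t => (f t : ℂ)) m‖ ^ 2 ≤
      decayConst κ s * B := by
  have hG := isBandKernel_meyerWaveletHat hw
  set c : ℤ → ℂ := fourierCoef (fun t => (f t : ℂ)) with hc
  have hb' : ∀ j k, innerCoef f (psi w j k) = coefOf (meyerWaveletHat w) c j k :=
    fun j k => hG.innerCoef_periodized j k hf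
  simp_rw [hb'] at hb
  have hB : 0 ≤ B := by
    have h1 := hb j₀ le_rfl
    have h2 : 0 ≤ ∑ k ∈ Finset.range (2 ^ j₀), ‖coefOf (meyerWaveletHat w) c j₀ k‖ ^ 2 :=
      Finset.sum_nonneg fun _ _ => by positivity
    exact nonneg_of_mul_nonneg_left (h2.trans h1) (by positivity)
  obtain ⟨j₁, hj₁, hj₁'⟩ : ∃ j₁, j₀ ≤ j₁ ∧ ∀ m ∈ F, 3 * |(m : ℝ)| ≤ 2 ^ j₁ := by
    obtain ⟨n, hn⟩ := pow_unbounded_of_one_lt (∑ m ∈ F, 3 * |(m : ℝ)|) (one_lt_two (α := ℝ))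
    refine ⟨max j₀ n, le_max_left _ _, fun m hm => ?_⟩
    calc 3 * |(m : ℝ)| ≤ ∑ m ∈ F, 3 * |(m : ℝ)| :=
          Finset.single_le_sum (f := fun m : ℤ => 3 * |(m : ℝ)|) (fun _ _ => by positivity) hm
      _ ≤ 2 ^ n := hn.le
      _ ≤ _ := pow_le_pow_right₀ one_le_two (le_max_right _ _)
  set Bf : ℕ → ℤ → ℂ := fun j m => ∑ k ∈ Finset.range (2 ^ j),
    coefOf (meyerWaveletHat w) c j k * modeCoef (meyerWaveletHat w) j k m with hBf
  have h1 : ∀ m ∈ F, |(m : ℝ)| ^ (2 * κ) * ‖c m‖ ^ 2 ≤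
      3 * ∑ j ∈ Finset.Ico j₀ j₁, (2 * 2 ^ j : ℝ) ^ (2 * κ) * ‖Bf j m‖ ^ 2 := by
    intro m hm
    have h2 := sq_norm_multilevel_le hw (Finset.Ico j₀ j₁) m 0 (coefOf (meyerWaveletHat w) c)
    have h3 := meyer_reconstruction hw c hj₁ (hj₁' m hm)
    -- These frequencies lie beyond the support of the scaling function of level `j₀`, so only
    -- wavelet levels contribute.
    have h4 : meyerScalingHat w (m / 2 ^ j₀) = 0 := by
      by_contra hcc
      have := meyerScalingHat_support hw hcc
      linarith [hF m hm]
    rw [sum_mul_modeCoef_eq_zero h4] at h3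
    rw [← h3] at h2
    calc |(m : ℝ)| ^ (2 * κ) * ‖c m‖ ^ 2
        ≤ |(m : ℝ)| ^ (2 * κ) * (3 * ∑ j ∈ Finset.Ico j₀ j₁, ‖Bf j m‖ ^ 2) := by
          gcongr
          simpa using h2
      _ = 3 * ∑ j ∈ Finset.Ico j₀ j₁, |(m : ℝ)| ^ (2 * κ) * ‖Bf j m‖ ^ 2 := by
          rw [← Finset.mul_sum]; ring
      _ ≤ _ := by
          gcongr 3 * ?_
          refine Finset.sum_le_sum fun j _ => ?_
          by_cases h5 : meyerWaveletHat w (m / 2 ^ j) = 0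
          · have : Bf j m = 0 := sum_mul_modeCoef_eq_zero h5 _ _
            simp [this]
          · have h6 := (meyerWaveletHat_support hw h5).2
            gcongr
            linarith [pow_pos (two_pos : (0 : ℝ) < 2) j]
  calc ∑ m ∈ F, |(m : ℝ)| ^ (2 * κ) * ‖c m‖ ^ 2
      ≤ ∑ m ∈ F, 3 * ∑ j ∈ Finset.Ico j₀ j₁, (2 * 2 ^ j : ℝ) ^ (2 * κ) * ‖Bf j m‖ ^ 2 :=
        Finset.sum_le_sum h1
    _ = 3 * ∑ j ∈ Finset.Ico j₀ j₁, (2 * 2 ^ j : ℝ) ^ (2 * κ) * ∑ m ∈ F, ‖Bf j m‖ ^ 2 := by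
        rw [← Finset.mul_sum, Finset.sum_comm]; simp_rw [← Finset.mul_sum]
    _ ≤ 3 * ∑ j ∈ Finset.Ico j₀ j₁, (2 * 2 ^ j : ℝ) ^ (2 * κ) *
          (5 * (B * (2 : ℝ) ^ (-(2 * j * s)))) := by
        gcongr 3 * ?_
        refine Finset.sum_le_sum fun j hj => ?_
        gcongr
        exact (hG.sum_synthesis_le j _ F).trans
          (by gcongr; exact hb j (Finset.mem_Ico.mp hj).1)
    _ = 15 * 2 ^ (2 * κ) * B * ∑ j ∈ Finset.Ico j₀ j₁, (2 : ℝ) ^ (-((j : ℝ) * (2 * (s - κ)))) := by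
        rw [Finset.mul_sum, Finset.mul_sum]
        refine Finset.sum_congr rfl fun j _ => ?_
        have h7 : (2 : ℝ) ^ (-((j : ℝ) * (2 * (s - κ)))) =
            ((2 : ℝ) ^ j) ^ (2 * κ) * (2 : ℝ) ^ (-(2 * j * s)) := by
          rw [← Real.rpow_natCast, ← Real.rpow_mul two_pos.le, ← Real.rpow_add two_pos]
          congr 1; ring
        rw [h7, Real.mul_rpow (by norm_num) (by positivity)]; ring
    _ ≤ 15 * 2 ^ (2 * κ) * B * (1 - (2 : ℝ) ^ (-(2 * (s - κ))))⁻¹ := by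
        gcongr
        exact geom_rpow_sum_le (by linarith) _
    _ = _ := by unfold decayConst; ring

/-- With `y = |m|^{2κ}` and `1/2 < κ < s`, one has `2|c_m| ≤ y |c_m|² + y⁻¹`, and both terms are
summable over high frequencies. -/
lemma summable_fourierCoef {w : ℝ → ℝ} (hw : IsMeyerAuxiliary w) {f : ℝ → ℝ}
    (hf : MemLp f 2 (volume.restrict (Set.Icc (0 : ℝ) 1))) {j₀ : ℕ} {s B : ℝ} (hs : 1 / 2 < s)
    (hb : ∀ j, j₀ ≤ j → ∑ k ∈ Finset.range (2 ^ j), ‖innerCoef f (psi w j k)‖ ^ 2 ≤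
      B * (2 : ℝ) ^ (-(2 * j * s))) :
    Summable fun m => ‖fourierCoef (fun t => (f t : ℂ)) m‖ := by
  set c : ℤ → ℂ := fourierCoef (fun t => (f t : ℂ)) with hc
  obtain ⟨κ, hκ, hκs⟩ := exists_between hs
  set P : ℤ → Prop := fun m => 2 * (2 : ℝ) ^ j₀ ≤ 3 * |(m : ℝ)| with hP
  classical
  have h1 : Summable fun m : ℤ => if P m then |(m : ℝ)| ^ (2 * κ) * ‖c m‖ ^ 2 else 0 := by
    refine summable_of_sum_le (c := decayConst κ s * B)
      (fun m => by simp only [Pi.zero_apply]; split_ifs <;> positivity) fun F => ?_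
    rw [← Finset.sum_filter]
    exact sum_weighted_sq_fourierCoef_le hw hf (by linarith) hκs hb
      fun m hm => (Finset.mem_filter.mp hm).2
  have h2 : Summable fun m : ℤ => |(m : ℝ)| ^ (-(2 * κ)) :=
    Real.summable_abs_int_rpow (by linarith)
  have h3 : Summable fun m : ℤ => if P m then 0 else ‖c m‖ := by
    refine summable_of_ne_finset_zero (s := Finset.Icc (-2 ^ j₀) (2 ^ j₀)) fun m hm => ?_
    rw [if_pos]
    by_contra hcc
    refine hm ?_
    rw [Finset.mem_Icc, ← abs_le]
    have : ((|m| : ℤ) : ℝ) ≤ ((2 ^ j₀ : ℤ) : ℝ) := by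
      push_cast
      simp only [hP, not_le] at hcc
      linarith [pow_pos (two_pos : (0 : ℝ) < 2) j₀]
    exact_mod_cast this
  refine Summable.of_nonneg_of_le (fun _ => norm_nonneg _) (fun m => ?_) ((h1.add h2).add h3)
  by_cases hm : P m
  · simp only [hm, if_true, add_zero]
    have hm0 : (0 : ℝ) < |(m : ℝ)| := by
      have : (0 : ℝ) < 2 ^ j₀ := by positivity
      simp only [hP] at hm; linarith
    have h4 : |(m : ℝ)| ^ (2 * κ) * ‖c m‖ ^ 2 + |(m : ℝ)| ^ (-(2 * κ)) ≥ 2 * ‖c m‖ := by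
      rw [Real.rpow_neg hm0.le]
      set y := |(m : ℝ)| ^ (2 * κ) with hy
      have hy0 : 0 < y := by positivity
      have : y * ‖c m‖ ^ 2 + y⁻¹ - 2 * ‖c m‖ = y⁻¹ * (y * ‖c m‖ - 1) ^ 2 := by
        field_simp; ring
      nlinarith [mul_nonneg (inv_pos.mpr hy0).le (sq_nonneg (y * ‖c m‖ - 1))]
    linarith [norm_nonneg (c m)]
  · simp only [hm, if_false, zero_add]
    have : (0 : ℝ) ≤ |(m : ℝ)| ^ (-(2 * κ)) := by positivity
    linarith

/-! ### Periodic convolution -/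

/-- Inside the integral `f` may be replaced by its absolutely convergent Fourier series. The
identity then holds at every `t`, as is needed at the sampling times. -/
lemma convolution_eq_tsum {g : ℝ → ℝ} (hg : Function.Periodic g 1)
    (hgi : IntegrableOn g (Set.Icc 0 1)) {f : ℝ → ℝ}
    (hf : MemLp f 2 (volume.restrict (Set.Icc (0 : ℝ) 1)))
    (hs : Summable fun m => ‖fourierCoef (fun t => (f t : ℂ)) m‖) (t : ℝ) :
    ((∫ x in (0 : ℝ)..1, g (t - x) * f x : ℝ) : ℂ) =
      ∑' m, fourierCoef (fun x => (g x : ℂ)) m * fourierCoef (fun x => (f x : ℂ)) m *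
        expMode (-m) t := by
  set c : ℤ → ℂ := fourierCoef (fun t => (f t : ℂ)) with hc
  have hgii : ∀ a b : ℝ, IntervalIntegrable (fun x => (g x : ℂ)) volume a b := fun a b => by
    have h1 : IntervalIntegrable g volume 0 (0 + 1) := by
      rw [zero_add, intervalIntegrable_iff_integrableOn_Icc_of_le zero_le_one]; exact hgi
    have h2 := hg.intervalIntegrable one_ne_zero h1 a b
    exact ⟨h2.1.ofReal, h2.2.ofReal⟩
  have hgt : IntervalIntegrable (fun x => (g (t - x) : ℂ)) volume 0 1 := by
    have := (hgii t (t - 1)).comp_sub_left t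
    simpa using this
  have hae := ae_eq_tsum_fourierCoef (h := fun x => (f x : ℂ)) hf.ofReal hs
  rw [← intervalIntegral.integral_ofReal]
  have h1 : ∫ x in (0 : ℝ)..1, ((g (t - x) * f x : ℝ) : ℂ) =
      ∫ x in (0 : ℝ)..1, ∑' m, (g (t - x) : ℂ) * (c m * expMode (-m) x) := by
    refine intervalIntegral.integral_congr_ae_restrict ?_
    rw [Set.uIoc_of_le zero_le_one, restrict_Ioc_eq_restrict_Icc]
    filter_upwards [hae] with x hx
    rw [Complex.ofReal_mul, hx, tsum_mul_left]
  rw [h1]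
  have h2 : HasSum (fun m => ∫ x in (0 : ℝ)..1, (g (t - x) : ℂ) * (c m * expMode (-m) x))
      (∫ x in (0 : ℝ)..1, ∑' m, (g (t - x) : ℂ) * (c m * expMode (-m) x)) := by
    refine intervalIntegral.hasSum_integral_of_dominated_convergence
      (fun m x => ‖(g (t - x) : ℂ)‖ * ‖c m‖) (fun m => ?_) (fun m => ?_) ?_ ?_ ?_
    · exact hgt.aestronglyMeasurable_restrict_uIoc.mul (continuous_const.mul
        (continuous_expMode _)).aestronglyMeasurable
    · exact ae_of_all _ fun x _ => by simp [norm_expMode]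
    · exact ae_of_all _ fun x _ => hs.mul_left _
    · simp_rw [tsum_mul_left]
      exact hgt.norm.mul_const _
    · refine ae_of_all _ fun x _ => Summable.hasSum (Summable.of_norm ?_)
      simpa [norm_expMode] using hs.mul_left ‖(g (t - x) : ℂ)‖
  rw [← h2.tsum_eq]
  refine tsum_congr fun m => ?_
  have h3 : ∫ x in (0 : ℝ)..1, (g (t - x) : ℂ) * (c m * expMode (-m) x) =
      c m * ∫ x in (0 : ℝ)..1, (g (t - x) : ℂ) * expMode (-m) (t - (t - x)) := by
    rw [← intervalIntegral.integral_const_mul]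
    congr 1; ext x; rw [sub_sub_cancel]; ring
  rw [h3, intervalIntegral.integral_comp_sub_left
    (fun y => (g y : ℂ) * expMode (-m) (t - y)) t]
  have h4 : ∀ y, (g y : ℂ) * expMode (-m) (t - y) = expMode (-m) t * (expMode m y * g y) := by
    intro y
    rw [sub_eq_add_neg, expMode_add_time]
    have : expMode (-m) (-y) = expMode m y := by
      unfold expMode; congr 1; push_cast; ring
    rw [this]; ring
  simp_rw [h4]
  rw [intervalIntegral.integral_const_mul]
  have hper : Function.Periodic (fun y => expMode m y * (g y : ℂ)) 1 := fun y => by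
    have := expMode_add_int m y 1
    rw [Int.cast_one] at this
    simp only [this, hg y]
  have h5 := hper.intervalIntegral_add_eq (t - 1) 0
  rw [sub_add_cancel, zero_add] at h5
  rw [sub_zero, h5, fourierCoef]; ring

/-! ### Aliasing -/

lemma norm_fourierCoef_le (h : ℝ → ℂ) (m : ℤ) :
    ‖fourierCoef h m‖ ≤ ∫ t in (0 : ℝ)..1, ‖h t‖ := by
  refine (intervalIntegral.norm_integral_le_integral_norm zero_le_one).trans (le_of_eq ?_)
  congr 1; ext t; rw [norm_mul, norm_expMode, one_mul]

namespace Model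

variable (D : Model.{v})

/-- The noise-free part of the observations. -/
def signal (f : ℝ → ℝ) (k : ℕ) (l : Fin (D.M k)) (i : Fin (D.N k)) : ℝ :=
  ∫ x in (0 : ℝ)..1, D.g (D.u k l) (D.time k i - x) * f x

/-- The weights `N^{-2 d_l}`. -/
def weight (k : ℕ) (l : Fin (D.M k)) : ℝ := (D.N k : ℝ) ^ (-2 * D.d k l)

lemma weight_pos (k : ℕ) (l : Fin (D.M k)) : 0 < D.weight k l :=
  Real.rpow_pos_of_pos (by exact_mod_cast D.N_pos k) _

lemma sum_weight_eq (k : ℕ) (m : ℤ) :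
    ∑ l, D.weight k l * ‖D.gCoef k l m‖ ^ 2 = D.M k * D.tau k m := by
  have : (D.M k : ℝ) ≠ 0 := by exact_mod_cast (D.M_pos k).ne'
  simp only [tau, weight]
  field_simp

lemma tau_nonneg (k : ℕ) (m : ℤ) : 0 ≤ D.tau k m := by
  unfold tau
  exact mul_nonneg (by positivity) (Finset.sum_nonneg fun l _ => by positivity)

lemma fHatCoef_eq (k : ℕ) (y : Fin (D.M k) → Fin (D.N k) → ℝ) (m : ℤ) :
    D.fHatCoef k y m = (∑ l, (D.weight k l : ℂ) * conj (D.gCoef k l m) * D.yCoef k y l m) /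
      ((D.M k * D.tau k m : ℝ) : ℂ) := by
  rw [← sum_weight_eq]; rfl

lemma yCoef_add (k : ℕ) (y y' : Fin (D.M k) → Fin (D.N k) → ℝ) (l : Fin (D.M k)) (m : ℤ) :
    D.yCoef k (fun l i => y l i + y' l i) l m = D.yCoef k y l m + D.yCoef k y' l m := by
  simp only [yCoef, Complex.ofReal_add, mul_add, Finset.sum_add_distrib]

lemma fHatCoef_add (k : ℕ) (y y' : Fin (D.M k) → Fin (D.N k) → ℝ) (m : ℤ) :
    D.fHatCoef k (fun l i => y l i + y' l i) m = D.fHatCoef k y m + D.fHatCoef k y' m := by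
  simp only [fHatCoef_eq, yCoef_add, mul_add, Finset.sum_add_distrib, add_div]

lemma sum_expMode_time (k : ℕ) (m : ℤ) :
    ∑ i, expMode m (D.time k i) = if (D.N k : ℤ) ∣ m then (D.N k : ℂ) else 0 := by
  have h1 : ∀ i : Fin (D.N k), expMode m (D.time k i) =
      expMode m ((i : ℕ) / D.N k) * expMode m (1 / D.N k) := fun i => by
    rw [← expMode_add_time, time]; congr 1; ring
  simp_rw [h1]
  rw [← Finset.sum_mul, Fin.sum_univ_eq_sum_range (fun i => expMode m ((i : ℝ) / D.N k)),
    sum_expMode (D.N_pos k)]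
  split_ifs with h
  · rw [(expMode_one_div_eq_one_iff (D.N_pos k) m).mpr h, mul_one]
  · rw [zero_mul]

lemma norm_gCoef_le (k : ℕ) (l : Fin (D.M k)) (m : ℤ) :
    ‖D.gCoef k l m‖ ≤ ∫ t in (0 : ℝ)..1, ‖(D.g (D.u k l) t : ℂ)‖ := norm_fourierCoef_le _ _

/-- The discrete transform over the sampling times is a character sum mod `N`: it folds all
frequencies congruent to `m` onto `m`. -/
lemma hasSum_yCoef_signal {f : ℝ → ℝ} (hf : MemLp f 2 (volume.restrict (Set.Icc (0 : ℝ) 1)))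
    (hs : Summable fun m => ‖fourierCoef (fun t => (f t : ℂ)) m‖) (k : ℕ) (l : Fin (D.M k))
    (m : ℤ) :
    HasSum (fun m' => if (D.N k : ℤ) ∣ m - m' then
      D.gCoef k l m' * fourierCoef (fun t => (f t : ℂ)) m' else 0)
      (D.yCoef k (D.signal f k) l m) := by
  set c : ℤ → ℂ := fourierCoef (fun t => (f t : ℂ)) with hc
  have hgc : Summable fun m' => ‖D.gCoef k l m' * c m'‖ := by
    refine Summable.of_nonneg_of_le (fun _ => norm_nonneg _) (fun m' => ?_)
      (hs.mul_left (∫ t in (0 : ℝ)..1, ‖(D.g (D.u k l) t : ℂ)‖))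
    rw [norm_mul]
    gcongr
    exact D.norm_gCoef_le k l m'
  have h1 : ∀ i, HasSum (fun m' => D.gCoef k l m' * c m' * expMode (-m') (D.time k i))
      (D.signal f k l i : ℂ) := fun i => by
    have := convolution_eq_tsum (D.g_periodic _ (D.u_mem k l)) (D.g_integrable _ (D.u_mem k l))
      hf hs (D.time k i)
    rw [signal, this]
    refine Summable.hasSum (Summable.of_norm ?_)
    simpa [norm_expMode] using hgc
  have h2 := (hasSum_sum (s := Finset.univ) fun i _ =>
    (h1 i).mul_left (expMode m (D.time k i))).mul_left (D.N k : ℂ)⁻¹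
  refine h2.congr_fun fun m' => ?_
  have h3 : ∀ i, expMode m (D.time k i) * (D.gCoef k l m' * c m' * expMode (-m') (D.time k i)) =
      D.gCoef k l m' * c m' * expMode (m - m') (D.time k i) := fun i => by
    rw [sub_eq_add_neg, expMode_add_mode]; ring
  simp_rw [h3]
  rw [← Finset.mul_sum, sum_expMode_time]
  have : (D.N k : ℂ) ≠ 0 := by exact_mod_cast (D.N_pos k).ne'
  split_ifs
  · field_simp
  · simp

/-- The aliasing error of the estimated Fourier coefficients. -/
def aliasBias (k : ℕ) (f : ℝ → ℝ) (m : ℤ) : ℂ :=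
  D.fHatCoef k (D.signal f k) m - fourierCoef (fun t => (f t : ℂ)) m

/-- Cauchy-Schwarz over the channels with the weights `N^{-2 d_l}`; both square sums are multiples
of `τ₁`. -/
lemma norm_cross_le (k : ℕ) (m m' : ℤ) :
    ‖∑ l, (D.weight k l : ℂ) * conj (D.gCoef k l m) * D.gCoef k l m'‖ ≤
      D.M k * √(D.tau k m * D.tau k m') := by
  have h1 : ‖∑ l, (D.weight k l : ℂ) * conj (D.gCoef k l m) * D.gCoef k l m'‖ ≤
      ∑ l, (√(D.weight k l) * ‖D.gCoef k l m‖) * (√(D.weight k l) * ‖D.gCoef k l m'‖) := by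
    refine (norm_sum_le _ _).trans (Finset.sum_le_sum fun l _ => le_of_eq ?_)
    rw [norm_mul, norm_mul, RCLike.norm_conj, Complex.norm_real,
      Real.norm_of_nonneg (D.weight_pos k l).le]
    nth_rewrite 1 [← Real.mul_self_sqrt (D.weight_pos k l).le]
    ring
  refine h1.trans ?_
  have h2 := Finset.sum_mul_sq_le_sq_mul_sq Finset.univ
    (fun l => √(D.weight k l) * ‖D.gCoef k l m‖) (fun l => √(D.weight k l) * ‖D.gCoef k l m'‖)
  simp_rw [mul_pow, Real.sq_sqrt (D.weight_pos k _).le, sum_weight_eq] at h2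
  have h3 : ((D.M k : ℝ) * √(D.tau k m * D.tau k m')) ^ 2 =
      D.M k * D.tau k m * (D.M k * D.tau k m') := by
    rw [mul_pow, Real.sq_sqrt (mul_nonneg (D.tau_nonneg k m) (D.tau_nonneg k m'))]; ring
  rw [← h3] at h2
  exact (le_abs_self _).trans (abs_le_of_sq_le_sq h2 (by positivity))

/-- The weighted least-squares form of the estimate reproduces the term `m' = m` exactly, with
factor one; any other folded frequency enters with a factor at most `√(τ₁(m')/τ₁(m))`. -/
lemma norm_aliasBias_le {f : ℝ → ℝ} (hf : MemLp f 2 (volume.restrict (Set.Icc (0 : ℝ) 1)))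
    (hs : Summable fun m => ‖fourierCoef (fun t => (f t : ℂ)) m‖) (k : ℕ) {m : ℤ} {ρ : ℝ}
    (hτ : 0 < D.tau k m) (hρ : ∀ m', (D.N k : ℤ) ∣ m - m' → m' ≠ m → D.tau k m' ≤ ρ * D.tau k m) :
    ‖D.aliasBias k f m‖ ≤ ∑' m', if (D.N k : ℤ) ∣ m - m' ∧ m' ≠ m then
      √ρ * ‖fourierCoef (fun t => (f t : ℂ)) m'‖ else 0 := by
  set c : ℤ → ℂ := fourierCoef (fun t => (f t : ℂ)) with hc
  have hM : (0 : ℝ) < D.M k := by exact_mod_cast D.M_pos k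
  set q : ℤ → ℂ := fun m' => (∑ l, (D.weight k l : ℂ) * conj (D.gCoef k l m) * D.gCoef k l m') /
    ((D.M k * D.tau k m : ℝ) : ℂ) with hq
  have hq1 : q m = 1 := by
    have : ∑ l, (D.weight k l : ℂ) * conj (D.gCoef k l m) * D.gCoef k l m =
        ((D.M k * D.tau k m : ℝ) : ℂ) := by
      rw [← sum_weight_eq, Complex.ofReal_sum]
      refine Finset.sum_congr rfl fun l _ => ?_
      rw [mul_assoc, mul_comm (conj _), Complex.mul_conj']; push_cast; ring
    rw [hq]; simp only; rw [this, div_self]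
    exact_mod_cast (mul_pos hM hτ).ne'
  have h1 : HasSum (fun m' => if (D.N k : ℤ) ∣ m - m' then q m' * c m' else 0)
      (D.fHatCoef k (D.signal f k) m) := by
    rw [fHatCoef_eq]
    have h2 := (hasSum_sum (s := Finset.univ) fun l _ => (D.hasSum_yCoef_signal hf hs k l m).mul_left
      ((D.weight k l : ℂ) * conj (D.gCoef k l m))).div_const ((D.M k * D.tau k m : ℝ) : ℂ)
    refine h2.congr_fun fun m' => ?_
    split_ifs
    · simp only [hq]
      rw [div_mul_eq_mul_div, Finset.sum_mul]
      congr 1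
      exact Finset.sum_congr rfl fun l _ => by ring
    · simp
  have h3 : HasSum (fun m' => if m' = m then c m else 0) (c m) := hasSum_ite_eq m (c m)
  have h4 := h1.sub h3
  have hsum : Summable fun m' => if (D.N k : ℤ) ∣ m - m' ∧ m' ≠ m then √ρ * ‖c m'‖ else 0 := by
    refine Summable.of_nonneg_of_le (fun m' => ?_) (fun m' => ?_) (hs.mul_left √ρ)
    · split_ifs <;> positivity
    · split_ifs
      · exact le_rfl
      · positivity
  refine (h4.norm_le_of_bounded hsum.hasSum fun m' => ?_)
  by_cases hm : m' = m
  · subst hm; simp [hq1]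
  · by_cases hd : (D.N k : ℤ) ∣ m - m'
    · simp only [hd, hm, if_true, if_false, sub_zero, ne_eq, not_false_eq_true, and_self]
      rw [norm_mul]
      gcongr
      simp only [hq]
      rw [norm_div, Complex.norm_real, Real.norm_of_nonneg (mul_pos hM hτ).le,
        div_le_iff₀ (mul_pos hM hτ)]
      refine (D.norm_cross_le k m m').trans ?_
      have h5 : √(D.tau k m * D.tau k m') ≤ √(ρ * D.tau k m ^ 2) := by
        refine Real.sqrt_le_sqrt ?_
        nlinarith [hρ m' hd hm]
      have h6 : √(ρ * D.tau k m ^ 2) = √ρ * D.tau k m := by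
        rw [Real.sqrt_mul' _ (sq_nonneg _), Real.sqrt_sq hτ.le]
      calc (D.M k : ℝ) * √(D.tau k m * D.tau k m') ≤ D.M k * (√ρ * D.tau k m) := by
            rw [← h6]; gcongr
        _ = _ := by ring
    · simp [hd, hm]

end Model

/-- The constant in the summation of `|m'|^{-2κ}` over a residue class. -/
def residueConst (κ : ℝ) : ℝ := 3 ^ (2 * κ) * ∑' r : ℤ, |(r : ℝ)| ^ (-(2 * κ))

lemma residueConst_pos {κ : ℝ} (hκ : 1 / 2 < κ) : 0 < residueConst κ := by
  unfold residueConst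
  have h2 : Summable fun m : ℤ => |(m : ℝ)| ^ (-(2 * κ)) :=
    Real.summable_abs_int_rpow (by linarith)
  have : 0 < ∑' r : ℤ, |(r : ℝ)| ^ (-(2 * κ)) :=
    h2.tsum_pos (fun _ => by positivity) 1 (by simp)
  positivity

/-- `|m'| ≥ N|r| - 2N/3 ≥ N|r|/3`, because `|r| ≥ 1`. -/
lemma three_mul_abs_of_alias {N : ℕ} {m m' r : ℤ} (hr : m - m' = N * r) (hr0 : r ≠ 0)
    (hm : 3 * |(m : ℝ)| ≤ 2 * N) : |(r : ℝ)| * N ≤ 3 * |(m' : ℝ)| := by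
  have h1 : (1 : ℝ) ≤ |(r : ℝ)| := by exact_mod_cast Int.one_le_abs hr0
  have h2 : |(m : ℝ) - m'| = N * |(r : ℝ)| := by
    rw [show (m : ℝ) - m' = N * r by exact_mod_cast hr, abs_mul, Nat.abs_cast]
  have h3 := abs_sub (m : ℝ) m'
  have h4 : (0 : ℝ) ≤ N := Nat.cast_nonneg N
  nlinarith

/-- The aliases of `m` are indexed injectively by the nonzero quotients `r`, with `|m'| ≥ |r| N /
3`; the sum over `r` converges because `2κ > 1`. -/
lemma sum_residue_le {κ : ℝ} (hκ : 1 / 2 < κ) {N : ℕ} (hN : 0 < N) {m : ℤ}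
    (hm : 3 * |(m : ℝ)| ≤ 2 * N) {S : Finset ℤ} (hS : ∀ m' ∈ S, (N : ℤ) ∣ m - m' ∧ m' ≠ m) :
    ∑ m' ∈ S, |(m' : ℝ)| ^ (-(2 * κ)) ≤ residueConst κ * (N : ℝ) ^ (-(2 * κ)) := by
  have hN' : (0 : ℝ) < N := by exact_mod_cast hN
  have hNz : (N : ℤ) ≠ 0 := by exact_mod_cast hN.ne'
  have h2 : Summable fun m : ℤ => |(m : ℝ)| ^ (-(2 * κ)) :=
    Real.summable_abs_int_rpow (by linarith)
  have hr : ∀ m' ∈ S, m - m' = N * ((m - m') / N) := fun m' h =>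
    (Int.mul_ediv_cancel' (hS m' h).1).symm
  have hr0 : ∀ m' ∈ S, (m - m') / (N : ℤ) ≠ 0 := fun m' h h0 => by
    have := hr m' h
    rw [h0, mul_zero] at this
    exact (hS m' h).2 (by linarith)
  calc ∑ m' ∈ S, |(m' : ℝ)| ^ (-(2 * κ))
      ≤ ∑ m' ∈ S, 3 ^ (2 * κ) * (N : ℝ) ^ (-(2 * κ)) *
          |(((m - m') / (N : ℤ) : ℤ) : ℝ)| ^ (-(2 * κ)) := by
        refine Finset.sum_le_sum fun m' h => ?_
        have h3 := three_mul_abs_of_alias (hr m' h) (hr0 m' h) hm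
        have h4 : (0 : ℝ) < |(((m - m') / (N : ℤ) : ℤ) : ℝ)| := by
          have := hr0 m' h
          positivity
        have h5 : |(((m - m') / (N : ℤ) : ℤ) : ℝ)| * N / 3 ≤ |(m' : ℝ)| := by linarith
        refine (Real.rpow_le_rpow_of_nonpos (by positivity) h5 (by linarith)).trans (le_of_eq ?_)
        rw [Real.div_rpow (by positivity) (by norm_num), Real.mul_rpow h4.le hN'.le,
          Real.rpow_neg (by norm_num : (0 : ℝ) ≤ 3)]
        field_simp
    _ = 3 ^ (2 * κ) * (N : ℝ) ^ (-(2 * κ)) *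
          ∑ r ∈ S.image (fun m' => (m - m') / (N : ℤ)), |(r : ℝ)| ^ (-(2 * κ)) := by
        rw [Finset.sum_image, Finset.mul_sum]
        intro a ha b hb hab
        have h6 := hr a ha
        have h7 := hr b hb
        simp only at hab
        rw [hab] at h6
        linarith
    _ ≤ 3 ^ (2 * κ) * (N : ℝ) ^ (-(2 * κ)) * ∑' r : ℤ, |(r : ℝ)| ^ (-(2 * κ)) := by
        gcongr
        exact h2.sum_le_tsum _ fun _ _ => by positivity
    _ = _ := by unfold residueConst; ring

namespace Model

variable (D : Model.{v})

/-- Summed over frequencies below `2N/3`, the squared aliasing error is of order `N^{-2κ}`. -/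
lemma sum_sq_aliasBias_le {w : ℝ → ℝ} (hw : IsMeyerAuxiliary w) {f : ℝ → ℝ}
    (hf : MemLp f 2 (volume.restrict (Set.Icc (0 : ℝ) 1))) {j₀ : ℕ} {κ s B ρ : ℝ} (hκ : 1 / 2 < κ)
    (hκs : κ < s) (hb : ∀ j, j₀ ≤ j → ∑ k ∈ Finset.range (2 ^ j), ‖innerCoef f (psi w j k)‖ ^ 2 ≤
      B * (2 : ℝ) ^ (-(2 * j * s))) (k : ℕ) (hN : 2 * 2 ^ j₀ ≤ D.N k) {F : Finset ℤ}
    (hF : ∀ m ∈ F, 3 * |(m : ℝ)| ≤ 2 * D.N k) (hτ : ∀ m ∈ F, 0 < D.tau k m) (hρ0 : 0 ≤ ρ)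
    (hρ : ∀ m ∈ F, ∀ m' : ℤ, (D.N k : ℝ) ≤ 3 * |(m' : ℝ)| → D.tau k m' ≤ ρ * D.tau k m) :
    ∑ m ∈ F, ‖D.aliasBias k f m‖ ^ 2 ≤
      5 * residueConst κ * decayConst κ s * B * ρ * (D.N k : ℝ) ^ (-(2 * κ)) := by
  set c : ℤ → ℂ := fourierCoef (fun t => (f t : ℂ)) with hc
  have hN0 := D.N_pos k
  have hNr : (0 : ℝ) < D.N k := by exact_mod_cast hN0
  have hs := summable_fourierCoef hw hf (hκ.trans hκs) hb
  have halias : ∀ m ∈ F, ∀ m' : ℤ, (D.N k : ℤ) ∣ m - m' → m' ≠ m → (D.N k : ℝ) ≤ 3 * |(m' : ℝ)| := by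
    rintro m hm m' ⟨r, hr⟩ hne
    have hr0 : r ≠ 0 := by
      rintro rfl
      exact hne (by linarith)
    have h1 := three_mul_abs_of_alias hr hr0 (hF m hm)
    have h2 : (1 : ℝ) ≤ |(r : ℝ)| := by exact_mod_cast Int.one_le_abs hr0
    nlinarith
  set T : ℤ → ℤ → ℝ := fun m m' => if (D.N k : ℤ) ∣ m - m' ∧ m' ≠ m then √ρ * ‖c m'‖ else 0 with hT
  have hTs : ∀ m, Summable (T m) := fun m => by
    refine Summable.of_nonneg_of_le (fun m' => ?_) (fun m' => ?_) (hs.mul_left √ρ)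
    · simp only [hT]; split_ifs <;> positivity
    · simp only [hT]; split_ifs
      · exact le_rfl
      · positivity
  have hstep : ∀ m ∈ F, ‖D.aliasBias k f m‖ ^ 2 ≤ (∑' m', T m m') ^ 2 := fun m hm => by
    gcongr
    exact D.norm_aliasBias_le hf hs k (hτ m hm) fun m' hd hne => hρ m hm m' (halias m hm m' hd hne)
  refine (Finset.sum_le_sum hstep).trans ?_
  -- Truncation to a finite set of aliases allows the double sum to be exchanged; the bound is
  -- uniform in the truncation.
  have hlim : Tendsto (fun S : Finset ℤ => ∑ m ∈ F, (∑ m' ∈ S, T m m') ^ 2) atTop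
      (𝓝 (∑ m ∈ F, (∑' m', T m m') ^ 2)) :=
    tendsto_finsetSum _ fun m _ => (hTs m).hasSum.pow 2
  refine le_of_tendsto' hlim fun S => ?_
  have hκ0 : 0 ≤ κ := by linarith
  -- Cauchy-Schwarz with the weights `|m'|^{-κ}` and `|m'|^{κ}`: the first sums to `N^{-2κ}` over a
  -- residue class.
  have hcs : ∀ m ∈ F, (∑ m' ∈ S, T m m') ^ 2 ≤ ρ * (residueConst κ * (D.N k : ℝ) ^ (-(2 * κ))) *
      ∑ m' ∈ S, if (D.N k : ℤ) ∣ m - m' ∧ m' ≠ m then |(m' : ℝ)| ^ (2 * κ) * ‖c m'‖ ^ 2 else 0 := by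
    intro m hm
    simp only [hT]
    rw [← Finset.sum_filter, ← Finset.sum_filter]
    set S' := S.filter fun m' => (D.N k : ℤ) ∣ m - m' ∧ m' ≠ m with hS'
    have hS'' : ∀ m' ∈ S', (D.N k : ℤ) ∣ m - m' ∧ m' ≠ m := fun m' h => (Finset.mem_filter.mp h).2
    rw [← Finset.mul_sum, mul_pow, Real.sq_sqrt hρ0, mul_assoc]
    gcongr
    have h1 : ∀ m' ∈ S', ‖c m'‖ = |(m' : ℝ)| ^ (-κ) * (|(m' : ℝ)| ^ κ * ‖c m'‖) := fun m' h => by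
      have h2 := halias m hm m' (hS'' m' h).1 (hS'' m' h).2
      have h3 : 0 < |(m' : ℝ)| := by linarith
      rw [← mul_assoc, ← Real.rpow_add h3]; simp
    rw [Finset.sum_congr rfl h1]
    refine (Finset.sum_mul_sq_le_sq_mul_sq _ _ _).trans ?_
    have h4 : ∀ (m' : ℤ) (x : ℝ), (|(m' : ℝ)| ^ x) ^ 2 = |(m' : ℝ)| ^ (2 * x) := fun m' x => by
      rw [← Real.rpow_natCast, ← Real.rpow_mul (abs_nonneg _)]; congr 1; push_cast; ring
    simp_rw [mul_pow, h4, mul_neg]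
    gcongr
    exact sum_residue_le hκ hN0 (hF m hm) hS''
  refine (Finset.sum_le_sum hcs).trans ?_
  rw [← Finset.mul_sum, Finset.sum_comm]
  -- After the exchange of sums, each alias `m'` belongs to at most five resolved frequencies `m`,
  -- so the weighted norm of the coefficients is counted at most five times.
  have hdouble : ∑ m' ∈ S, ∑ m ∈ F, (if (D.N k : ℤ) ∣ m - m' ∧ m' ≠ m then
      |(m' : ℝ)| ^ (2 * κ) * ‖c m'‖ ^ 2 else 0) ≤ 5 * (decayConst κ s * B) := by
    have h1 : ∀ m' ∈ S, ∑ m ∈ F, (if (D.N k : ℤ) ∣ m - m' ∧ m' ≠ m then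
        |(m' : ℝ)| ^ (2 * κ) * ‖c m'‖ ^ 2 else 0) ≤
        if (D.N k : ℝ) ≤ 3 * |(m' : ℝ)| then 5 * (|(m' : ℝ)| ^ (2 * κ) * ‖c m'‖ ^ 2) else 0 := by
      intro m' _
      split_ifs with h2
      · rw [← Finset.sum_filter, Finset.sum_const, nsmul_eq_mul]
        gcongr
        have h3 : (F.filter fun m => (D.N k : ℤ) ∣ m - m' ∧ m' ≠ m).card ≤ 5 := by
          refine le_trans (Finset.card_le_card fun m hm => ?_) (card_residue_le hN0 (F := F)
            (fun m hm => ?_) m')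
          · rw [Finset.mem_filter] at hm ⊢
            exact ⟨hm.1, dvd_sub_comm.mp hm.2.1⟩
          · have h4 := hF m hm
            have h5 : ((|m| : ℤ) : ℝ) ≤ ((2 * D.N k : ℤ) : ℝ) := by push_cast; linarith
            exact_mod_cast h5
        exact_mod_cast h3
      · refine (Finset.sum_eq_zero fun m hm => ?_).le
        rw [if_neg]
        rintro ⟨h3, h4⟩
        exact h2 (halias m hm m' h3 h4)
    refine (Finset.sum_le_sum h1).trans ?_
    rw [← Finset.sum_filter, ← Finset.mul_sum]
    gcongr
    refine sum_weighted_sq_fourierCoef_le hw hf hκ0 hκs hb fun m' hm' => ?_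
    have h5 := (Finset.mem_filter.mp hm').2
    have h6 : ((2 * 2 ^ j₀ : ℕ) : ℝ) ≤ D.N k := by exact_mod_cast hN
    push_cast at h6
    linarith
  have hR := (residueConst_pos hκ).le
  calc _ ≤ ρ * (residueConst κ * (D.N k : ℝ) ^ (-(2 * κ))) * (5 * (decayConst κ s * B)) := by
        gcongr
    _ = _ := by ring

end Model

/-! ### Exponential moments of squared norms -/

lemma lintegral_pi_gaussian_prod {ι : Type*} [Fintype ι] {φ : ι → ℝ → ℝ}
    (hpos : ∀ i x, 0 ≤ φ i x) (hint : ∀ i, Integrable (φ i) (gaussianReal 0 1)) :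
    ∫⁻ g, ENNReal.ofReal (∏ i, φ i (g i)) ∂(Measure.pi fun _ : ι => gaussianReal 0 1) =
      ENNReal.ofReal (∏ i, ∫ x, φ i x ∂(gaussianReal 0 1)) := by
  rw [← integral_fintype_prod_eq_prod (fun i x => φ i x),
    ofReal_integral_eq_lintegral_ofReal (Integrable.fintype_prod hint)]
  exact ae_of_all _ fun g => Finset.prod_nonneg fun i _ => hpos i _

lemma integral_exp_mul_gaussian (a : ℝ) :
    ∫ x, Real.exp (a * x) ∂(gaussianReal 0 1) = Real.exp (a ^ 2 / 2) := by
  have := mgf_gaussianReal (p := gaussianReal 0 1) (X := id) (μ := 0) (v := 1) (by simp) a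
  simpa [mgf] using this

lemma integrable_exp_sq_div_four_gaussian :
    Integrable (fun x => Real.exp (x ^ 2 / 4)) (gaussianReal 0 1) ∧
      ∫ x, Real.exp (x ^ 2 / 4) ∂(gaussianReal 0 1) = √2 := by
  have h1 : ∀ x : ℝ, gaussianPDFReal 0 1 x * Real.exp (x ^ 2 / 4) =
      (√(2 * Real.pi))⁻¹ * Real.exp (-(1 / 4) * x ^ 2) := fun x => by
    simp only [gaussianPDFReal, NNReal.coe_one, mul_one, sub_zero]
    rw [mul_assoc, ← Real.exp_add]; congr 2; ring
  constructor
  · rw [gaussianReal_of_var_ne_zero _ one_ne_zero, gaussianPDF_def,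
      integrable_withDensity_iff_integrable_smul₀' (by fun_prop) (by simp)]
    have : (fun x => (ENNReal.ofReal (gaussianPDFReal 0 1 x)).toReal • Real.exp (x ^ 2 / 4)) =
        fun x => (√(2 * Real.pi))⁻¹ * Real.exp (-(1 / 4) * x ^ 2) := by
      ext x
      rw [ENNReal.toReal_ofReal (gaussianPDFReal_nonneg _ _ _), smul_eq_mul, h1]
    rw [this]
    exact (integrable_exp_neg_mul_sq (by norm_num)).const_mul _
  · rw [integral_gaussianReal_eq_integral_smul one_ne_zero]
    simp_rw [smul_eq_mul, h1]
    rw [integral_const_mul, integral_gaussian, ← Real.sqrt_inv, ← Real.sqrt_mul (by positivity)]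
    congr 1
    have := Real.pi_ne_zero
    field_simp; norm_num

/-- If all linear functionals of a random vector are sub-Gaussian with variance proxy `v`, then the
squared norm of the vector has an exponential moment. -/
lemma lintegral_exp_sq_le {ι : Type*} [Fintype ι] {Ω : Type*} [MeasurableSpace Ω] {P : Measure Ω}
    [IsProbabilityMeasure P] {X : ι → Ω → ℝ} (hX : ∀ i, Measurable (X i)) {v : ℝ} (hv : 0 < v)
    (h : ∀ a : ι → ℝ, ∫⁻ ω, ENNReal.ofReal (Real.exp (∑ i, a i * X i ω)) ∂P ≤
      ENNReal.ofReal (Real.exp (v / 2 * ∑ i, a i ^ 2))) :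
    ∫⁻ ω, ENNReal.ofReal (Real.exp ((∑ i, X i ω ^ 2) / (4 * v))) ∂P ≤
      ENNReal.ofReal (√2 ^ Fintype.card ι) := by
  set γ : Measure (ι → ℝ) := Measure.pi fun _ : ι => gaussianReal 0 1 with hγ
  -- Chosen so that averaging `exp(c g·X)` over a standard Gaussian `g` gives `exp(c²|X|²/2) =
  -- exp(|X|²/(4v))`.
  set c : ℝ := (√(2 * v))⁻¹ with hc
  have hc2 : c ^ 2 = (2 * v)⁻¹ := by rw [hc, inv_pow, Real.sq_sqrt (by positivity)]
  have h1 : ∀ ω, ENNReal.ofReal (Real.exp ((∑ i, X i ω ^ 2) / (4 * v))) =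
      ∫⁻ g, ENNReal.ofReal (Real.exp (∑ i, (c * g i) * X i ω)) ∂γ := fun ω => by
    have h2 := lintegral_pi_gaussian_prod (φ := fun (i : ι) x => Real.exp ((c * X i ω) * x))
      (fun i x => (Real.exp_pos _).le) fun i => integrable_exp_mul_gaussianReal _
    simp_rw [integral_exp_mul_gaussian, ← Real.exp_sum] at h2
    have h3 : ∀ g : ι → ℝ, ∑ i, (c * g i) * X i ω = ∑ i, c * X i ω * g i := fun g =>
      Finset.sum_congr rfl fun i _ => by ring
    simp_rw [h3]
    rw [h2]
    congr 2
    rw [Finset.sum_div]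
    refine Finset.sum_congr rfl fun i _ => ?_
    rw [mul_pow, hc2]; field_simp; norm_num
  simp_rw [h1]
  rw [lintegral_lintegral_swap]
  · have h4 : ∀ g : ι → ℝ, ∫⁻ ω, ENNReal.ofReal (Real.exp (∑ i, (c * g i) * X i ω)) ∂P ≤
        ENNReal.ofReal (∏ i, Real.exp (g i ^ 2 / 4)) := fun g => by
      refine (h fun i => c * g i).trans (le_of_eq ?_)
      rw [← Real.exp_sum]
      congr 2
      rw [Finset.mul_sum]
      refine Finset.sum_congr rfl fun i _ => ?_
      rw [mul_pow, hc2]; field_simp; ring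
    refine (lintegral_mono h4).trans ?_
    rw [hγ, lintegral_pi_gaussian_prod (φ := fun (_ : ι) x => Real.exp (x ^ 2 / 4))
      (fun i x => (Real.exp_pos _).le) fun i => integrable_exp_sq_div_four_gaussian.1]
    simp_rw [integrable_exp_sq_div_four_gaussian.2]
    simp
  · refine Measurable.aemeasurable ?_
    refine ENNReal.measurable_ofReal.comp (Real.measurable_exp.comp ?_)
    change Measurable fun p : Ω × (ι → ℝ) => ∑ i, (c * p.2 i) * X i p.1
    refine Finset.measurable_sum _ fun i _ => ?_
    exact (measurable_const.mul ((measurable_pi_apply i).comp measurable_snd)).mul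
      ((hX i).comp measurable_fst)

/-- Complex version of `lintegral_exp_sq_le`. -/
lemma lintegral_exp_sq_norm_le {Ω : Type*} [MeasurableSpace Ω] {P : Measure Ω}
    [IsProbabilityMeasure P] {U : Finset ℕ} {Z : ℕ → Ω → ℂ} (hZ : ∀ i, Measurable (Z i)) {v : ℝ}
    (hv : 0 < v)
    (h : ∀ a : ℕ → ℂ, ∫⁻ ω, ENNReal.ofReal (Real.exp (∑ i ∈ U, a i * Z i ω).re) ∂P ≤
      ENNReal.ofReal (Real.exp (v / 2 * ∑ i ∈ U, ‖a i‖ ^ 2))) :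
    ∫⁻ ω, ENNReal.ofReal (Real.exp ((∑ i ∈ U, ‖Z i ω‖ ^ 2) / (4 * v))) ∂P ≤
      ENNReal.ofReal (2 ^ U.card) := by
  classical
  -- Real and imaginary parts give twice as many coordinates, so the factor `√2` per real coordinate
  -- becomes `2` per complex one.
  set X : U ⊕ U → Ω → ℝ := Sum.elim (fun i ω => (Z i ω).re) (fun i ω => (Z i ω).im) with hX
  have hXm : ∀ i, Measurable (X i) := by
    rintro (i | i)
    · exact Complex.measurable_re.comp (hZ i)
    · exact Complex.measurable_im.comp (hZ i)
  have hU : ∀ b : U → ℂ, ∫⁻ ω, ENNReal.ofReal (Real.exp (∑ i, b i * Z i ω).re) ∂P ≤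
      ENNReal.ofReal (Real.exp (v / 2 * ∑ i, ‖b i‖ ^ 2)) := fun b => by
    have h2 := h fun i => if hi : i ∈ U then b ⟨i, hi⟩ else 0
    have e1 : ∀ ω, ∑ i ∈ U, (if hi : i ∈ U then b ⟨i, hi⟩ else 0) * Z i ω =
        ∑ i, b i * Z i ω := fun ω => by
      rw [← Finset.sum_coe_sort]
      exact Finset.sum_congr rfl fun i _ => by simp
    have e2 : ∑ i ∈ U, ‖(if hi : i ∈ U then b ⟨i, hi⟩ else 0)‖ ^ 2 = ∑ i, ‖b i‖ ^ 2 := by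
      rw [← Finset.sum_coe_sort]
      exact Finset.sum_congr rfl fun i _ => by simp
    simp_rw [e1] at h2
    rwa [e2] at h2
  have h1 := lintegral_exp_sq_le hXm hv (P := P) fun a => by
    have h2 := hU fun i => (a (Sum.inl i) : ℂ) - (a (Sum.inr i) : ℂ) * Complex.I
    have e1 : ∀ ω, ∑ i, a i * X i ω =
        (∑ i, ((a (Sum.inl i) : ℂ) - (a (Sum.inr i) : ℂ) * Complex.I) * Z i ω).re := fun ω => by
      simp only [hX, Fintype.sum_sum_type, Sum.elim_inl, Sum.elim_inr]
      rw [← Finset.sum_add_distrib, Complex.re_sum]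
      refine Finset.sum_congr rfl fun i _ => ?_
      simp [Complex.mul_re, Complex.sub_re, Complex.sub_im]
    have e2 : ∑ i, a i ^ 2 =
        ∑ i, ‖(a (Sum.inl i) : ℂ) - (a (Sum.inr i) : ℂ) * Complex.I‖ ^ 2 := by
      rw [Fintype.sum_sum_type, ← Finset.sum_add_distrib]
      refine Finset.sum_congr rfl fun i _ => ?_
      rw [← Complex.normSq_eq_norm_sq, Complex.normSq_apply]
      simp; ring
    simp_rw [e1, e2]
    exact h2
  have h3 : ∀ ω, ∑ i, X i ω ^ 2 = ∑ i ∈ U, ‖Z i ω‖ ^ 2 := fun ω => by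
    rw [← Finset.sum_coe_sort U, Fintype.sum_sum_type, ← Finset.sum_add_distrib]
    refine Finset.sum_congr rfl fun i _ => ?_
    rw [← Complex.normSq_eq_norm_sq, Complex.normSq_apply]
    simp only [hX, Sum.elim_inl, Sum.elim_inr]; ring
  simp_rw [h3] at h1
  refine h1.trans (ENNReal.ofReal_le_ofReal (le_of_eq ?_))
  rw [Fintype.card_sum, Fintype.card_coe, ← two_mul, pow_mul, Real.sq_sqrt (by norm_num)]

/-! ### The noise -/

namespace Model

variable (D : Model.{v})

instance instMeasurableSpaceΩ (k : ℕ) : MeasurableSpace (D.Ω k) := D.mΩ k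

instance instIsProbabilityMeasureP (k : ℕ) : IsProbabilityMeasure (D.P k) :=
  D.isProbabilityMeasure k

lemma memLp_noise (k : ℕ) (l : Fin (D.M k)) (i : Fin (D.N k)) :
    MemLp (fun ω => D.ξ k l ω i) 2 (D.P k) :=
  ((D.ξ_gaussian k l).eval i).memLp_two

/-- The matrix `r I - Σ` has spectrum `r` minus that of `Σ`, hence is positive semidefinite for `r`
the upper eigenvalue bound. -/
lemma noiseCov_quadratic_le {K₁ K₂ : ℝ} (hA1 : D.AssumptionA1 K₁ K₂) (k : ℕ) (l : Fin (D.M k))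
    (c : Fin (D.N k) → ℝ) :
    ∑ i, ∑ i', c i * c i' * D.noiseCov k l i i' ≤
      K₂ * (D.N k : ℝ) ^ (2 * D.d k l) * ∑ i, c i ^ 2 := by
  set A := D.noiseCov k l with hA
  set r := K₂ * (D.N k : ℝ) ^ (2 * D.d k l) with hr
  have hherm : A.IsHermitian := by
    ext i i'
    simp only [hA, noiseCov, Matrix.conjTranspose_apply, Matrix.of_apply, star_trivial]
    exact covariance_comm _ _
  have hB : (algebraMap ℝ (Matrix (Fin (D.N k)) (Fin (D.N k)) ℝ) r - A).IsHermitian := by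
    refine Matrix.IsHermitian.sub ?_ hherm
    rw [Matrix.algebraMap_eq_diagonal]
    exact Matrix.isHermitian_diagonal _
  have hpsd : (algebraMap ℝ (Matrix (Fin (D.N k)) (Fin (D.N k)) ℝ) r - A).PosSemidef := by
    rw [hB.posSemidef_iff_eigenvalues_nonneg]
    intro i
    have h1 := hB.eigenvalues_mem_spectrum_real i
    rw [← spectrum.singleton_sub_eq] at h1
    obtain ⟨_, rfl, x, hx, hxe⟩ := h1
    have h2 := ((hA1 k l).2.2 x hx).2
    simp only at hxe
    rw [← hxe]
    simpa using h2
  have h3 := hpsd.dotProduct_mulVec_nonneg c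
  rw [Matrix.sub_mulVec, dotProduct_sub, Algebra.algebraMap_eq_smul_one, Matrix.smul_mulVec,
    Matrix.one_mulVec] at h3
  have h4 : star c ⬝ᵥ r • c = r * ∑ i, c i ^ 2 := by
    simp only [dotProduct, Finset.mul_sum, Pi.smul_apply, smul_eq_mul, star_trivial]
    exact Finset.sum_congr rfl fun i _ => by ring
  have h5 : star c ⬝ᵥ A.mulVec c = ∑ i, ∑ i', c i * c i' * A i i' := by
    simp only [dotProduct, Matrix.mulVec, Finset.mul_sum, star_trivial]
    exact Finset.sum_congr rfl fun i _ => Finset.sum_congr rfl fun i' _ => by ring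
  rw [h4, h5] at h3
  linarith

/-- A linear functional of a centered Gaussian vector is centered Gaussian with variance given by
the quadratic form of `Σ`. Positivity is recorded because it later yields integrability of the
exponential. -/
lemma mgf_channel_le {K₁ K₂ : ℝ} (hA1 : D.AssumptionA1 K₁ K₂) (k : ℕ) (l : Fin (D.M k))
    (c : Fin (D.N k) → ℝ) :
    0 < mgf (fun ω => ∑ i, c i * D.ξ k l ω i) (D.P k) 1 ∧
    mgf (fun ω => ∑ i, c i * D.ξ k l ω i) (D.P k) 1 ≤
      Real.exp (K₂ / 2 * ((D.N k : ℝ) ^ (2 * D.d k l) * ∑ i, c i ^ 2)) := by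
  set X : D.Ω k → ℝ := fun ω => ∑ i, c i * D.ξ k l ω i with hX
  set L : (Fin (D.N k) → ℝ) →L[ℝ] ℝ := ∑ i, c i • ContinuousLinearMap.proj i with hL
  have hXL : X = fun ω => L (D.ξ k l ω) := by
    ext ω; simp [hX, hL]
  have hg : HasGaussianLaw X (D.P k) := by
    rw [hXL]; exact (D.ξ_gaussian k l).map_fun L
  have hmean : (D.P k)[X] = 0 := by
    simp only [hX]
    rw [integral_finsetSum _ fun i _ => ((D.memLp_noise k l i).integrable (by norm_num)).const_mul _]
    refine Finset.sum_eq_zero fun i _ => ?_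
    rw [integral_const_mul, D.ξ_centered, mul_zero]
  have hvar : Var[X; D.P k] = ∑ i, ∑ i', c i * c i' * D.noiseCov k l i i' := by
    rw [← covariance_self hg.aemeasurable]
    simp only [hX]
    rw [covariance_fun_sum_fun_sum (fun i => (D.memLp_noise k l i).const_mul _)
      (fun i => (D.memLp_noise k l i).const_mul _)]
    refine Finset.sum_congr rfl fun i _ => Finset.sum_congr rfl fun i' _ => ?_
    rw [covariance_const_mul_left, covariance_const_mul_right, ← mul_assoc]
    rfl
  have hmgf := mgf_gaussianReal hg.map_eq_gaussianReal 1
  rw [hmean] at hmgf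
  simp only [zero_add, one_pow, mul_one, Real.coe_toNNReal _ (variance_nonneg _ _)] at hmgf
  rw [hmgf]
  refine ⟨Real.exp_pos _, Real.exp_le_exp.mpr ?_⟩
  have := D.noiseCov_quadratic_le hA1 k l c
  rw [hvar]
  linarith

/-- Dependence within a channel sits in the covariance bound; across channels independence makes the
moment generating functions multiply. -/
lemma lintegral_exp_noise_le {K₁ K₂ : ℝ} (hA1 : D.AssumptionA1 K₁ K₂) (k : ℕ)
    (c : Fin (D.M k) → Fin (D.N k) → ℝ) :
    ∫⁻ ω, ENNReal.ofReal (Real.exp (∑ l, ∑ i, c l i * D.ξ k l ω i)) ∂(D.P k) ≤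
      ENNReal.ofReal (Real.exp (K₂ / 2 *
        ∑ l, (D.N k : ℝ) ^ (2 * D.d k l) * ∑ i, c l i ^ 2)) := by
  have hm : ∀ l, Measurable fun x : Fin (D.N k) → ℝ => ∑ i, c l i * x i := fun l =>
    Finset.measurable_sum _ fun i _ => measurable_const.mul (measurable_pi_apply i)
  have hind := (D.ξ_indep k).comp (fun l x => ∑ i, c l i * x i) hm
  have hmeas : ∀ l, Measurable ((fun x : Fin (D.N k) → ℝ => ∑ i, c l i * x i) ∘ D.ξ k l) :=
    fun l => (hm l).comp (D.ξ_measurable k l)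
  have h1 := hind.mgf_sum (t := 1) hmeas Finset.univ
  have hpos : 0 < mgf (∑ l, (fun x : Fin (D.N k) → ℝ => ∑ i, c l i * x i) ∘ D.ξ k l) (D.P k) 1 := by
    rw [h1]
    exact Finset.prod_pos fun l _ => (D.mgf_channel_le hA1 k l (c l)).1
  have hint := mgf_pos_iff.mp hpos
  have h2 : mgf (∑ l, (fun x : Fin (D.N k) → ℝ => ∑ i, c l i * x i) ∘ D.ξ k l) (D.P k) 1 ≤
      Real.exp (K₂ / 2 * ∑ l, (D.N k : ℝ) ^ (2 * D.d k l) * ∑ i, c l i ^ 2) := by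
    rw [h1, Finset.mul_sum, Real.exp_sum]
    exact Finset.prod_le_prod (fun l _ => (D.mgf_channel_le hA1 k l (c l)).1.le)
      fun l _ => (D.mgf_channel_le hA1 k l (c l)).2
  have h3 : ∀ ω, Real.exp (1 * (∑ l, (fun x : Fin (D.N k) → ℝ => ∑ i, c l i * x i) ∘ D.ξ k l) ω) =
      Real.exp (∑ l, ∑ i, c l i * D.ξ k l ω i) := fun ω => by
    simp [Finset.sum_apply]
  rw [mgf] at h2
  simp_rw [h3] at h2 hint
  rw [← ofReal_integral_eq_lintegral_ofReal hint (ae_of_all _ fun _ => (Real.exp_pos _).le)]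
  exact ENNReal.ofReal_le_ofReal h2

end Model

namespace Model

variable (D : Model.{v})

lemma sum_sq_expMode_time_le (k : ℕ) {F : Finset ℤ} (hF : ∀ m ∈ F, |m| ≤ 2 * D.N k) (x : ℤ → ℂ) :
    ∑ i, ‖∑ m ∈ F, expMode m (D.time k i) * x m‖ ^ 2 ≤ 5 * D.N k * ∑ m ∈ F, ‖x m‖ ^ 2 := by
  have h1 := dft_bessel (D.N_pos k) hF (fun m => expMode m (1 / D.N k) * x m)
  simp only [norm_mul, norm_expMode, one_mul] at h1
  refine le_of_eq_of_le ?_ h1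
  rw [Finset.sum_range]
  refine Finset.sum_congr rfl fun i _ => ?_
  congr 2
  refine Finset.sum_congr rfl fun m _ => ?_
  rw [← mul_assoc, ← expMode_add_time, time, add_div]

/-- The contribution of the noise to an estimated wavelet coefficient. -/
def noiseCoef (h : ℝ → ℂ) (k j i : ℕ) (ω : D.Ω k) : ℂ :=
  coefOf h (D.fHatCoef k fun l i' => D.ξ k l ω i') j i

lemma measurable_noiseCoef (h : ℝ → ℂ) (k j i : ℕ) : Measurable (D.noiseCoef h k j i) := by
  have h1 : ∀ l i', Measurable fun ω => D.ξ k l ω i' := fun l i' =>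
    (measurable_pi_apply i').comp (D.ξ_measurable k l)
  unfold noiseCoef coefOf fHatCoef yCoef
  fun_prop

/-- The coefficient of `ξ_{li}` in a linear combination of noise coefficients. -/
def noiseDual (k : ℕ) (F : Finset ℤ) (x : ℤ → ℂ) (l : Fin (D.M k)) (i : Fin (D.N k)) : ℂ :=
  (D.weight k l * (D.N k : ℝ)⁻¹ : ℝ) * ∑ m ∈ F, expMode m (D.time k i) *
    (conj (D.gCoef k l m) * x m / ((D.M k * D.tau k m : ℝ) : ℂ))

lemma sum_fHatCoef_mul (k : ℕ) (F : Finset ℤ) (x : ℤ → ℂ) (y : Fin (D.M k) → Fin (D.N k) → ℝ) :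
    ∑ m ∈ F, D.fHatCoef k y m * x m = ∑ l, ∑ i, D.noiseDual k F x l i * y l i := by
  simp only [fHatCoef_eq, noiseDual, yCoef, Finset.mul_sum, Finset.sum_mul, Finset.sum_div]
  rw [Finset.sum_comm]
  refine Finset.sum_congr rfl fun l _ => ?_
  rw [Finset.sum_comm]
  refine Finset.sum_congr rfl fun i _ => Finset.sum_congr rfl fun m _ => ?_
  push_cast
  ring

/-- The squared weight `N^{-4d_l}` times the variance factor `N^{2d_l}` is again the weight
`N^{-2d_l}`, so the sum over channels rebuilds `M τ₁` and cancels one of the two powers of `M τ₁` in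
the denominator. The sum over sampling times costs the Bessel constant 5. -/
lemma sum_sq_noiseDual_le {k : ℕ} {F : Finset ℤ} {V : ℝ} (hF : ∀ m ∈ F, |m| ≤ 2 * D.N k)
    (hτ : ∀ m ∈ F, 0 < D.tau k m ∧ (D.tau k m)⁻¹ ≤ V) (x : ℤ → ℂ) :
    ∑ l, (D.N k : ℝ) ^ (2 * D.d k l) * ∑ i, (D.noiseDual k F x l i).re ^ 2 ≤
      5 * V / D.n k * ∑ m ∈ F, ‖x m‖ ^ 2 := by
  have hN : (0 : ℝ) < D.N k := by exact_mod_cast D.N_pos k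
  have hM : (0 : ℝ) < D.M k := by exact_mod_cast D.M_pos k
  have hw : ∀ l, (D.N k : ℝ) ^ (2 * D.d k l) = (D.weight k l)⁻¹ := fun l => by
    rw [weight, ← Real.rpow_neg hN.le]; congr 1; ring
  have h1 : ∀ l, (D.N k : ℝ) ^ (2 * D.d k l) * ∑ i, (D.noiseDual k F x l i).re ^ 2 ≤
      ∑ m ∈ F, 5 * (D.N k : ℝ)⁻¹ * ‖x m‖ ^ 2 / (D.M k * D.tau k m) ^ 2 *
        (D.weight k l * ‖D.gCoef k l m‖ ^ 2) := by
    intro l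
    have hwl := D.weight_pos k l
    have h2 : ∑ i, (D.noiseDual k F x l i).re ^ 2 ≤
        (D.weight k l * (D.N k : ℝ)⁻¹) ^ 2 * (5 * D.N k * ∑ m ∈ F,
          ‖conj (D.gCoef k l m) * x m / ((D.M k * D.tau k m : ℝ) : ℂ)‖ ^ 2) := by
      refine le_trans ?_ (mul_le_mul_of_nonneg_left (D.sum_sq_expMode_time_le k hF _)
        (sq_nonneg _))
      rw [Finset.mul_sum]
      refine Finset.sum_le_sum fun i _ => ?_
      rw [← sq_abs]
      refine (pow_le_pow_left₀ (abs_nonneg _) (Complex.abs_re_le_norm _) 2).trans ?_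
      rw [noiseDual, norm_mul, mul_pow, Complex.norm_real, Real.norm_eq_abs, sq_abs]
    rw [hw]
    refine (mul_le_mul_of_nonneg_left h2 (by positivity)).trans (le_of_eq ?_)
    simp only [norm_mul, norm_div, RCLike.norm_conj, Complex.norm_real, Real.norm_eq_abs,
      div_pow, mul_pow, sq_abs, Finset.mul_sum]
    refine Finset.sum_congr rfl fun m _ => ?_
    field_simp
  refine (Finset.sum_le_sum fun l _ => h1 l).trans ?_
  rw [Finset.sum_comm, Finset.mul_sum]
  refine Finset.sum_le_sum fun m hm => ?_
  obtain ⟨h3, h4⟩ := hτ m hm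
  rw [← Finset.mul_sum, sum_weight_eq]
  have h5 : 5 * (D.N k : ℝ)⁻¹ * ‖x m‖ ^ 2 / (D.M k * D.tau k m) ^ 2 * (D.M k * D.tau k m) =
      5 / D.n k * ‖x m‖ ^ 2 * (D.tau k m)⁻¹ := by
    rw [n]; field_simp
  rw [h5]
  have hn : 0 < D.n k := mul_pos hN hM
  calc 5 / D.n k * ‖x m‖ ^ 2 * (D.tau k m)⁻¹ ≤ 5 / D.n k * ‖x m‖ ^ 2 * V := by gcongr
    _ = _ := by ring

/-- Noise coefficients of a level are jointly sub-Gaussian. -/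
lemma lintegral_exp_noiseCoef_le {h : ℝ → ℂ} (hh : IsBandKernel h) {K₁ K₂ : ℝ} (hK₂ : 0 < K₂)
    (hA1 : D.AssumptionA1 K₁ K₂) {k j : ℕ} {V : ℝ} (hV : 0 ≤ V)
    (hband : ∀ m : ℤ, h (m / 2 ^ j) ≠ 0 →
      3 * |(m : ℝ)| ≤ 2 * D.N k ∧ 0 < D.tau k m ∧ (D.tau k m)⁻¹ ≤ V)
    {U : Finset ℕ} (hU : U ⊆ Finset.range (2 ^ j)) (a : ℕ → ℂ) :
    ∫⁻ ω, ENNReal.ofReal (Real.exp (∑ i ∈ U, a i * D.noiseCoef h k j i ω).re) ∂(D.P k) ≤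
      ENNReal.ofReal (Real.exp (25 * K₂ * V / D.n k / 2 * ∑ i ∈ U, ‖a i‖ ^ 2)) := by
  classical
  set a' : ℕ → ℂ := fun i => if i ∈ U then a i else 0 with ha'
  set x : ℤ → ℂ := fun m => ∑ i ∈ Finset.range (2 ^ j), a' i * conj (modeCoef h j i m) with hx
  set F : Finset ℤ := (modes j).filter fun m : ℤ => h (m / 2 ^ j) ≠ 0 with hF
  have hFm : ∀ m ∈ F, h (m / 2 ^ j) ≠ 0 := fun m hm => (Finset.mem_filter.mp hm).2
  have hn : 0 < D.n k := mul_pos (by exact_mod_cast D.N_pos k) (by exact_mod_cast D.M_pos k)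
  have hsum : ∀ c : ℕ → ℂ, ∑ i ∈ Finset.range (2 ^ j), a' i * c i = ∑ i ∈ U, a i * c i := by
    intro c
    simp only [ha', ite_mul, zero_mul]
    rw [← Finset.sum_filter]
    congr 1
    ext i
    simp only [Finset.mem_filter]
    exact ⟨fun h => h.2, fun h => ⟨hU h, h⟩⟩
  have h1 : ∀ ω, ∑ i ∈ U, a i * D.noiseCoef h k j i ω =
      ∑ l, ∑ i, D.noiseDual k F x l i * D.ξ k l ω i := by
    intro ω
    rw [← sum_fHatCoef_mul, ← hsum]
    simp only [noiseCoef, coefOf, hx, Finset.mul_sum]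
    rw [Finset.sum_comm, hF, Finset.sum_filter]
    refine Finset.sum_congr rfl fun m _ => ?_
    split_ifs with h2
    · refine Finset.sum_congr rfl fun i _ => ?_
      ring
    · refine Finset.sum_eq_zero fun i _ => ?_
      simp only [ne_eq, not_not] at h2
      simp [modeCoef, h2]
  have hre : ∀ ω, (∑ i ∈ U, a i * D.noiseCoef h k j i ω).re =
      ∑ l, ∑ i, (D.noiseDual k F x l i).re * D.ξ k l ω i := by
    intro ω
    rw [h1]
    simp [Complex.re_sum]
  simp only [hre]
  refine (D.lintegral_exp_noise_le hA1 k _).trans ?_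
  refine ENNReal.ofReal_le_ofReal (Real.exp_le_exp.mpr ?_)
  -- The constant 25 is the product of two Bessel constants: one for the sampling times, one for the
  -- positions `k` of the level.
  have h2 := D.sum_sq_noiseDual_le (k := k) (F := F) (V := V) (fun m hm => ?_)
    (fun m hm => (hband m (hFm m hm)).2) x
  · have h3 : ∑ m ∈ F, ‖x m‖ ^ 2 ≤ 5 * ∑ i ∈ U, ‖a i‖ ^ 2 := by
      have h4 := hh.synthesis_bessel j fun i => conj (a' i)
      have h5 : ∀ m, ‖x m‖ = ‖∑ i ∈ Finset.range (2 ^ j), conj (a' i) * modeCoef h j i m‖ := by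
        intro m
        rw [← RCLike.norm_conj, hx]
        simp
      simp only [RCLike.norm_conj, ← h5] at h4
      have h6 : ∑ i ∈ Finset.range (2 ^ j), ‖a' i‖ ^ 2 = ∑ i ∈ U, ‖a i‖ ^ 2 := by
        have h7 : ∀ i, ‖a' i‖ ^ 2 = if i ∈ U then ‖a i‖ ^ 2 else 0 := fun i => by
          simp only [ha']; split_ifs <;> simp
        simp only [h7]
        rw [← Finset.sum_filter]
        congr 1
        ext i
        simp only [Finset.mem_filter]
        exact ⟨fun h => h.2, fun h => ⟨hU h, h⟩⟩
      rw [h6] at h4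
      exact (Finset.sum_le_sum_of_subset_of_nonneg (Finset.filter_subset _ _)
        fun _ _ _ => by positivity).trans h4
    calc K₂ / 2 * ∑ l, (D.N k : ℝ) ^ (2 * D.d k l) * ∑ i, (D.noiseDual k F x l i).re ^ 2
        ≤ K₂ / 2 * (5 * V / D.n k * (5 * ∑ i ∈ U, ‖a i‖ ^ 2)) := by gcongr; exact h2.trans (by gcongr)
      _ = _ := by ring
  · have h4 := (hband m (hFm m hm)).1
    have h5 : ((|m| : ℤ) : ℝ) ≤ ((2 * D.N k : ℤ) : ℝ) := by push_cast; linarith [abs_nonneg (m : ℝ)]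
    exact_mod_cast h5

end Model

/-- Tail of the second moment under an exponential moment bound. -/
lemma lintegral_indicator_le_of_exp {Ω : Type*} [MeasurableSpace Ω] {P : Measure Ω} {R : Ω → ℝ}
    {v t : ℝ} (hv : 0 < v) {E : ℝ≥0∞}
    (h : ∫⁻ ω, ENNReal.ofReal (Real.exp (R ω / (4 * v))) ∂P ≤ E) :
    ∫⁻ ω, ENNReal.ofReal (if t ≤ R ω then R ω else 0) ∂P ≤
      ENNReal.ofReal (8 * v * Real.exp (-(t / (8 * v)))) * E := by
  calc ∫⁻ ω, ENNReal.ofReal (if t ≤ R ω then R ω else 0) ∂P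
      ≤ ∫⁻ ω, ENNReal.ofReal (8 * v * Real.exp (-(t / (8 * v)))) *
          ENNReal.ofReal (Real.exp (R ω / (4 * v))) ∂P := by
        refine lintegral_mono fun ω => ?_
        rw [← ENNReal.ofReal_mul (by positivity)]
        refine ENNReal.ofReal_le_ofReal ?_
        split_ifs with ht
        -- Half of the available exponent absorbs the factor `R`, the other half gives the Chernoff
        -- bound on `R ≥ t`.
        · have h1 : R ω / (8 * v) ≤ Real.exp (R ω / (8 * v)) := by
            linarith [Real.add_one_le_exp (R ω / (8 * v))]
          have h2 : 1 ≤ Real.exp (R ω / (8 * v) - t / (8 * v)) := by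
            rw [Real.one_le_exp_iff, sub_nonneg]; gcongr
          have h3 : R ω = 8 * v * (R ω / (8 * v)) := by field_simp
          have h4 : Real.exp (-(t / (8 * v))) * Real.exp (R ω / (4 * v)) =
              Real.exp (R ω / (8 * v)) * Real.exp (R ω / (8 * v) - t / (8 * v)) := by
            rw [← Real.exp_add, ← Real.exp_add]; congr 1; field_simp; ring
          rw [mul_assoc, h4]
          calc R ω = 8 * v * (R ω / (8 * v) * 1) := by rw [mul_one]; exact h3
            _ ≤ _ := by gcongr
        · positivity
    _ = ENNReal.ofReal (8 * v * Real.exp (-(t / (8 * v)))) *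
          ∫⁻ ω, ENNReal.ofReal (Real.exp (R ω / (4 * v))) ∂P :=
        lintegral_const_mul' _ _ ENNReal.ofReal_ne_top
    _ ≤ _ := by gcongr

namespace Model

variable (D : Model.{v})

/-- Second moment of a block of noise coefficients on the event that it is large. -/
lemma lintegral_noise_block_le {h : ℝ → ℂ} (hh : IsBandKernel h) {K₁ K₂ : ℝ} (hK₂ : 0 < K₂)
    (hA1 : D.AssumptionA1 K₁ K₂) {k j : ℕ} {V : ℝ} (hV : 0 < V)
    (hband : ∀ m : ℤ, h (m / 2 ^ j) ≠ 0 →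
      3 * |(m : ℝ)| ≤ 2 * D.N k ∧ 0 < D.tau k m ∧ (D.tau k m)⁻¹ ≤ V)
    {U : Finset ℕ} (hU : U ⊆ Finset.range (2 ^ j)) (t : ℝ) :
    ∫⁻ ω, ENNReal.ofReal (if t ≤ ∑ i ∈ U, ‖D.noiseCoef h k j i ω‖ ^ 2 then
        ∑ i ∈ U, ‖D.noiseCoef h k j i ω‖ ^ 2 else 0) ∂(D.P k) ≤
      ENNReal.ofReal (8 * (25 * K₂ * V / D.n k) * 2 ^ U.card *
        Real.exp (-(t / (8 * (25 * K₂ * V / D.n k))))) := by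
  have hn : 0 < D.n k := mul_pos (by exact_mod_cast D.N_pos k) (by exact_mod_cast D.M_pos k)
  have hv : 0 < 25 * K₂ * V / D.n k := by positivity
  have h1 := lintegral_exp_sq_norm_le (P := D.P k) (U := U) (D.measurable_noiseCoef h k j) hv
    (D.lintegral_exp_noiseCoef_le hh hK₂ hA1 hV.le hband hU)
  refine (lintegral_indicator_le_of_exp hv h1).trans (le_of_eq ?_)
  rw [← ENNReal.ofReal_mul (by positivity)]
  congr 1
  ring

end Model

/-! ### Block thresholding -/

/-- Blocks are numbered from one, so position `i` lies in block `i / L + 1`; for `r = 0` the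
truncated subtraction in `block` would be misleading. -/
lemma mem_block_iff {L j r i : ℕ} (hL : 0 < L) (hr : 1 ≤ r) :
    i ∈ block L j r ↔ i < 2 ^ j ∧ i / L + 1 = r := by
  simp only [block, Finset.mem_filter, Finset.mem_range]
  refine and_congr_right fun _ => ?_
  rw [← Nat.le_div_iff_mul_le hL, ← Nat.div_lt_iff_lt_mul hL]
  omega

lemma mem_blockIndices {L j i : ℕ} (hL : 0 < L) (hi : i < 2 ^ j) :
    i / L + 1 ∈ blockIndices L j := by
  rw [blockIndices, Finset.mem_Icc]
  refine ⟨Nat.le_add_left 1 _, ?_⟩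
  rw [Nat.add_one_le_iff, Nat.lt_ceil]
  refine Nat.cast_div_le.trans_lt ?_
  have h1 : (i : ℝ) < 2 ^ j := by exact_mod_cast hi
  have h2 : (0 : ℝ) < L := by exact_mod_cast hL
  gcongr

lemma sum_block {M : Type*} [AddCommMonoid M] {L : ℕ} (hL : 0 < L) (j : ℕ) (g : ℕ → ℕ → M) :
    ∑ r ∈ blockIndices L j, ∑ i ∈ block L j r, g r i =
      ∑ i ∈ Finset.range (2 ^ j), g (i / L + 1) i := by
  rw [← Finset.sum_fiberwise_of_maps_to (s := Finset.range (2 ^ j)) (t := blockIndices L j)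
    (g := fun i => i / L + 1) fun i hi => mem_blockIndices hL (Finset.mem_range.mp hi)]
  refine Finset.sum_congr rfl fun r hr => ?_
  have hr1 : 1 ≤ r := (Finset.mem_Icc.mp hr).1
  have h1 : block L j r = (Finset.range (2 ^ j)).filter fun i => i / L + 1 = r := by
    ext i
    rw [mem_block_iff hL hr1, Finset.mem_filter, Finset.mem_range]
  rw [h1]
  refine Finset.sum_congr rfl fun i hi => ?_
  rw [(Finset.mem_filter.mp hi).2]

lemma card_block_le (L j r : ℕ) : (block L j r).card ≤ L := by
  have h1 : block L j r ⊆ Finset.Ico ((r - 1) * L) (r * L) := fun i hi => by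
    rw [Finset.mem_Ico]
    exact (Finset.mem_filter.mp hi).2
  refine (Finset.card_le_card h1).trans ?_
  rw [Nat.card_Ico, ← Nat.sub_mul]
  have h2 : r - (r - 1) ≤ 1 := by omega
  nlinarith

lemma block_subset (L j r : ℕ) : block L j r ⊆ Finset.range (2 ^ j) := Finset.filter_subset _ _

lemma card_blockIndices_le (L j : ℕ) : ((blockIndices L j).card : ℝ) ≤ 2 ^ j / L + 1 := by
  rw [blockIndices, Nat.card_Icc, Nat.add_sub_cancel]
  exact (Nat.ceil_lt_add_one (by positivity)).le

lemma card_blockIndices_le_pow {L : ℕ} (hL : 0 < L) (j : ℕ) :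
    ((blockIndices L j).card : ℝ) ≤ 2 ^ j := by
  rw [blockIndices, Nat.card_Icc, Nat.add_sub_cancel]
  have h1 : ⌈(2 : ℝ) ^ j / L⌉₊ ≤ 2 ^ j := by
    rw [Nat.ceil_le]
    push_cast
    exact div_le_self (by positivity) (by exact_mod_cast hL)
  exact_mod_cast h1

lemma sum_sq_norm_add_le {ι : Type*} (U : Finset ι) (x y : ι → ℂ) :
    ∑ i ∈ U, ‖x i + y i‖ ^ 2 ≤ 2 * ∑ i ∈ U, ‖x i‖ ^ 2 + 2 * ∑ i ∈ U, ‖y i‖ ^ 2 := by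
  rw [Finset.mul_sum, Finset.mul_sum, ← Finset.sum_add_distrib]
  refine Finset.sum_le_sum fun i _ => ?_
  have h1 := norm_add_le (x i) (y i)
  have h2 := norm_nonneg (x i + y i)
  nlinarith [sq_nonneg (‖x i‖ - ‖y i‖)]

/-- Loss of block thresholding, with bias `δ` small compared to the threshold and noise `z`. -/
lemma block_loss_le {ι : Type*} (U : Finset ι) (b δ z : ι → ℂ) {θ : ℝ} (hθ : 0 ≤ θ)
    (hδ : ∑ i ∈ U, ‖δ i‖ ^ 2 ≤ θ / 16) :
    ∑ i ∈ U, ‖(if θ ≤ ∑ i ∈ U, ‖b i + (δ i + z i)‖ ^ 2 then b i + (δ i + z i) else 0) - b i‖ ^ 2 ≤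
      3 * min (∑ i ∈ U, ‖b i‖ ^ 2) θ +
        54 * (if θ / 16 ≤ ∑ i ∈ U, ‖z i‖ ^ 2 then ∑ i ∈ U, ‖z i‖ ^ 2 else 0) := by
  have h1 := sum_sq_norm_add_le U δ z
  have h2 := sum_sq_norm_add_le U b fun i => δ i + z i
  have h3 := sum_sq_norm_add_le U (fun i => b i + (δ i + z i)) fun i => -(δ i + z i)
  simp only [norm_neg, add_neg_cancel_right] at h3
  set B := ∑ i ∈ U, ‖b i‖ ^ 2 with hB
  set Z := ∑ i ∈ U, ‖z i‖ ^ 2 with hZ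
  set E := ∑ i ∈ U, ‖δ i + z i‖ ^ 2 with hE
  set Y := ∑ i ∈ U, ‖b i + (δ i + z i)‖ ^ 2 with hY
  have hB0 : 0 ≤ B := by positivity
  have hmin : 0 ≤ min B θ := le_min hB0 hθ
  -- With `E ≤ 2Δ + 2Z`, where `Δ` is the bias energy: if `Z ≥ θ/16`, everything is bounded by a
  -- multiple of `Z`. Otherwise `E ≤ θ/4`; a kept block then has `B ≥ θ/4`, so its loss `E` is at
  -- most `min(B, θ)`, and a discarded one has `B ≤ 3θ`, so its loss `B` is at most `3 min(B, θ)`.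
  split_ifs with hk hz hz
  · simp only [add_sub_cancel_left]
    linarith
  · simp only [add_sub_cancel_left]
    have : θ / 4 ≤ min B θ := le_min (by linarith) (by linarith)
    linarith
  · simp only [zero_sub, norm_neg]
    linarith
  · simp only [zero_sub, norm_neg]
    have : B / 3 ≤ min B θ := le_min (by linarith) (by linarith)
    linarith

/-! ### Risk of the block-thresholding estimator at a fixed sample size. -/

namespace Model

variable (D : Model.{v})

lemma coefHat_periodized {h : ℝ → ℂ} (hh : IsBandKernel h) (k : ℕ)
    (y : Fin (D.M k) → Fin (D.N k) → ℝ) (j i : ℕ) :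
    D.coefHat k y (periodized (𝓕⁻ h) j i) = coefOf h (D.fHatCoef k y) j i := by
  simp only [coefHat, hh.fourierCoef_periodized, coefOf]
  refine finsum_eq_sum_of_support_subset _ fun m hm => ?_
  by_contra hm'
  exact hm (by simp [hh.modeCoef_eq_zero i (by exact_mod_cast hm')])

/-- The contribution of aliasing to an estimated wavelet coefficient. -/
def aliasCoef (h : ℝ → ℂ) (k : ℕ) (f : ℝ → ℝ) (j i : ℕ) : ℂ :=
  coefOf h (D.aliasBias k f) j i

lemma coefHat_obs {h : ℝ → ℂ} (hh : IsBandKernel h) (k : ℕ) {f : ℝ → ℝ}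
    (hf : MemLp f 2 (volume.restrict (Set.Icc (0 : ℝ) 1))) (j i : ℕ) (ω : D.Ω k) :
    D.coefHat k (fun l i' => D.obs f k l i' ω) (periodized (𝓕⁻ h) j i) =
      innerCoef f (periodized (𝓕⁻ h) j i) + (D.aliasCoef h k f j i + D.noiseCoef h k j i ω) := by
  rw [D.coefHat_periodized hh, hh.innerCoef_periodized j i hf]
  simp only [aliasCoef, noiseCoef, coefOf, ← Finset.sum_add_distrib, ← add_mul]
  refine Finset.sum_congr rfl fun m _ => ?_
  congr 1
  rw [aliasBias, ← add_assoc, add_sub_cancel]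
  exact D.fHatCoef_add k (D.signal f k) (fun l i' => D.ξ k l ω i') m

/-- In this form the estimator is a plain multilevel expansion with data-dependent coefficients, to
which `lintegral_multilevel_sub_le` applies for each outcome. -/
lemma blockEstimator_eq (w : ℝ → ℝ) (j₀ J : ℕ) {L : ℕ} (hL : 0 < L) (thr : ℕ → ℝ) (k : ℕ)
    (y : Fin (D.M k) → Fin (D.N k) → ℝ) (t : ℝ) :
    D.blockEstimator w j₀ J L thr k y t =
      ∑ i ∈ Finset.range (2 ^ j₀), D.coefHat k y (phi w j₀ i) * phi w j₀ i t +
      ∑ j ∈ Finset.Ico j₀ J, ∑ i ∈ Finset.range (2 ^ j),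
        (if thr j ≤ ∑ i' ∈ block L j (i / L + 1), ‖D.coefHat k y (psi w j i')‖ ^ 2 then
          D.coefHat k y (psi w j i) else 0) * psi w j i t := by
  rw [blockEstimator]
  congr 1
  refine Finset.sum_congr rfl fun j _ => ?_
  rw [← sum_block hL j fun r i => (if thr j ≤ ∑ i' ∈ block L j r,
    ‖D.coefHat k y (psi w j i')‖ ^ 2 then D.coefHat k y (psi w j i) else 0) * psi w j i t]
  refine Finset.sum_congr rfl fun r _ => ?_
  split_ifs <;> simp

/-- The variance proxy of a noise coefficient when `τ₁⁻¹ ≤ V` on the band of the wavelet. -/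
def noiseLevel (K₂ : ℝ) (k : ℕ) (V : ℝ) : ℝ := 25 * K₂ * V / D.n k

lemma n_pos (k : ℕ) : 0 < D.n k :=
  mul_pos (by exact_mod_cast D.N_pos k) (by exact_mod_cast D.M_pos k)

/-- Band condition: the sampling rate and the kernels resolve the band of `h` at level `j`. -/
def BandBound (h : ℝ → ℂ) (k j : ℕ) (V : ℝ) : Prop :=
  ∀ m : ℤ, h (m / 2 ^ j) ≠ 0 →
    3 * |(m : ℝ)| ≤ 2 * D.N k ∧ 0 < D.tau k m ∧ (D.tau k m)⁻¹ ≤ V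

/-- A singleton block with cutoff zero turns the deviation bound into a second moment bound, with
constant `16 = 8 * 2`. -/
lemma lintegral_scaling_le {h : ℝ → ℂ} (hh : IsBandKernel h) {K₁ K₂ : ℝ} (hK₂ : 0 < K₂)
    (hA1 : D.AssumptionA1 K₁ K₂) {k j : ℕ} {V Δ : ℝ} (hV : 0 < V) (hband : D.BandBound h k j V)
    {f : ℝ → ℝ} (hΔ : ∑ i ∈ Finset.range (2 ^ j), ‖D.aliasCoef h k f j i‖ ^ 2 ≤ Δ) :
    ∫⁻ ω, ENNReal.ofReal (∑ i ∈ Finset.range (2 ^ j),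
        ‖D.aliasCoef h k f j i + D.noiseCoef h k j i ω‖ ^ 2) ∂(D.P k) ≤
      ENNReal.ofReal (2 * Δ + 32 * 2 ^ j * D.noiseLevel K₂ k V) := by
  have hn := D.n_pos k
  have hΔ0 : 0 ≤ Δ := le_trans (by positivity) hΔ
  have hσ : 0 < D.noiseLevel K₂ k V := by unfold noiseLevel; positivity
  have hmeas : ∀ i, Measurable fun ω => ENNReal.ofReal (‖D.noiseCoef h k j i ω‖ ^ 2) := fun i =>
    ((D.measurable_noiseCoef h k j i).norm.pow_const 2).ennreal_ofReal
  have hone : ∀ i ∈ Finset.range (2 ^ j), ∫⁻ ω, ENNReal.ofReal (‖D.noiseCoef h k j i ω‖ ^ 2)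
      ∂(D.P k) ≤ ENNReal.ofReal (16 * D.noiseLevel K₂ k V) := fun i hi => by
    have h1 := D.lintegral_noise_block_le hh hK₂ hA1 hV hband
      (U := {i}) (Finset.singleton_subset_iff.mpr hi) 0
    simp only [Finset.sum_singleton, sq_nonneg, if_true, Finset.card_singleton, zero_div, neg_zero,
      Real.exp_zero, mul_one, pow_one] at h1
    refine h1.trans (le_of_eq ?_)
    rw [noiseLevel]; congr 1; ring
  calc ∫⁻ ω, ENNReal.ofReal (∑ i ∈ Finset.range (2 ^ j),
        ‖D.aliasCoef h k f j i + D.noiseCoef h k j i ω‖ ^ 2) ∂(D.P k)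
      ≤ ∫⁻ ω, (ENNReal.ofReal (2 * Δ) + 2 * ∑ i ∈ Finset.range (2 ^ j),
          ENNReal.ofReal (‖D.noiseCoef h k j i ω‖ ^ 2)) ∂(D.P k) := by
        refine lintegral_mono fun ω => ?_
        rw [← ENNReal.ofReal_sum_of_nonneg fun _ _ => by positivity,
          ← ENNReal.ofReal_ofNat 2, ← ENNReal.ofReal_mul (by norm_num),
          ← ENNReal.ofReal_add (by positivity) (by positivity)]
        refine ENNReal.ofReal_le_ofReal ((sum_sq_norm_add_le _ _ _).trans ?_)
        gcongr
    _ = ENNReal.ofReal (2 * Δ) + 2 * ∑ i ∈ Finset.range (2 ^ j),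
          ∫⁻ ω, ENNReal.ofReal (‖D.noiseCoef h k j i ω‖ ^ 2) ∂(D.P k) := by
        rw [lintegral_add_left measurable_const, lintegral_const, measure_univ, mul_one,
          lintegral_const_mul' _ _ (by norm_num), lintegral_finsetSum _ fun i _ => hmeas i]
    _ ≤ ENNReal.ofReal (2 * Δ) + 2 * ∑ i ∈ Finset.range (2 ^ j),
          ENNReal.ofReal (16 * D.noiseLevel K₂ k V) := by
        gcongr with i hi
        exact hone i hi
    _ = _ := by
        rw [← ENNReal.ofReal_sum_of_nonneg fun _ _ => by positivity,
          ← ENNReal.ofReal_ofNat 2, ← ENNReal.ofReal_mul (by norm_num),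
          ← ENNReal.ofReal_add (by positivity) (by positivity)]
        congr 1
        rw [Finset.sum_const, Finset.card_range, nsmul_eq_mul]
        push_cast
        ring

/-- `block_loss_le` summed over the blocks. A block has at most `L` positions, whence `2^L`; there
are at most `2^j` blocks; and `432 = 54 * 8`. -/
lemma lintegral_level_le {h : ℝ → ℂ} (hh : IsBandKernel h) {K₁ K₂ : ℝ} (hK₂ : 0 < K₂)
    (hA1 : D.AssumptionA1 K₁ K₂) {k j L : ℕ} (hL : 0 < L) {V θ : ℝ} (hV : 0 < V) (hθ : 0 ≤ θ)
    (hband : D.BandBound h k j V) {f : ℝ → ℝ} (b : ℕ → ℂ)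
    (hΔ : ∑ i ∈ Finset.range (2 ^ j), ‖D.aliasCoef h k f j i‖ ^ 2 ≤ θ / 16) :
    ∫⁻ ω, ENNReal.ofReal (∑ i ∈ Finset.range (2 ^ j),
        ‖(if θ ≤ ∑ i' ∈ block L j (i / L + 1),
          ‖b i' + (D.aliasCoef h k f j i' + D.noiseCoef h k j i' ω)‖ ^ 2 then
          b i + (D.aliasCoef h k f j i + D.noiseCoef h k j i ω) else 0) - b i‖ ^ 2) ∂(D.P k) ≤
      ENNReal.ofReal (3 * ∑ r ∈ blockIndices L j, min (∑ i ∈ block L j r, ‖b i‖ ^ 2) θ +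
        432 * 2 ^ L * 2 ^ j * D.noiseLevel K₂ k V *
          Real.exp (-(θ / (128 * D.noiseLevel K₂ k V)))) := by
  have hn := D.n_pos k
  set σ := D.noiseLevel K₂ k V with hσdef
  have hσ : 0 < σ := by rw [hσdef]; unfold noiseLevel; positivity
  set Z : ℕ → D.Ω k → ℝ := fun r ω => if θ / 16 ≤ ∑ i ∈ block L j r, ‖D.noiseCoef h k j i ω‖ ^ 2 then
    ∑ i ∈ block L j r, ‖D.noiseCoef h k j i ω‖ ^ 2 else 0 with hZ
  have hZ0 : ∀ r ω, 0 ≤ Z r ω := fun r ω => by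
    simp only [hZ]; split_ifs <;> positivity
  have hmeas : ∀ r, Measurable fun ω => ENNReal.ofReal (Z r ω) := fun r => by
    have h1 : Measurable fun ω => ∑ i ∈ block L j r, ‖D.noiseCoef h k j i ω‖ ^ 2 :=
      Finset.measurable_sum _ fun i _ => (D.measurable_noiseCoef h k j i).norm.pow_const 2
    exact (Measurable.ite (measurableSet_le measurable_const h1) h1 measurable_const).ennreal_ofReal
  have hone : ∀ r, ∫⁻ ω, ENNReal.ofReal (Z r ω) ∂(D.P k) ≤
      ENNReal.ofReal (8 * σ * 2 ^ L * Real.exp (-(θ / (128 * σ)))) := fun r => by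
    refine (D.lintegral_noise_block_le hh hK₂ hA1 hV hband (block_subset L j r) (θ / 16)).trans ?_
    refine ENNReal.ofReal_le_ofReal ?_
    change 8 * σ * _ * Real.exp (-(θ / 16 / (8 * σ))) ≤ _
    rw [div_div, show 16 * (8 * σ) = 128 * σ by ring]
    gcongr
    · norm_num
    · exact card_block_le L j r
  have hmin : ∀ r, 0 ≤ min (∑ i ∈ block L j r, ‖b i‖ ^ 2) θ := fun r =>
    le_min (by positivity) hθ
  have hminsum : 0 ≤ 3 * ∑ r ∈ blockIndices L j, min (∑ i ∈ block L j r, ‖b i‖ ^ 2) θ :=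
    mul_nonneg (by norm_num) (Finset.sum_nonneg fun r _ => hmin r)
  calc _ ≤ ∫⁻ ω, (ENNReal.ofReal (3 * ∑ r ∈ blockIndices L j,
          min (∑ i ∈ block L j r, ‖b i‖ ^ 2) θ) + ENNReal.ofReal 54 * ∑ r ∈ blockIndices L j,
            ENNReal.ofReal (Z r ω)) ∂(D.P k) := by
        refine lintegral_mono fun ω => ?_
        rw [← ENNReal.ofReal_sum_of_nonneg fun r _ => hZ0 r ω,
          ← ENNReal.ofReal_mul (by norm_num),
          ← ENNReal.ofReal_add hminsum
            (mul_nonneg (by norm_num) (Finset.sum_nonneg fun r _ => hZ0 r ω))]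
        refine ENNReal.ofReal_le_ofReal ?_
        rw [← sum_block hL j fun r i => ‖(if θ ≤ ∑ i' ∈ block L j r,
          ‖b i' + (D.aliasCoef h k f j i' + D.noiseCoef h k j i' ω)‖ ^ 2 then
          b i + (D.aliasCoef h k f j i + D.noiseCoef h k j i ω) else 0) - b i‖ ^ 2,
          Finset.mul_sum, Finset.mul_sum, ← Finset.sum_add_distrib]
        refine Finset.sum_le_sum fun r _ => ?_
        exact block_loss_le (block L j r) b (D.aliasCoef h k f j) (fun i => D.noiseCoef h k j i ω) hθ
          ((Finset.sum_le_sum_of_subset_of_nonneg (block_subset L j r)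
            fun _ _ _ => by positivity).trans hΔ)
    _ = ENNReal.ofReal (3 * ∑ r ∈ blockIndices L j, min (∑ i ∈ block L j r, ‖b i‖ ^ 2) θ) +
          ENNReal.ofReal 54 * ∑ r ∈ blockIndices L j,
            ∫⁻ ω, ENNReal.ofReal (Z r ω) ∂(D.P k) := by
        rw [lintegral_add_left measurable_const, lintegral_const, measure_univ, mul_one,
          lintegral_const_mul' _ _ ENNReal.ofReal_ne_top,
          lintegral_finsetSum _ fun r _ => hmeas r]
    _ ≤ ENNReal.ofReal (3 * ∑ r ∈ blockIndices L j, min (∑ i ∈ block L j r, ‖b i‖ ^ 2) θ) +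
          ENNReal.ofReal 54 * ∑ r ∈ blockIndices L j,
            ENNReal.ofReal (8 * σ * 2 ^ L * Real.exp (-(θ / (128 * σ)))) := by
        gcongr with r hr
        exact hone r
    _ ≤ _ := by
        rw [← ENNReal.ofReal_sum_of_nonneg fun r _ => by positivity,
          ← ENNReal.ofReal_mul (by norm_num),
          ← ENNReal.ofReal_add hminsum (by positivity)]
        refine ENNReal.ofReal_le_ofReal ?_
        rw [Finset.sum_const, nsmul_eq_mul]
        have h2 := card_blockIndices_le_pow hL j
        calc _ ≤ 3 * ∑ r ∈ blockIndices L j, min (∑ i ∈ block L j r, ‖b i‖ ^ 2) θ +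
              54 * (2 ^ j * (8 * σ * 2 ^ L * Real.exp (-(θ / (128 * σ))))) := by gcongr
          _ = _ := by ring

/-- The risk of the block-thresholding estimator at a fixed sample size. -/
theorem risk_blockEstimator_le {w : ℝ → ℝ} (hw : IsMeyerAuxiliary w) {f : ℝ → ℝ}
    (hf : MemLp f 2 (volume.restrict (Set.Icc (0 : ℝ) 1))) {K₁ K₂ : ℝ} (hK₂ : 0 < K₂)
    (hA1 : D.AssumptionA1 K₁ K₂) {k j₀ J L : ℕ} (hJ : j₀ ≤ J) (hL : 0 < L) {thr : ℕ → ℝ}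
    (hthr : ∀ j ∈ Finset.Ico j₀ J, 0 ≤ thr j) {V₀ Δ₀ : ℝ} (hV₀ : 0 < V₀)
    (hband₀ : D.BandBound (meyerScalingHat w) k j₀ V₀)
    (hΔ₀ : ∑ i ∈ Finset.range (2 ^ j₀), ‖D.aliasCoef (meyerScalingHat w) k f j₀ i‖ ^ 2 ≤ Δ₀)
    {V : ℕ → ℝ} (hV : ∀ j ∈ Finset.Ico j₀ J, 0 < V j)
    (hband : ∀ j ∈ Finset.Ico j₀ J, D.BandBound (meyerWaveletHat w) k j (V j))
    (hΔ : ∀ j ∈ Finset.Ico j₀ J, ∑ i ∈ Finset.range (2 ^ j),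
      ‖D.aliasCoef (meyerWaveletHat w) k f j i‖ ^ 2 ≤ thr j / 16) :
    D.risk k (D.blockEstimator w j₀ J L thr k) f ≤
      15 * (ENNReal.ofReal (2 * Δ₀ + 32 * 2 ^ j₀ * D.noiseLevel K₂ k V₀) +
        (∑ j ∈ Finset.Ico j₀ J, ENNReal.ofReal
          (3 * ∑ r ∈ blockIndices L j,
              min (∑ i ∈ block L j r, ‖innerCoef f (psi w j i)‖ ^ 2) (thr j) +
            432 * 2 ^ L * 2 ^ j * D.noiseLevel K₂ k (V j) *
              Real.exp (-(thr j / (128 * D.noiseLevel K₂ k (V j))))) +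
        ∑' i, ENNReal.ofReal (∑ i' ∈ Finset.range (2 ^ (J + i)),
          ‖innerCoef f (psi w (J + i) i')‖ ^ 2))) := by
  have hH := isBandKernel_meyerScalingHat hw
  have hG := isBandKernel_meyerWaveletHat hw
  have hphi : ∀ i ω, D.coefHat k (fun l i' => D.obs f k l i' ω) (phi w j₀ i) =
      innerCoef f (phi w j₀ i) + (D.aliasCoef (meyerScalingHat w) k f j₀ i +
        D.noiseCoef (meyerScalingHat w) k j₀ i ω) := fun i ω => D.coefHat_obs hH k hf j₀ i ω
  have hpsi : ∀ j i ω, D.coefHat k (fun l i' => D.obs f k l i' ω) (psi w j i) =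
      innerCoef f (psi w j i) + (D.aliasCoef (meyerWaveletHat w) k f j i +
        D.noiseCoef (meyerWaveletHat w) k j i ω) := fun j i ω => D.coefHat_obs hG k hf j i ω
  have hm1 : Measurable fun ω => ENNReal.ofReal (∑ i ∈ Finset.range (2 ^ j₀),
      ‖D.aliasCoef (meyerScalingHat w) k f j₀ i +
        D.noiseCoef (meyerScalingHat w) k j₀ i ω‖ ^ 2) :=
    (Finset.measurable_sum _ fun i _ =>
      ((D.measurable_noiseCoef _ k j₀ i).const_add _).norm.pow_const 2).ennreal_ofReal
  have hm2 : ∀ j, Measurable fun ω => ENNReal.ofReal (∑ i ∈ Finset.range (2 ^ j),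
      ‖(if thr j ≤ ∑ i' ∈ block L j (i / L + 1), ‖innerCoef f (psi w j i') +
          (D.aliasCoef (meyerWaveletHat w) k f j i' +
            D.noiseCoef (meyerWaveletHat w) k j i' ω)‖ ^ 2 then
          innerCoef f (psi w j i) + (D.aliasCoef (meyerWaveletHat w) k f j i +
            D.noiseCoef (meyerWaveletHat w) k j i ω) else 0) - innerCoef f (psi w j i)‖ ^ 2) := by
    intro j
    have h1 : ∀ i, Measurable fun ω => innerCoef f (psi w j i) +
        (D.aliasCoef (meyerWaveletHat w) k f j i + D.noiseCoef (meyerWaveletHat w) k j i ω) :=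
      fun i => ((D.measurable_noiseCoef _ k j i).const_add _).const_add _
    refine (Finset.measurable_sum _ fun i _ => ?_).ennreal_ofReal
    refine ((Measurable.ite (measurableSet_le measurable_const ?_) (h1 i)
      measurable_const).sub_const _).norm.pow_const 2
    exact Finset.measurable_sum _ fun i' _ => (h1 i').norm.pow_const 2
  calc D.risk k (D.blockEstimator w j₀ J L thr k) f
      ≤ ∫⁻ ω, 15 * (ENNReal.ofReal (∑ i ∈ Finset.range (2 ^ j₀),
          ‖D.aliasCoef (meyerScalingHat w) k f j₀ i +
            D.noiseCoef (meyerScalingHat w) k j₀ i ω‖ ^ 2) +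
        (∑ j ∈ Finset.Ico j₀ J, ENNReal.ofReal (∑ i ∈ Finset.range (2 ^ j),
          ‖(if thr j ≤ ∑ i' ∈ block L j (i / L + 1), ‖innerCoef f (psi w j i') +
              (D.aliasCoef (meyerWaveletHat w) k f j i' +
                D.noiseCoef (meyerWaveletHat w) k j i' ω)‖ ^ 2 then
              innerCoef f (psi w j i) + (D.aliasCoef (meyerWaveletHat w) k f j i +
                D.noiseCoef (meyerWaveletHat w) k j i ω) else 0) -
              innerCoef f (psi w j i)‖ ^ 2) +
        ∑' i, ENNReal.ofReal (∑ i' ∈ Finset.range (2 ^ (J + i)),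
          ‖innerCoef f (psi w (J + i) i')‖ ^ 2))) ∂(D.P k) := by
        refine lintegral_mono fun ω => ?_
        simp only [D.blockEstimator_eq w j₀ J hL]
        refine (lintegral_multilevel_sub_le hw hf hJ _ _).trans ?_
        simp only [hphi, hpsi, add_sub_cancel_left]
        exact le_rfl
    _ = 15 * (∫⁻ ω, ENNReal.ofReal (∑ i ∈ Finset.range (2 ^ j₀),
          ‖D.aliasCoef (meyerScalingHat w) k f j₀ i +
            D.noiseCoef (meyerScalingHat w) k j₀ i ω‖ ^ 2) ∂(D.P k) +
        (∑ j ∈ Finset.Ico j₀ J, ∫⁻ ω, ENNReal.ofReal (∑ i ∈ Finset.range (2 ^ j),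
          ‖(if thr j ≤ ∑ i' ∈ block L j (i / L + 1), ‖innerCoef f (psi w j i') +
              (D.aliasCoef (meyerWaveletHat w) k f j i' +
                D.noiseCoef (meyerWaveletHat w) k j i' ω)‖ ^ 2 then
              innerCoef f (psi w j i) + (D.aliasCoef (meyerWaveletHat w) k f j i +
                D.noiseCoef (meyerWaveletHat w) k j i ω) else 0) -
              innerCoef f (psi w j i)‖ ^ 2) ∂(D.P k) +
        ∑' i, ENNReal.ofReal (∑ i' ∈ Finset.range (2 ^ (J + i)),
          ‖innerCoef f (psi w (J + i) i')‖ ^ 2))) := by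
        rw [lintegral_const_mul' _ _ (by norm_num), lintegral_add_left hm1,
          lintegral_add_right _ measurable_const, lintegral_finsetSum _ fun j _ => hm2 j,
          lintegral_const, measure_univ, mul_one]
    _ ≤ _ := by
        gcongr with j hj
        · exact D.lintegral_scaling_le hH hK₂ hA1 hV₀ hband₀ hΔ₀
        · exact D.lintegral_level_le hG hK₂ hA1 hL (hV j hj) (hthr j hj) (hband j hj) _ (hΔ j hj)

lemma sum_sq_aliasCoef_le {h : ℝ → ℂ} (hh : IsBandKernel h) (k : ℕ) (f : ℝ → ℝ) (j : ℕ) :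
    ∑ i ∈ Finset.range (2 ^ j), ‖D.aliasCoef h k f j i‖ ^ 2 ≤
      5 * ∑ m ∈ (modes j).filter (fun m : ℤ => h (m / 2 ^ j) ≠ 0), ‖D.aliasBias k f m‖ ^ 2 :=
  hh.sum_sq_coefOf_le j _

end Model

/-! ### Besov balls -/

lemma le_ellNorm {ι : Type} {p : ℝ≥0∞} (hp : 1 ≤ p) (a : ι → ℝ≥0∞) (i : ι) :
    a i ≤ ellNorm p a := by
  unfold ellNorm
  split_ifs with h
  · exact le_iSup a i
  · have h0 : 0 < p.toReal := ENNReal.toReal_pos (by rintro rfl; simp at hp) h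
    calc a i = (a i ^ p.toReal) ^ (1 / p.toReal) := by
          rw [← ENNReal.rpow_mul, mul_one_div_cancel h0.ne', ENNReal.rpow_one]
      _ ≤ _ := by
          gcongr
          exact ENNReal.le_tsum i

lemma sum_rpow_le_ellNorm {ι : Type} {p : ℝ≥0∞} (hp : 1 ≤ p) (hp' : p ≠ ∞) (a : ι → ℝ≥0∞)
    (S : Finset ι) : ∑ i ∈ S, a i ^ p.toReal ≤ ellNorm p a ^ p.toReal := by
  have h0 : 0 < p.toReal := ENNReal.toReal_pos (by rintro rfl; simp at hp) hp'
  rw [ellNorm, if_neg hp', ← ENNReal.rpow_mul, one_div_mul_cancel h0.ne', ENNReal.rpow_one]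
  exact ENNReal.sum_le_tsum S

lemma ellNorm_fin_eq {p : ℝ≥0∞} (hp' : p ≠ ∞) {n : ℕ} (b : ℕ → ℂ) :
    ellNorm p (fun k : Fin n => ‖b k‖ₑ) =
      ENNReal.ofReal ((∑ k ∈ Finset.range n, ‖b k‖ ^ p.toReal) ^ (1 / p.toReal)) := by
  have h0 : 0 ≤ p.toReal := ENNReal.toReal_nonneg
  rw [ellNorm, if_neg hp', tsum_fintype, Finset.sum_range,
    ← ENNReal.ofReal_rpow_of_nonneg (by positivity) (by positivity),
    ENNReal.ofReal_sum_of_nonneg fun _ _ => by positivity]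
  congr 1
  refine Finset.sum_congr rfl fun k _ => ?_
  rw [← ENNReal.ofReal_rpow_of_nonneg (norm_nonneg _) h0, ofReal_norm]

/-- The weighted `ℓ^p` norm of the wavelet coefficients at level `j`. -/
def levelNorm (w : ℝ → ℝ) (s : ℝ) (p : ℝ≥0∞) (f : ℝ → ℝ) (j : ℕ) : ℝ :=
  (2 : ℝ) ^ ((j : ℝ) * sPrime s p) *
    (∑ k ∈ Finset.range (2 ^ j), ‖innerCoef f (psi w j k)‖ ^ p.toReal) ^ (1 / p.toReal)

lemma levelNorm_nonneg (w : ℝ → ℝ) (s : ℝ) (p : ℝ≥0∞) (f : ℝ → ℝ) (j : ℕ) :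
    0 ≤ levelNorm w s p f j := by unfold levelNorm; positivity

lemma besov_term_eq (w : ℝ → ℝ) (s : ℝ) {p : ℝ≥0∞} (hp' : p ≠ ∞) (f : ℝ → ℝ) (j : ℕ) :
    ENNReal.ofReal ((2 : ℝ) ^ ((j : ℝ) * sPrime s p)) *
      ellNorm p (fun k : Fin (2 ^ j) => ‖innerCoef f (psi w j k)‖ₑ) =
    ENNReal.ofReal (levelNorm w s p f j) := by
  rw [ellNorm_fin_eq hp' fun k => innerCoef f (psi w j k), levelNorm,
    ENNReal.ofReal_mul (by positivity)]

lemma besov_term_le {w : ℝ → ℝ} {ℓ : ℕ} {s : ℝ} {p q : ℝ≥0∞} (hq : 1 ≤ q) {A : ℝ} {f : ℝ → ℝ}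
    (hf : f ∈ besovBall w ℓ s p q A) {j : ℕ} (hj : ℓ ≤ j) :
    ENNReal.ofReal ((2 : ℝ) ^ ((j : ℝ) * sPrime s p)) *
      ellNorm p (fun k : Fin (2 ^ j) => ‖innerCoef f (psi w j k)‖ₑ) ≤ ENNReal.ofReal A := by
  obtain ⟨i, rfl⟩ := Nat.exists_eq_add_of_le hj
  refine le_trans ?_ ((le_add_self).trans hf.2)
  exact le_ellNorm hq (fun i : ℕ =>
      ENNReal.ofReal ((2 : ℝ) ^ (((ℓ + i : ℕ) : ℝ) * sPrime s p)) *
        ellNorm p (fun k : Fin (2 ^ (ℓ + i)) => ‖innerCoef f (psi w (ℓ + i) k)‖ₑ)) i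

lemma levelNorm_le {w : ℝ → ℝ} {ℓ : ℕ} {s : ℝ} {p q : ℝ≥0∞} (hp' : p ≠ ∞) (hq : 1 ≤ q) {A : ℝ}
    (hA : 0 ≤ A) {f : ℝ → ℝ} (hf : f ∈ besovBall w ℓ s p q A) {j : ℕ} (hj : ℓ ≤ j) :
    levelNorm w s p f j ≤ A := by
  rw [← ENNReal.ofReal_le_ofReal_iff hA, ← besov_term_eq w s hp']
  exact besov_term_le hq hf hj

lemma levelNorm_rpow (w : ℝ → ℝ) (s : ℝ) {p : ℝ≥0∞} (hp : 1 ≤ p) (hp' : p ≠ ∞) (f : ℝ → ℝ)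
    (j : ℕ) : levelNorm w s p f j ^ p.toReal = (2 : ℝ) ^ ((j : ℝ) * sPrime s p * p.toReal) *
      ∑ k ∈ Finset.range (2 ^ j), ‖innerCoef f (psi w j k)‖ ^ p.toReal := by
  have h0 : 0 < p.toReal := ENNReal.toReal_pos (by rintro rfl; simp at hp) hp'
  rw [levelNorm, Real.mul_rpow (by positivity) (by positivity), ← Real.rpow_mul (by norm_num),
    ← Real.rpow_mul (by positivity), one_div_mul_cancel h0.ne', Real.rpow_one]

/-- The exponent `p' = min (p, 2)` as a real number. -/
def minExp (p : ℝ≥0∞) : ℝ := (min p 2).toReal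

lemma minExp_mem {p : ℝ≥0∞} (hp : 1 ≤ p) : 1 ≤ minExp p ∧ minExp p ≤ 2 := by
  have h2 : min p 2 ≠ ∞ := (lt_of_le_of_lt (min_le_right p 2) (by norm_num)).ne
  constructor
  · have := ENNReal.toReal_mono h2 (le_min hp (by norm_num : (1 : ℝ≥0∞) ≤ 2))
    simpa [minExp] using this
  · have := ENNReal.toReal_mono (by norm_num) (min_le_right p 2)
    simpa [minExp] using this

lemma sStar_eq (s : ℝ) (p : ℝ≥0∞) : sStar s p = s + 1 / 2 - 1 / minExp p := by
  rw [sStar, ENNReal.toReal_inv, minExp, one_div (min p 2).toReal]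

/-- The `ℓ^{p'}` norm of the coefficients of a level, for functions in a Besov ball. -/
lemma sum_rpow_minExp_le {w : ℝ → ℝ} {ℓ : ℕ} {s : ℝ} {p q : ℝ≥0∞} (hp : 1 ≤ p) (hq : 1 ≤ q)
    {A : ℝ} (hA : 0 ≤ A) {f : ℝ → ℝ} (hf : f ∈ besovBall w ℓ s p q A) {j : ℕ} (hj : ℓ ≤ j) :
    ∑ k ∈ Finset.range (2 ^ j), ‖innerCoef f (psi w j k)‖ ^ minExp p ≤
      A ^ minExp p * (2 : ℝ) ^ (-((j : ℝ) * sStar s p * minExp p)) := by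
  have h2pos : (0 : ℝ) < 2 := by norm_num
  by_cases hp' : p = ∞
  · subst hp'
    have h1 : minExp ∞ = 2 := by simp [minExp]
    have h2 : ∀ k ∈ Finset.range (2 ^ j), ‖innerCoef f (psi w j k)‖ ≤
        A * (2 : ℝ) ^ (-((j : ℝ) * sPrime s ∞)) := fun k hk => by
      have h3 := besov_term_le hq hf hj
      have h4 : ENNReal.ofReal ((2 : ℝ) ^ ((j : ℝ) * sPrime s ∞)) * ‖innerCoef f (psi w j k)‖ₑ ≤
          ENNReal.ofReal A := by
        refine le_trans ?_ h3
        gcongr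
        exact le_ellNorm hp (fun k : Fin (2 ^ j) => ‖innerCoef f (psi w j k)‖ₑ)
          ⟨k, Finset.mem_range.mp hk⟩
      rw [← ofReal_norm, ← ENNReal.ofReal_mul (by positivity),
        ENNReal.ofReal_le_ofReal_iff hA] at h4
      rw [Real.rpow_neg h2pos.le, ← div_eq_mul_inv, le_div_iff₀ (by positivity), mul_comm]
      exact h4
    rw [h1]
    calc ∑ k ∈ Finset.range (2 ^ j), ‖innerCoef f (psi w j k)‖ ^ (2 : ℝ)
        ≤ ∑ k ∈ Finset.range (2 ^ j), (A * (2 : ℝ) ^ (-((j : ℝ) * sPrime s ∞))) ^ (2 : ℝ) := by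
          refine Finset.sum_le_sum fun k hk => ?_
          exact Real.rpow_le_rpow (norm_nonneg _) (h2 k hk) (by norm_num)
      _ = (2 : ℝ) ^ (j : ℝ) * (A ^ (2 : ℝ) * (2 : ℝ) ^ (-((j : ℝ) * sPrime s ∞) * 2)) := by
          rw [Finset.sum_const, Finset.card_range, nsmul_eq_mul,
            Real.mul_rpow hA (by positivity), ← Real.rpow_mul h2pos.le, Real.rpow_natCast]
          push_cast
          rfl
      _ = A ^ (2 : ℝ) * (2 : ℝ) ^ ((j : ℝ) + -((j : ℝ) * sPrime s ∞) * 2) := by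
          rw [Real.rpow_add h2pos]; ring
      _ = _ := by
          rw [sStar_eq, h1, sPrime]
          congr 2
          simp
          ring
  have hp0 : 1 ≤ p.toReal := by
    have := ENNReal.toReal_mono hp' hp
    simpa using this
  have hmain : ∑ k ∈ Finset.range (2 ^ j), ‖innerCoef f (psi w j k)‖ ^ p.toReal ≤
      A ^ p.toReal * (2 : ℝ) ^ (-((j : ℝ) * sPrime s p * p.toReal)) := by
    have h1 := Real.rpow_le_rpow (levelNorm_nonneg w s p f j) (levelNorm_le hp' hq hA hf hj)
      (by linarith : 0 ≤ p.toReal)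
    rw [levelNorm_rpow w s hp hp'] at h1
    rw [Real.rpow_neg h2pos.le, ← div_eq_mul_inv, le_div_iff₀ (by positivity), mul_comm]
    exact h1
  rcases le_total p 2 with h2 | h2
  · have h1 : minExp p = p.toReal := by rw [minExp, min_eq_left h2]
    have h3 : sStar s p = sPrime s p := by rw [sStar, sPrime, min_eq_left h2]
    rw [h1, h3]
    exact hmain
  · have h1 : minExp p = 2 := by rw [minExp, min_eq_right h2]; simp
    have h3 : 2 ≤ p.toReal := by
      have := ENNReal.toReal_mono hp' h2
      simpa using this
    have h4 : sStar s p = s := by rw [sStar_eq, h1]; ring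
    rw [h1, h4]
    set P := p.toReal with hP
    set a : ℕ → ℝ := fun k => ‖innerCoef f (psi w j k)‖ with ha
    have ha0 : ∀ k, 0 ≤ a k := fun k => norm_nonneg _
    -- For `p ≥ 2`, Hölder over the `2^j` positions passes from `ℓ^p` to `ℓ²`; the power of `2^j` it
    -- costs turns the weight `s'` into `s`.
    have h5 := Real.rpow_sum_le_const_mul_sum_rpow (Finset.range (2 ^ j))
      (fun k => a k ^ (2 : ℝ)) (p := P / 2) (by linarith)
    have h6 : ∀ k, |a k ^ (2 : ℝ)| = a k ^ (2 : ℝ) := fun k => abs_of_nonneg (by positivity)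
    have h7 : ∀ k, (a k ^ (2 : ℝ)) ^ (P / 2) = a k ^ P := fun k => by
      rw [← Real.rpow_mul (ha0 k)]; congr 1; ring
    simp only [h6, h7, Finset.card_range] at h5
    have h8 : (∑ k ∈ Finset.range (2 ^ j), a k ^ (2 : ℝ)) ^ (P / 2) ≤
        (A ^ (2 : ℝ) * (2 : ℝ) ^ (-((j : ℝ) * s * 2))) ^ (P / 2) := by
      refine h5.trans ?_
      calc ((2 ^ j : ℕ) : ℝ) ^ (P / 2 - 1) * ∑ k ∈ Finset.range (2 ^ j), a k ^ P
          ≤ ((2 ^ j : ℕ) : ℝ) ^ (P / 2 - 1) *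
              (A ^ P * (2 : ℝ) ^ (-((j : ℝ) * sPrime s p * P))) := by gcongr
        _ = A ^ P * (2 : ℝ) ^ ((j : ℝ) * (P / 2 - 1) + -((j : ℝ) * sPrime s p * P)) := by
            rw [Real.rpow_add h2pos, Real.rpow_mul h2pos.le, Real.rpow_natCast]
            push_cast
            ring
        _ = A ^ P * (2 : ℝ) ^ (-((j : ℝ) * s * 2) * (P / 2)) := by
            congr 2
            rw [sPrime, ENNReal.toReal_inv, ← hP]
            have : P ≠ 0 := by positivity
            field_simp
            ring
        _ = _ := by
            rw [Real.mul_rpow (by positivity) (by positivity), ← Real.rpow_mul hA,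
              ← Real.rpow_mul h2pos.le]
            congr 2
            ring
    exact (Real.rpow_le_rpow_iff (by positivity) (by positivity) (by linarith)).mp h8

/-- The embedding `ℓ^r ⊂ ℓ²`: each entry is at most the `ℓ^r` norm, so `a² = a^{2-r} a^r` can be
summed. -/
lemma sum_sq_le_sum_rpow_rpow {ι : Type*} (S : Finset ι) {a : ι → ℝ} (ha : ∀ i, 0 ≤ a i) {r : ℝ}
    (hr : 1 ≤ r) (hr2 : r ≤ 2) : ∑ i ∈ S, a i ^ 2 ≤ (∑ i ∈ S, a i ^ r) ^ (2 / r) := by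
  have hr0 : 0 < r := by linarith
  have h1 : ∀ i ∈ S, a i ≤ (∑ i ∈ S, a i ^ r) ^ (1 / r) := fun i hi => by
    calc a i = (a i ^ r) ^ (1 / r) := by
          rw [← Real.rpow_mul (ha i), mul_one_div_cancel hr0.ne', Real.rpow_one]
      _ ≤ _ := by
          refine Real.rpow_le_rpow (Real.rpow_nonneg (ha i) r) ?_ (by positivity)
          exact Finset.single_le_sum (f := fun i => a i ^ r)
            (fun i _ => Real.rpow_nonneg (ha i) r) hi
  have hT : 0 ≤ ∑ i ∈ S, a i ^ r := Finset.sum_nonneg fun i _ => Real.rpow_nonneg (ha i) r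
  calc ∑ i ∈ S, a i ^ 2 ≤ ∑ i ∈ S, ((∑ i ∈ S, a i ^ r) ^ (1 / r)) ^ (2 - r) * a i ^ r := by
        refine Finset.sum_le_sum fun i hi => ?_
        have h2 : a i ^ 2 = a i ^ (2 - r) * a i ^ r := by
          rw [← Real.rpow_add_of_nonneg (ha i) (by linarith) hr0.le]; norm_num
        rw [h2]
        exact mul_le_mul_of_nonneg_right (Real.rpow_le_rpow (ha i) (h1 i hi) (by linarith))
          (Real.rpow_nonneg (ha i) r)
    _ = (∑ i ∈ S, a i ^ r) ^ (2 / r) := by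
        rw [← Finset.mul_sum, ← Real.rpow_mul hT]
        nth_rewrite 2 [← Real.rpow_one (∑ i ∈ S, a i ^ r)]
        rw [← Real.rpow_add_of_nonneg hT
          (mul_nonneg (by positivity) (by linarith)) zero_le_one]
        congr 1
        field_simp
        ring

/-- The `ℓ²` norm of the coefficients of a level, for functions in a Besov ball. -/
lemma sum_sq_besov_le {w : ℝ → ℝ} {ℓ : ℕ} {s : ℝ} {p q : ℝ≥0∞} (hp : 1 ≤ p) (hq : 1 ≤ q)
    {A : ℝ} (hA : 0 ≤ A) {f : ℝ → ℝ} (hf : f ∈ besovBall w ℓ s p q A) {j : ℕ} (hj : ℓ ≤ j) :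
    ∑ k ∈ Finset.range (2 ^ j), ‖innerCoef f (psi w j k)‖ ^ 2 ≤
      A ^ 2 * (2 : ℝ) ^ (-(2 * j * sStar s p)) := by
  obtain ⟨h1, h2⟩ := minExp_mem hp
  refine (sum_sq_le_sum_rpow_rpow _ (fun k => norm_nonneg _) h1 h2).trans ?_
  refine (Real.rpow_le_rpow (by positivity) (sum_rpow_minExp_le hp hq hA hf hj)
    (by positivity)).trans (le_of_eq ?_)
  have h0 : minExp p ≠ 0 := by linarith
  rw [Real.mul_rpow (by positivity) (by positivity), ← Real.rpow_mul hA,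
    ← Real.rpow_mul (by norm_num), ← Real.rpow_natCast]
  congr 2
  · field_simp; norm_num
  · field_simp

/-- Summation of the `p`-th powers of the level norms over finitely many levels. -/
lemma sum_levelNorm_rpow_le {w : ℝ → ℝ} {ℓ : ℕ} {s : ℝ} {p q : ℝ≥0∞} (hp : 1 ≤ p) (hp' : p ≠ ∞)
    (hq : 1 ≤ q) {A : ℝ} (hA : 0 ≤ A) {f : ℝ → ℝ} (hf : f ∈ besovBall w ℓ s p q A) {S : Finset ℕ}
    (hS : ∀ j ∈ S, ℓ ≤ j) :
    ∑ j ∈ S, levelNorm w s p f j ^ p.toReal ≤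
      A ^ p.toReal * (S.card : ℝ) ^ (max 0 (1 - p.toReal * (q⁻¹).toReal)) := by
  have hp0 : 1 ≤ p.toReal := by
    have := ENNReal.toReal_mono hp' hp
    simpa using this
  have hle : ∀ j ∈ S, levelNorm w s p f j ≤ A := fun j hj => levelNorm_le hp' hq hA hf (hS j hj)
  have hnn := levelNorm_nonneg w s p f
  by_cases hq' : q = ∞
  · subst hq'
    have h1 : max 0 (1 - p.toReal * ((∞ : ℝ≥0∞)⁻¹).toReal) = 1 := by simp
    rw [h1, Real.rpow_one]
    calc _ ≤ ∑ j ∈ S, A ^ p.toReal := by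
          gcongr with j hj
          · exact hnn j
          · exact hle j hj
      _ = _ := by rw [Finset.sum_const, nsmul_eq_mul, mul_comm]
  have hq0 : 1 ≤ q.toReal := by
    have := ENNReal.toReal_mono hq' hq
    simpa using this
  have hsum : ∑ j ∈ S, levelNorm w s p f j ^ q.toReal ≤ A ^ q.toReal := by
    have h1 := sum_rpow_le_ellNorm hq hq' (fun i : ℕ =>
      ENNReal.ofReal ((2 : ℝ) ^ (((ℓ + i : ℕ) : ℝ) * sPrime s p)) *
        ellNorm p (fun k : Fin (2 ^ (ℓ + i)) => ‖innerCoef f (psi w (ℓ + i) k)‖ₑ))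
      (S.image fun j => j - ℓ)
    rw [Finset.sum_image] at h1
    · have h2 : ∀ j ∈ S, (ENNReal.ofReal ((2 : ℝ) ^ (((ℓ + (j - ℓ) : ℕ) : ℝ) * sPrime s p)) *
          ellNorm p (fun k : Fin (2 ^ (ℓ + (j - ℓ))) =>
            ‖innerCoef f (psi w (ℓ + (j - ℓ)) k)‖ₑ)) ^ q.toReal =
          ENNReal.ofReal (levelNorm w s p f j ^ q.toReal) := fun j hj => by
        rw [besov_term_eq w s hp', Nat.add_sub_of_le (hS j hj),
          ENNReal.ofReal_rpow_of_nonneg (hnn j) (by linarith)]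
      rw [Finset.sum_congr rfl h2,
        ← ENNReal.ofReal_sum_of_nonneg fun j _ => Real.rpow_nonneg (hnn j) _] at h1
      rw [← ENNReal.ofReal_le_ofReal_iff (by positivity)]
      refine h1.trans ?_
      rw [← ENNReal.ofReal_rpow_of_nonneg hA (by linarith)]
      gcongr
      exact le_add_self.trans hf.2
    · intro i hi j hj hij
      have := hS i hi
      have := hS j hj
      simp only at hij
      omega
  have hqinv : (q⁻¹).toReal = 1 / q.toReal := by rw [ENNReal.toReal_inv, one_div]
  -- For `q ≤ p` the spare power is bounded by `A` on each level. For `q > p`, Hölder over the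
  -- levels costs `card^{1-p/q}`, the logarithmic factor on the boundary of the zones.
  rcases le_total q.toReal p.toReal with hqp | hpq
  · have h1 : max 0 (1 - p.toReal * (q⁻¹).toReal) = 0 := by
      rw [max_eq_left]
      rw [hqinv, mul_one_div, sub_nonpos, le_div_iff₀ (by linarith)]
      linarith
    rw [h1, Real.rpow_zero, mul_one]
    calc ∑ j ∈ S, levelNorm w s p f j ^ p.toReal
        ≤ ∑ j ∈ S, A ^ (p.toReal - q.toReal) * levelNorm w s p f j ^ q.toReal := by
          refine Finset.sum_le_sum fun j hj => ?_
          calc levelNorm w s p f j ^ p.toReal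
              = levelNorm w s p f j ^ (p.toReal - q.toReal) * levelNorm w s p f j ^ q.toReal := by
                rw [← Real.rpow_add_of_nonneg (hnn j) (by linarith) (by linarith)]
                congr 1; ring
            _ ≤ _ := mul_le_mul_of_nonneg_right
                (Real.rpow_le_rpow (hnn j) (hle j hj) (by linarith)) (Real.rpow_nonneg (hnn j) _)
      _ ≤ A ^ (p.toReal - q.toReal) * A ^ q.toReal := by
          rw [← Finset.mul_sum]; gcongr
      _ = A ^ p.toReal := by
          rw [← Real.rpow_add_of_nonneg hA (by linarith) (by linarith)]
          congr 1; ring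
  · have h1 : max 0 (1 - p.toReal * (q⁻¹).toReal) = 1 - p.toReal / q.toReal := by
      rw [max_eq_right, hqinv, mul_one_div]
      rw [hqinv, mul_one_div, sub_nonneg, div_le_one (by linarith)]
      exact hpq
    rw [h1]
    set P := p.toReal with hP
    set Q := q.toReal with hQ
    have h5 := Real.rpow_sum_le_const_mul_sum_rpow S (fun j => levelNorm w s p f j ^ P)
      (p := Q / P) (by rw [le_div_iff₀ (by linarith)]; linarith)
    have h6 : ∀ j, |levelNorm w s p f j ^ P| = levelNorm w s p f j ^ P := fun j =>
      abs_of_nonneg (Real.rpow_nonneg (hnn j) _)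
    have h7 : ∀ j, (levelNorm w s p f j ^ P) ^ (Q / P) = levelNorm w s p f j ^ Q := fun j => by
      rw [← Real.rpow_mul (hnn j)]; congr 1; field_simp
    simp only [h6, h7] at h5
    have hP0 : P ≠ 0 := by linarith
    have hQ0 : Q ≠ 0 := by linarith
    have h8 : (∑ j ∈ S, levelNorm w s p f j ^ P) ^ (Q / P) ≤
        (A ^ P * (S.card : ℝ) ^ (1 - P / Q)) ^ (Q / P) := by
      refine h5.trans ((mul_le_mul_of_nonneg_left hsum (by positivity)).trans (le_of_eq ?_))
      rw [Real.mul_rpow (by positivity) (by positivity), ← Real.rpow_mul hA,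
        ← Real.rpow_mul (by positivity), mul_comm]
      congr 2
      · field_simp
      · field_simp
    exact (Real.rpow_le_rpow_iff (Finset.sum_nonneg fun j _ => Real.rpow_nonneg (hnn j) _)
      (by positivity) (by positivity)).mp h8

/-! ### Sums over resolution levels -/

/-- Two-sided comparability lets an exponent of unknown sign be transferred; this is how the factors
`j^{λ₁}` are compared with powers of logarithms. -/
lemma rpow_le_of_comparable {u v K : ℝ} (hu : 0 < u) (hv : 0 < v) (h1 : u ≤ K * v)
    (h2 : v ≤ K * u) (γ : ℝ) : u ^ γ ≤ K ^ |γ| * v ^ γ := by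
  have hK : 0 < K := by
    by_contra hK
    nlinarith
  rcases le_total 0 γ with hγ | hγ
  · rw [abs_of_nonneg hγ, ← Real.mul_rpow hK.le hv.le]
    exact Real.rpow_le_rpow hu.le h1 hγ
  · rw [abs_of_nonpos hγ, Real.rpow_neg hK.le, ← Real.inv_rpow hK.le,
      ← Real.mul_rpow (by positivity) hv.le]
    refine Real.rpow_le_rpow_of_nonpos (by positivity) ?_ hγ
    rw [inv_mul_le_iff₀ hK]
    exact h2

lemma natCast_rpow_le {j m : ℕ} (hj : 1 ≤ j) (hm : 1 ≤ m) (lam : ℝ) {i : ℕ}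
    (h1 : j ≤ m + i) (h2 : m ≤ j + i) :
    (j : ℝ) ^ lam ≤ (1 + i : ℝ) ^ |lam| * (m : ℝ) ^ lam := by
  have hj' : (1 : ℝ) ≤ j := by exact_mod_cast hj
  have hm' : (1 : ℝ) ≤ m := by exact_mod_cast hm
  have h1' : (j : ℝ) ≤ m + i := by exact_mod_cast h1
  have h2' : (m : ℝ) ≤ j + i := by exact_mod_cast h2
  have hi : (0 : ℝ) ≤ i := Nat.cast_nonneg i
  refine rpow_le_of_comparable (by linarith) (by linarith) ?_ ?_ lam <;> nlinarith

/-- The constant in the summation of `2^{±jδ} j^λ` over levels. -/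
def zoneConst (δ lam : ℝ) : ℝ := ∑' i : ℕ, (2 : ℝ) ^ (-((i : ℝ) * δ)) * (1 + i : ℝ) ^ |lam|

lemma summable_zoneConst {δ : ℝ} (hδ : 0 < δ) (lam : ℝ) :
    Summable fun i : ℕ => (2 : ℝ) ^ (-((i : ℝ) * δ)) * (1 + i : ℝ) ^ |lam| := by
  set r : ℝ := (2 : ℝ) ^ (-δ) with hr
  have hr0 : 0 < r := by positivity
  have hr1 : r < 1 := Real.rpow_lt_one_of_one_lt_of_neg (by norm_num) (by linarith)
  have h1 := summable_pow_mul_geometric_of_norm_lt_one ⌈|lam|⌉₊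
    (r := r) (by rwa [Real.norm_of_nonneg hr0.le])
  have h2 := ((summable_nat_add_iff 1).mpr h1).mul_left r⁻¹
  refine Summable.of_nonneg_of_le (fun i => by positivity) (fun i => ?_) h2
  have h3 : (2 : ℝ) ^ (-((i : ℝ) * δ)) = r ^ i := by
    rw [hr, ← Real.rpow_natCast, ← Real.rpow_mul (by norm_num)]; congr 1; ring
  have h4 : (1 + i : ℝ) ^ |lam| ≤ ((i + 1 : ℕ) : ℝ) ^ ⌈|lam|⌉₊ := by
    rw [← Real.rpow_natCast, Nat.cast_add, Nat.cast_one, add_comm]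
    exact Real.rpow_le_rpow_of_exponent_le (by linarith [Nat.cast_nonneg (α := ℝ) i])
      (Nat.le_ceil _)
  rw [h3, pow_succ]
  calc r ^ i * (1 + i : ℝ) ^ |lam| ≤ r ^ i * ((i + 1 : ℕ) : ℝ) ^ ⌈|lam|⌉₊ := by gcongr
    _ = _ := by field_simp

lemma zoneConst_nonneg (δ lam : ℝ) : 0 ≤ zoneConst δ lam :=
  tsum_nonneg fun _ => by positivity

/-- A geometrically growing sum is dominated by its last level; at distance `i` from it the factor
`j^λ` changes by at most `(1 + i)^{|λ|}`, which the geometric decay absorbs. -/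
lemma sum_low_levels_le {δ : ℝ} (hδ : 0 < δ) (lam : ℝ) {m : ℕ} {S : Finset ℕ}
    (hS : ∀ j ∈ S, 1 ≤ j ∧ j ≤ m) :
    ∑ j ∈ S, (2 : ℝ) ^ ((j : ℝ) * δ) * (j : ℝ) ^ lam ≤
      zoneConst δ lam * ((2 : ℝ) ^ ((m : ℝ) * δ) * (m : ℝ) ^ lam) := by
  have h1 : ∀ j ∈ S, (2 : ℝ) ^ ((j : ℝ) * δ) * (j : ℝ) ^ lam ≤
      (2 : ℝ) ^ (-(((m - j : ℕ) : ℝ) * δ)) * (1 + (m - j : ℕ) : ℝ) ^ |lam| *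
        ((2 : ℝ) ^ ((m : ℝ) * δ) * (m : ℝ) ^ lam) := fun j hj => by
    obtain ⟨hj1, hjm⟩ := hS j hj
    have h2 := natCast_rpow_le hj1 (hj1.trans hjm) lam (i := m - j) (by omega) (by omega)
    have h3 : (2 : ℝ) ^ ((j : ℝ) * δ) =
        (2 : ℝ) ^ (-(((m - j : ℕ) : ℝ) * δ)) * (2 : ℝ) ^ ((m : ℝ) * δ) := by
      rw [← Real.rpow_add (by norm_num), Nat.cast_sub hjm]; congr 1; ring
    rw [h3]
    calc _ ≤ (2 : ℝ) ^ (-(((m - j : ℕ) : ℝ) * δ)) * (2 : ℝ) ^ ((m : ℝ) * δ) *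
          ((1 + (m - j : ℕ) : ℝ) ^ |lam| * (m : ℝ) ^ lam) := by gcongr
      _ = _ := by ring
  refine (Finset.sum_le_sum h1).trans ?_
  rw [← Finset.sum_mul]
  refine mul_le_mul_of_nonneg_right ?_ (by positivity)
  have h4 : Set.InjOn (fun j => m - j) (S : Set ℕ) := fun i hi j hj hij => by
    have := (hS i hi).2
    have := (hS j hj).2
    simp only at hij
    omega
  rw [← Finset.sum_image (f := fun i : ℕ => (2 : ℝ) ^ (-((i : ℝ) * δ)) * (1 + i : ℝ) ^ |lam|) h4]
  exact (summable_zoneConst hδ lam).sum_le_tsum _ fun _ _ => by positivity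

lemma sum_high_levels_le {δ : ℝ} (hδ : 0 < δ) (lam : ℝ) {m : ℕ} (hm : 1 ≤ m) {S : Finset ℕ}
    (hS : ∀ j ∈ S, m ≤ j) :
    ∑ j ∈ S, (2 : ℝ) ^ (-((j : ℝ) * δ)) * (j : ℝ) ^ lam ≤
      zoneConst δ lam * ((2 : ℝ) ^ (-((m : ℝ) * δ)) * (m : ℝ) ^ lam) := by
  have h1 : ∀ j ∈ S, (2 : ℝ) ^ (-((j : ℝ) * δ)) * (j : ℝ) ^ lam ≤
      (2 : ℝ) ^ (-(((j - m : ℕ) : ℝ) * δ)) * (1 + (j - m : ℕ) : ℝ) ^ |lam| *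
        ((2 : ℝ) ^ (-((m : ℝ) * δ)) * (m : ℝ) ^ lam) := fun j hj => by
    have hjm := hS j hj
    have h2 := natCast_rpow_le (hm.trans hjm) hm lam (i := j - m) (by omega) (by omega)
    have h3 : (2 : ℝ) ^ (-((j : ℝ) * δ)) =
        (2 : ℝ) ^ (-(((j - m : ℕ) : ℝ) * δ)) * (2 : ℝ) ^ (-((m : ℝ) * δ)) := by
      rw [← Real.rpow_add (by norm_num), Nat.cast_sub hjm]; congr 1; ring
    rw [h3]
    calc _ ≤ (2 : ℝ) ^ (-(((j - m : ℕ) : ℝ) * δ)) * (2 : ℝ) ^ (-((m : ℝ) * δ)) *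
          ((1 + (j - m : ℕ) : ℝ) ^ |lam| * (m : ℝ) ^ lam) := by gcongr
      _ = _ := by ring
  refine (Finset.sum_le_sum h1).trans ?_
  rw [← Finset.sum_mul]
  refine mul_le_mul_of_nonneg_right ?_ (by positivity)
  have h4 : Set.InjOn (fun j => j - m) (S : Set ℕ) := fun i hi j hj hij => by
    have := hS i hi
    have := hS j hj
    simp only at hij
    omega
  rw [← Finset.sum_image (f := fun i : ℕ => (2 : ℝ) ^ (-((i : ℝ) * δ)) * (1 + i : ℝ) ^ |lam|) h4]
  exact (summable_zoneConst hδ lam).sum_le_tsum _ fun _ _ => by positivity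

/-- The integer part of the binary logarithm. -/
lemma floor_logb_spec {y : ℝ} (hy : 1 ≤ y) :
    (2 : ℝ) ^ ⌊Real.logb 2 y⌋₊ ≤ y ∧ y < 2 * (2 : ℝ) ^ ⌊Real.logb 2 y⌋₊ := by
  have hy0 : 0 < y := by linarith
  have h0 : 0 ≤ Real.logb 2 y := Real.logb_nonneg (by norm_num) hy
  constructor
  · rw [← Real.rpow_natCast, ← Real.le_logb_iff_rpow_le (by norm_num) hy0]
    exact Nat.floor_le h0
  · rw [mul_comm, ← pow_succ, ← Real.rpow_natCast, ← Real.logb_lt_iff_lt_rpow (by norm_num) hy0]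
    push_cast
    exact Nat.lt_floor_add_one _

lemma floor_logb_comparable {y : ℝ} (hy : 4 ≤ y) :
    1 ≤ ⌊Real.logb 2 y⌋₊ ∧ (⌊Real.logb 2 y⌋₊ : ℝ) ≤ 2 * Real.log y ∧
      Real.log y ≤ 2 * (⌊Real.logb 2 y⌋₊ : ℝ) := by
  have hl2 := Real.log_two_gt_d9
  have hl2' := Real.log_two_lt_d9
  have h4 : Real.log 4 ≤ Real.log y := Real.log_le_log (by norm_num) hy
  have h5 : Real.log 4 = 2 * Real.log 2 := by
    rw [show (4 : ℝ) = 2 ^ 2 by norm_num, Real.log_pow]; norm_num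
  have h6 : Real.logb 2 y * Real.log 2 = Real.log y := by
    rw [Real.logb]; field_simp
  have h2 : 2 ≤ Real.logb 2 y := by
    by_contra h; push Not at h; nlinarith
  have h7 : Real.logb 2 y < ⌊Real.logb 2 y⌋₊ + 1 := Nat.lt_floor_add_one _
  have h8 : (⌊Real.logb 2 y⌋₊ : ℝ) ≤ Real.logb 2 y := Nat.floor_le (by linarith)
  refine ⟨?_, ?_, ?_⟩
  · rw [Nat.one_le_floor_iff]; linarith
  · nlinarith
  · nlinarith

/-- Two-zone estimate for a sum over levels, split at `2^j ≈ y`. -/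
lemma sum_two_zones_le {δ₁ δ₂ : ℝ} (hδ₁ : 0 < δ₁) (hδ₂ : 0 < δ₂) (γ₁ γ₂ : ℝ) {a b y : ℝ}
    (ha : 0 ≤ a) (hb : 0 ≤ b) (hy : 4 ≤ y) {S : Finset ℕ} (hS : ∀ j ∈ S, 1 ≤ j) {T : ℕ → ℝ}
    (h1 : ∀ j ∈ S, T j ≤ a * ((2 : ℝ) ^ ((j : ℝ) * δ₁) * (j : ℝ) ^ γ₁))
    (h2 : ∀ j ∈ S, T j ≤ b * ((2 : ℝ) ^ (-((j : ℝ) * δ₂)) * (j : ℝ) ^ γ₂)) :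
    ∑ j ∈ S, T j ≤ zoneConst δ₁ γ₁ * 2 ^ |γ₁| * (a * (y ^ δ₁ * Real.log y ^ γ₁)) +
      zoneConst δ₂ γ₂ * 2 ^ |γ₂| * 2 ^ δ₂ * (b * (y ^ (-δ₂) * Real.log y ^ γ₂)) := by
  set m := ⌊Real.logb 2 y⌋₊ with hm
  obtain ⟨hm1, hm2, hm3⟩ := floor_logb_comparable hy
  obtain ⟨hm4, hm5⟩ := floor_logb_spec (by linarith : 1 ≤ y)
  rw [← hm] at hm1 hm2 hm3 hm4 hm5
  have hm0 : (0 : ℝ) < m := by exact_mod_cast hm1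
  have hly : 0 < Real.log y := Real.log_pos (by linarith)
  have hy0 : 0 < y := by linarith
  have hz1 := zoneConst_nonneg δ₁ γ₁
  have hz2 := zoneConst_nonneg δ₂ γ₂
  have hg : ∀ γ : ℝ, (m : ℝ) ^ γ ≤ 2 ^ |γ| * Real.log y ^ γ := fun γ =>
    rpow_le_of_comparable hm0 hly hm2 hm3 γ
  have hp1 : (2 : ℝ) ^ ((m : ℝ) * δ₁) ≤ y ^ δ₁ := by
    rw [Real.rpow_mul (by norm_num), Real.rpow_natCast]
    exact Real.rpow_le_rpow (by positivity) hm4 hδ₁.le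
  have hp2 : (2 : ℝ) ^ (-((m : ℝ) * δ₂)) ≤ 2 ^ δ₂ * y ^ (-δ₂) := by
    rw [← mul_neg, Real.rpow_mul (by norm_num), Real.rpow_natCast]
    calc ((2 : ℝ) ^ m) ^ (-δ₂) ≤ (y / 2) ^ (-δ₂) :=
          Real.rpow_le_rpow_of_nonpos (by positivity) (by linarith) (by linarith)
      _ = _ := by
          rw [Real.div_rpow hy0.le (by norm_num), Real.rpow_neg (by norm_num : (0 : ℝ) ≤ 2)]
          field_simp
  rw [← Finset.sum_filter_add_sum_filter_not S (fun j => j ≤ m)]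
  gcongr ?_ + ?_
  · calc ∑ j ∈ S.filter (fun j => j ≤ m), T j
        ≤ ∑ j ∈ S.filter (fun j => j ≤ m), a * ((2 : ℝ) ^ ((j : ℝ) * δ₁) * (j : ℝ) ^ γ₁) :=
          Finset.sum_le_sum fun j hj => h1 j (Finset.mem_filter.mp hj).1
      _ ≤ a * (zoneConst δ₁ γ₁ * ((2 : ℝ) ^ ((m : ℝ) * δ₁) * (m : ℝ) ^ γ₁)) := by
          rw [← Finset.mul_sum]
          gcongr
          exact sum_low_levels_le hδ₁ γ₁ fun j hj =>
            ⟨hS j (Finset.mem_filter.mp hj).1, (Finset.mem_filter.mp hj).2⟩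
      _ ≤ a * (zoneConst δ₁ γ₁ * (y ^ δ₁ * (2 ^ |γ₁| * Real.log y ^ γ₁))) := by
          gcongr
          exact hg γ₁
      _ = _ := by ring
  · calc ∑ j ∈ S.filter (fun j => ¬ j ≤ m), T j
        ≤ ∑ j ∈ S.filter (fun j => ¬ j ≤ m), b * ((2 : ℝ) ^ (-((j : ℝ) * δ₂)) * (j : ℝ) ^ γ₂) :=
          Finset.sum_le_sum fun j hj => h2 j (Finset.mem_filter.mp hj).1
      _ ≤ b * (zoneConst δ₂ γ₂ * ((2 : ℝ) ^ (-((m : ℝ) * δ₂)) * (m : ℝ) ^ γ₂)) := by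
          rw [← Finset.mul_sum]
          gcongr
          exact sum_high_levels_le hδ₂ γ₂ hm1 fun j hj =>
            (not_le.mp (Finset.mem_filter.mp hj).2).le
      _ ≤ b * (zoneConst δ₂ γ₂ * (2 ^ δ₂ * y ^ (-δ₂) * (2 ^ |γ₂| * Real.log y ^ γ₂))) := by
          gcongr
          exact hg γ₂
      _ = _ := by ring

/-- The squared norms of the fine levels decay geometrically. -/
lemma tsum_tail_le {J : ℕ} {s B : ℝ} (hs : 0 < s) (hB : 0 ≤ B) {c : ℕ → ℝ}
    (hc : ∀ j, J ≤ j → c j ≤ B * (2 : ℝ) ^ (-(2 * j * s))) :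
    ∑' i, ENNReal.ofReal (c (J + i)) ≤
      ENNReal.ofReal (B * (1 - (2 : ℝ) ^ (-(2 * s)))⁻¹ * (2 : ℝ) ^ (-(2 * J * s))) := by
  have h1 : ∀ i, ENNReal.ofReal (c (J + i)) ≤
      ENNReal.ofReal (B * (2 : ℝ) ^ (-(2 * J * s)) * (2 : ℝ) ^ (-((i : ℝ) * (2 * s)))) := fun i => by
    refine ENNReal.ofReal_le_ofReal ((hc (J + i) (Nat.le_add_right J i)).trans (le_of_eq ?_))
    rw [mul_assoc B, ← Real.rpow_add (by norm_num)]
    congr 2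
    push_cast
    ring
  refine (ENNReal.tsum_le_tsum h1).trans ?_
  rw [ENNReal.tsum_eq_iSup_sum]
  refine iSup_le fun F => ?_
  rw [← ENNReal.ofReal_sum_of_nonneg fun _ _ => by positivity]
  refine ENNReal.ofReal_le_ofReal ?_
  rw [← Finset.mul_sum, mul_right_comm]
  gcongr
  exact geom_rpow_sum_le (by linarith) F

/-! ### Loss of a level -/

lemma sum_min_block_le_card (L j : ℕ) (b : ℕ → ℂ) {θ : ℝ} (hθ : 0 ≤ θ) :
    ∑ r ∈ blockIndices L j, min (∑ i ∈ block L j r, ‖b i‖ ^ 2) θ ≤ (2 ^ j / L + 1) * θ := by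
  calc _ ≤ ∑ r ∈ blockIndices L j, θ := Finset.sum_le_sum fun r _ => min_le_right _ _
    _ = (blockIndices L j).card * θ := by rw [Finset.sum_const, nsmul_eq_mul]
    _ ≤ _ := by gcongr; exact card_blockIndices_le L j

lemma sum_min_block_le_sq {L : ℕ} (hL : 0 < L) (j : ℕ) (b : ℕ → ℂ) (θ : ℝ) :
    ∑ r ∈ blockIndices L j, min (∑ i ∈ block L j r, ‖b i‖ ^ 2) θ ≤
      ∑ i ∈ Finset.range (2 ^ j), ‖b i‖ ^ 2 := by
  calc _ ≤ ∑ r ∈ blockIndices L j, ∑ i ∈ block L j r, ‖b i‖ ^ 2 :=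
        Finset.sum_le_sum fun r _ => min_le_left _ _
    _ = _ := sum_block hL j fun _ i => ‖b i‖ ^ 2

/-- Interpolation `min(B, θ) ≤ θ^{1-r/2} B^{r/2}` on each block, followed by the embedding of `ℓ^r`
in `ℓ²`. -/
lemma sum_min_block_le_rpow {L : ℕ} (hL : 0 < L) (j : ℕ) (b : ℕ → ℂ) {θ r : ℝ} (hθ : 0 ≤ θ)
    (hr : 1 ≤ r) (hr2 : r ≤ 2) :
    ∑ i ∈ blockIndices L j, min (∑ i' ∈ block L j i, ‖b i'‖ ^ 2) θ ≤
      θ ^ (1 - r / 2) * ∑ i ∈ Finset.range (2 ^ j), ‖b i‖ ^ r := by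
  rw [← sum_block hL j fun _ i => ‖b i‖ ^ r, Finset.mul_sum]
  refine Finset.sum_le_sum fun i _ => ?_
  set B := ∑ i' ∈ block L j i, ‖b i'‖ ^ 2 with hB
  have hB0 : 0 ≤ B := by positivity
  have h1 : B ^ (r / 2) ≤ ∑ i' ∈ block L j i, ‖b i'‖ ^ r := by
    have h2 := sum_sq_le_sum_rpow_rpow (block L j i) (a := fun i => ‖b i‖)
      (fun i => norm_nonneg _) hr hr2
    have h3 := Real.rpow_le_rpow hB0 h2 (by linarith : 0 ≤ r / 2)
    rwa [← Real.rpow_mul (by positivity), show 2 / r * (r / 2) = 1 by field_simp,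
      Real.rpow_one] at h3
  have hm0 : 0 ≤ min B θ := le_min hB0 hθ
  calc min B θ = min B θ ^ (1 - r / 2) * min B θ ^ (r / 2) := by
        rw [← Real.rpow_add_of_nonneg hm0 (by linarith) (by linarith)]
        simp
    _ ≤ θ ^ (1 - r / 2) * B ^ (r / 2) := by
        gcongr
        · linarith
        · exact min_le_right _ _
        · exact min_le_left _ _
    _ ≤ _ := by gcongr

/-! ### Growth of logarithms -/

lemma eventually_mul_log_rpow_le (C a : ℝ) {b : ℝ} (hb : 0 < b) :
    ∀ᶠ x : ℝ in atTop, C * Real.log x ^ a ≤ x ^ b := by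
  have h1 := (isLittleO_log_rpow_rpow_atTop a hb).def (c := (|C| + 1)⁻¹) (by positivity)
  filter_upwards [h1, eventually_ge_atTop 1] with x hx hx1
  have hl : 0 ≤ Real.log x := Real.log_nonneg hx1
  rw [Real.norm_of_nonneg (by positivity), Real.norm_of_nonneg (by positivity),
    ← div_eq_inv_mul, le_div_iff₀ (by positivity)] at hx
  have h2 : 0 ≤ Real.log x ^ a := by positivity
  nlinarith [le_abs_self C]

/-- For `t ≥ 2` one has `1/2 ≤ log t ≤ t`, so `log t` and `1` agree up to the factor `2t`. -/
lemma log_rpow_bounds {t : ℝ} (ht : 2 ≤ t) (lam : ℝ) :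
    ((2 * t) ^ |lam|)⁻¹ ≤ Real.log t ^ (-lam) ∧ Real.log t ^ (-lam) ≤ (2 * t) ^ |lam| := by
  have h1 : 1 / 2 ≤ Real.log t := by
    have := Real.log_le_log (by norm_num) ht
    linarith [Real.log_two_gt_d9]
  have h2 : Real.log t ≤ t := by linarith [Real.log_le_sub_one_of_pos (by linarith : 0 < t)]
  have h3 := rpow_le_of_comparable (u := 1) (v := Real.log t) (K := 2 * t) one_pos (by linarith)
    (by nlinarith) (by linarith) (-lam)
  have h4 := rpow_le_of_comparable (u := Real.log t) (v := 1) (K := 2 * t) (by linarith) one_pos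
    (by linarith) (by nlinarith) (-lam)
  rw [Real.one_rpow, abs_neg] at h3 h4
  rw [mul_one] at h4
  refine ⟨?_, h4⟩
  rwa [inv_le_iff_one_le_mul₀' (by positivity)]

lemma rpow_mul_log_rpow_ge {t : ℝ} (ht : 2 ≤ t) (ν lam : ℝ) :
    (2 ^ |lam| * t ^ (2 * |ν| + |lam|))⁻¹ ≤ t ^ (-2 * ν) * Real.log t ^ (-lam) := by
  have ht0 : 0 < t := by linarith
  have h1 : (t ^ (2 * |ν|))⁻¹ ≤ t ^ (-2 * ν) := by
    rw [← Real.rpow_neg ht0.le]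
    exact Real.rpow_le_rpow_of_exponent_le (by linarith) (by linarith [le_abs_self ν])
  calc (2 ^ |lam| * t ^ (2 * |ν| + |lam|))⁻¹ = (t ^ (2 * |ν|))⁻¹ * ((2 * t) ^ |lam|)⁻¹ := by
        rw [Real.rpow_add ht0, Real.mul_rpow (by norm_num) ht0.le]; field_simp
    _ ≤ _ := by
        gcongr
        exact (log_rpow_bounds ht lam).1

lemma rpow_mul_log_rpow_le {t : ℝ} (ht : 2 ≤ t) (ν lam : ℝ) :
    t ^ (-2 * ν) * Real.log t ^ (-lam) ≤ 2 ^ |lam| * t ^ (2 * |ν| + |lam|) := by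
  have ht0 : 0 < t := by linarith
  have hl : 0 ≤ Real.log t := Real.log_nonneg (by linarith)
  have h1 : t ^ (-2 * ν) ≤ t ^ (2 * |ν|) :=
    Real.rpow_le_rpow_of_exponent_le (by linarith) (by linarith [neg_abs_le ν])
  calc t ^ (-2 * ν) * Real.log t ^ (-lam) ≤ t ^ (2 * |ν|) * (2 * t) ^ |lam| := by
        gcongr
        exact (log_rpow_bounds ht lam).2
    _ = _ := by rw [Real.rpow_add ht0, Real.mul_rpow (by norm_num) ht0.le]; ring

/-! ### The super-smooth case -/

/-- The real number whose binary logarithm defines the level of the super-smooth estimator. -/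
def superScale (α₁ β x : ℝ) : ℝ := 3 / (8 * Real.pi) * (Real.log x / (2 * α₁)) ^ (1 / β)

lemma superScale_eq {α₁ β x : ℝ} (hα₁ : 0 < α₁) (hx : 1 ≤ x) :
    superScale α₁ β x =
      3 / (8 * Real.pi) * ((2 * α₁) ^ (1 / β))⁻¹ * Real.log x ^ (1 / β) := by
  rw [superScale, Real.div_rpow (Real.log_nonneg hx) (by positivity)]
  ring

lemma tendsto_superScale {α₁ β : ℝ} (hα₁ : 0 < α₁) (hβ : 0 < β) :
    Tendsto (superScale α₁ β) atTop atTop := by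
  unfold superScale
  refine Tendsto.const_mul_atTop (by positivity) ?_
  exact (tendsto_rpow_atTop (by positivity)).comp
    (Real.tendsto_log_atTop.atTop_div_const (by positivity))

lemma coarseLevel_spec {α₁ β x : ℝ} (hα₁ : 0 < α₁) (hx : 1 ≤ superScale α₁ β x) :
    (2 : ℝ) ^ coarseLevel α₁ β x ≤ superScale α₁ β x ∧
      superScale α₁ β x < 2 * (2 : ℝ) ^ coarseLevel α₁ β x := by
  rw [coarseLevel, if_neg hα₁.ne']
  exact floor_logb_spec hx

lemma eventually_superScale_rpow_le {α₁ β : ℝ} (hα₁ : 0 < α₁) (C a c : ℝ) {b : ℝ} (hb : 0 < b) :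
    ∀ᶠ x : ℝ in atTop, C * superScale α₁ β x ^ a * Real.log x ^ c ≤ x ^ b := by
  have h1 := eventually_mul_log_rpow_le
    (C * (3 / (8 * Real.pi) * ((2 * α₁) ^ (1 / β))⁻¹) ^ a) (1 / β * a + c) hb
  filter_upwards [h1, eventually_gt_atTop 1] with x hx hx1
  have hl : 0 < Real.log x := Real.log_pos hx1
  rw [superScale_eq hα₁ hx1.le, Real.mul_rpow (by positivity) (by positivity),
    ← Real.rpow_mul hl.le]
  rw [Real.rpow_add hl] at hx
  linarith

/-- The scale is chosen so that `α₁ t^β ≤ (ln x)/2` on the resolved band; the exponential therefore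
costs `x^{1/2}`, and the power and logarithmic factors at most `x^{1/4}`. -/
lemma eventually_super_lower {α₁ β : ℝ} (hα₁ : 0 < α₁) (hβ : 0 < β) (ν₁ lam₁ : ℝ) :
    ∀ᶠ x : ℝ in atTop, ∀ t : ℝ, 2 ≤ t → 3 * t ≤ 2 * superScale α₁ β x →
      x ^ (-(3 / 4 : ℝ)) ≤ t ^ (-2 * ν₁) * Real.log t ^ (-lam₁) * Real.exp (-α₁ * t ^ β) := by
  filter_upwards [eventually_superScale_rpow_le (β := β) hα₁ (2 ^ |lam₁|) (2 * |ν₁| + |lam₁|) 0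
    (by norm_num : (0 : ℝ) < 1 / 4), eventually_gt_atTop 1] with x hx hx1 t ht hty
  have ht0 : 0 < t := by linarith
  have hl : 0 < Real.log x := Real.log_pos hx1
  have hx0 : 0 < x := by linarith
  rw [Real.rpow_zero, mul_one] at hx
  have h1 : t ≤ superScale α₁ β x := by linarith
  have h2 : t ≤ (Real.log x / (2 * α₁)) ^ (1 / β) := by
    refine h1.trans ?_
    unfold superScale
    refine mul_le_of_le_one_left (by positivity) ?_
    rw [div_le_one (by positivity)]
    linarith [Real.pi_gt_three]
  have h3 : t ^ β ≤ Real.log x / (2 * α₁) := by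
    refine (Real.rpow_le_rpow ht0.le h2 hβ.le).trans (le_of_eq ?_)
    rw [← Real.rpow_mul (by positivity), one_div_mul_cancel hβ.ne', Real.rpow_one]
  have h4 : x ^ (-(1 / 2 : ℝ)) ≤ Real.exp (-α₁ * t ^ β) := by
    rw [Real.rpow_def_of_pos hx0, Real.exp_le_exp]
    have : α₁ * t ^ β ≤ α₁ * (Real.log x / (2 * α₁)) := by gcongr
    have h5 : α₁ * (Real.log x / (2 * α₁)) = Real.log x / 2 := by field_simp
    linarith
  have h5 : x ^ (-(1 / 4 : ℝ)) ≤ t ^ (-2 * ν₁) * Real.log t ^ (-lam₁) := by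
    refine le_trans ?_ (rpow_mul_log_rpow_ge ht ν₁ lam₁)
    rw [Real.rpow_neg hx0.le]
    gcongr
    refine le_trans ?_ hx
    gcongr
  calc x ^ (-(3 / 4 : ℝ)) = x ^ (-(1 / 4 : ℝ)) * x ^ (-(1 / 2 : ℝ)) := by
        rw [← Real.rpow_add hx0]; norm_num
    _ ≤ _ := mul_le_mul h5 h4 (by positivity) (le_trans (by positivity) h5)

/-- Halving the rate of the exponential absorbs the power and logarithmic factors, whatever their
signs. -/
lemma eventually_super_upper {α₂ β : ℝ} (hα₂ : 0 < α₂) (hβ : 0 < β) (ν₂ lam₂ : ℝ) :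
    ∀ᶠ t : ℝ in atTop, t ^ (-2 * ν₂) * Real.log t ^ (-lam₂) * Real.exp (-α₂ * t ^ β) ≤
      Real.exp (-(α₂ / 2 * t ^ β)) := by
  have h1 := ((isLittleO_rpow_exp_pos_mul_atTop ((2 * |ν₂| + |lam₂|) / β)
    (by positivity : 0 < α₂ / 2)).comp_tendsto (tendsto_rpow_atTop hβ)).def
    (c := (2 ^ |lam₂|)⁻¹) (by positivity)
  filter_upwards [h1, eventually_ge_atTop 2] with t ht ht2
  have ht0 : 0 < t := by linarith
  simp only [Function.comp] at ht
  rw [Real.norm_of_nonneg (by positivity), Real.norm_of_nonneg (by positivity),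
    ← Real.rpow_mul ht0.le, mul_div_cancel₀ _ hβ.ne', ← div_eq_inv_mul,
    le_div_iff₀ (by positivity)] at ht
  have h2 : Real.exp (-(α₂ / 2 * t ^ β)) =
      Real.exp (α₂ / 2 * t ^ β) * Real.exp (-α₂ * t ^ β) := by
    rw [← Real.exp_add]; congr 1; ring
  rw [h2]
  gcongr
  refine (rpow_mul_log_rpow_le ht2 ν₂ lam₂).trans ?_
  linarith

/-- The smoothness assumption enters through this inequality: it allows an aliasing exponent `κ`
strictly between `1/2` and `s*`. -/
lemma half_lt_sStar {s : ℝ} {p : ℝ≥0∞} (hs : ((min p 2)⁻¹).toReal < s) : 1 / 2 < sStar s p := by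
  rw [sStar]; linarith

/-! ### Risk over a Besov ball, and the super-smooth rate. -/

namespace Model

variable (D : Model.{v})

lemma tendsto_n : Tendsto D.n atTop atTop := by
  have h1 : Tendsto (fun k => ((D.N k * D.M k : ℕ) : ℝ)) atTop atTop :=
    tendsto_natCast_atTop_atTop.comp D.tendsto_size
  refine h1.congr fun k => ?_
  rw [n]
  push_cast
  rfl

lemma eventually_log_n_ge (R : ℝ) : ∀ᶠ k in atTop, R ≤ Real.log (D.n k) :=
  (Real.tendsto_log_atTop.comp D.tendsto_n).eventually_ge_atTop R

/-- Bound for the squared aliasing error per unit of `sup τ₁⁻¹`, if `τ₁ ≤ U` for the frequencies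
that are not resolved. -/
def aliasConst (κ σ A U : ℝ) (k : ℕ) : ℝ :=
  25 * residueConst κ * decayConst κ σ * A ^ 2 * (U * (D.N k : ℝ) ^ (-(2 * κ)))

/-- The risk over a Besov ball, in terms of bounds for `τ₁`. -/
lemma risk_besov_le {w : ℝ → ℝ} (hw : IsMeyerAuxiliary w) {f : ℝ → ℝ} {s A : ℝ} {p q : ℝ≥0∞}
    (hp : 1 ≤ p) (hq : 1 ≤ q) (hA : 0 < A) (hs : ((min p 2)⁻¹).toReal < s) {ℓ j₀ J : ℕ}
    (hℓ : ℓ ≤ j₀) (hJ : j₀ ≤ J) (hf : f ∈ besovBall w ℓ s p q A) {K₁ K₂ κ : ℝ} (hK₂ : 0 < K₂)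
    (hκ : 1 / 2 < κ) (hκs : κ < sStar s p) (hA1 : D.AssumptionA1 K₁ K₂) {k L : ℕ} (hL : 0 < L)
    {thr V : ℕ → ℝ} {V₀ U : ℝ} (hthr : ∀ j ∈ Finset.Ico j₀ J, 0 ≤ thr j) (hV₀ : 0 < V₀)
    (hV : ∀ j ∈ Finset.Ico j₀ J, 0 < V j) (hU0 : 0 ≤ U) (hN : 2 * 2 ^ j₀ ≤ D.N k)
    (hNJ : 2 ^ J ≤ D.N k)
    (hτ₀ : ∀ m : ℤ, 3 * |(m : ℝ)| < 2 * 2 ^ j₀ → 0 < D.tau k m ∧ (D.tau k m)⁻¹ ≤ V₀)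
    (hτ : ∀ j ∈ Finset.Ico j₀ J, ∀ m : ℤ, (2 : ℝ) ^ j < 3 * |(m : ℝ)| →
      3 * |(m : ℝ)| < 4 * 2 ^ j → 0 < D.tau k m ∧ (D.tau k m)⁻¹ ≤ V j)
    (hU : ∀ m' : ℤ, (D.N k : ℝ) ≤ 3 * |(m' : ℝ)| → D.tau k m' ≤ U)
    (hbias : ∀ j ∈ Finset.Ico j₀ J, D.aliasConst κ (sStar s p) A U k * V j ≤ thr j / 16)
    {T E : ℝ} (hT : ∑ j ∈ Finset.Ico j₀ J, ∑ r ∈ blockIndices L j,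
      min (∑ i ∈ block L j r, ‖innerCoef f (psi w j i)‖ ^ 2) (thr j) ≤ T)
    (hE : ∑ j ∈ Finset.Ico j₀ J, 432 * 2 ^ L * 2 ^ j * D.noiseLevel K₂ k (V j) *
      Real.exp (-(thr j / (128 * D.noiseLevel K₂ k (V j)))) ≤ E) :
    D.risk k (D.blockEstimator w j₀ J L thr k) f ≤
      ENNReal.ofReal (15 * (2 * (D.aliasConst κ (sStar s p) A U k * V₀) +
        32 * 2 ^ j₀ * D.noiseLevel K₂ k V₀ + (3 * T + E) +
        A ^ 2 * (1 - (2 : ℝ) ^ (-(2 * sStar s p)))⁻¹ * (2 : ℝ) ^ (-(2 * J * sStar s p)))) := by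
  have hs0 := half_lt_sStar hs
  have hn := D.n_pos k
  have hNr : (2 : ℝ) * 2 ^ j₀ ≤ D.N k := by exact_mod_cast hN
  have hNJr : (2 : ℝ) ^ J ≤ D.N k := by exact_mod_cast hNJ
  have hpow : ∀ j ∈ Finset.Ico j₀ J, (2 : ℝ) * 2 ^ j ≤ D.N k := fun j hj => by
    rw [← pow_succ']
    refine le_trans (pow_le_pow_right₀ (by norm_num) ?_) hNJr
    exact (Finset.mem_Ico.mp hj).2
  have hb : ∀ j, ℓ ≤ j → ∑ k ∈ Finset.range (2 ^ j), ‖innerCoef f (psi w j k)‖ ^ 2 ≤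
      A ^ 2 * (2 : ℝ) ^ (-(2 * j * sStar s p)) := fun j hj =>
    sum_sq_besov_le hp hq hA.le hf hj
  have halias : ∀ {h : ℝ → ℂ}, IsBandKernel h → ∀ {j : ℕ} {v : ℝ}, 0 < v →
      D.BandBound h k j v →
      ∑ i ∈ Finset.range (2 ^ j), ‖D.aliasCoef h k f j i‖ ^ 2 ≤
        D.aliasConst κ (sStar s p) A U k * v := by
    intro h hh j v hv hband
    refine (D.sum_sq_aliasCoef_le hh k f j).trans ?_
    -- On the band `1 ≤ v τ₁(m)`, so unresolved frequencies satisfy `τ₁(m') ≤ U ≤ U v τ₁(m)`, which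
    -- gives `ρ = U v`.
    have h1 := D.sum_sq_aliasBias_le hw hf.1 hκ hκs (fun j hj => hb j (hℓ.trans hj)) k hN
      (F := (modes j).filter fun m : ℤ => h (m / 2 ^ j) ≠ 0) (ρ := U * v)
      (fun m hm => (hband m (Finset.mem_filter.mp hm).2).1)
      (fun m hm => (hband m (Finset.mem_filter.mp hm).2).2.1) (by positivity)
      (fun m hm m' hm' => by
        obtain ⟨-, h2, h3⟩ := hband m (Finset.mem_filter.mp hm).2
        refine (hU m' hm').trans ?_
        rw [mul_assoc]
        refine le_mul_of_one_le_right hU0 ?_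
        calc (1 : ℝ) = (D.tau k m)⁻¹ * D.tau k m := (inv_mul_cancel₀ h2.ne').symm
          _ ≤ _ := by gcongr)
    refine (mul_le_mul_of_nonneg_left h1 (by norm_num)).trans (le_of_eq ?_)
    rw [aliasConst]
    ring
  have hband₀ : D.BandBound (meyerScalingHat w) k j₀ V₀ := fun m hm => by
    have h1 := meyerScalingHat_support hw hm
    exact ⟨by linarith [pow_pos (two_pos (α := ℝ)) j₀], hτ₀ m h1⟩
  have hband : ∀ j ∈ Finset.Ico j₀ J, D.BandBound (meyerWaveletHat w) k j (V j) :=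
    fun j hj m hm => by
      obtain ⟨h1, h2⟩ := meyerWaveletHat_support hw hm
      exact ⟨by linarith [hpow j hj], hτ j hj m h1 h2⟩
  have hH := isBandKernel_meyerScalingHat hw
  have hG := isBandKernel_meyerWaveletHat hw
  refine (D.risk_blockEstimator_le hw hf.1 hK₂ hA1 hJ hL hthr hV₀ hband₀ (halias hH hV₀ hband₀) hV
    hband fun j hj => (halias hG (hV j hj) (hband j hj)).trans (hbias j hj)).trans ?_
  have htail := tsum_tail_le (by linarith : 0 < sStar s p) (by positivity : 0 ≤ A ^ 2)
    fun j hj => hb j ((hℓ.trans hJ).trans hj)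
  have hgeo : (2 : ℝ) ^ (-(2 * sStar s p)) < 1 :=
    Real.rpow_lt_one_of_one_lt_of_neg (by norm_num) (by linarith)
  have hgeo' : 0 < (1 - (2 : ℝ) ^ (-(2 * sStar s p)))⁻¹ := inv_pos.mpr (by linarith)
  have hσ : ∀ v, 0 < v → 0 < D.noiseLevel K₂ k v := fun v hv => by unfold noiseLevel; positivity
  have hσ₀ := hσ V₀ hV₀
  have hQ : 0 ≤ D.aliasConst κ (sStar s p) A U k := by
    have := residueConst_pos hκ
    have := decayConst_pos hκs
    unfold aliasConst
    positivity
  have hmin : ∀ j ∈ Finset.Ico j₀ J, 0 ≤ 3 * ∑ r ∈ blockIndices L j,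
      min (∑ i ∈ block L j r, ‖innerCoef f (psi w j i)‖ ^ 2) (thr j) := fun j hj =>
    mul_nonneg (by norm_num) (Finset.sum_nonneg fun r _ => le_min (by positivity) (hthr j hj))
  have hexp : ∀ j ∈ Finset.Ico j₀ J, 0 ≤ 432 * 2 ^ L * 2 ^ j * D.noiseLevel K₂ k (V j) *
      Real.exp (-(thr j / (128 * D.noiseLevel K₂ k (V j)))) := fun j hj => by
    have := hσ (V j) (hV j hj)
    positivity
  have hmid : ∑ j ∈ Finset.Ico j₀ J, ENNReal.ofReal (3 * ∑ r ∈ blockIndices L j,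
        min (∑ i ∈ block L j r, ‖innerCoef f (psi w j i)‖ ^ 2) (thr j) +
      432 * 2 ^ L * 2 ^ j * D.noiseLevel K₂ k (V j) *
        Real.exp (-(thr j / (128 * D.noiseLevel K₂ k (V j))))) ≤ ENNReal.ofReal (3 * T + E) := by
    rw [← ENNReal.ofReal_sum_of_nonneg fun j hj => add_nonneg (hmin j hj) (hexp j hj),
      Finset.sum_add_distrib, ← Finset.mul_sum]
    exact ENNReal.ofReal_le_ofReal (by linarith)
  have hTE : 0 ≤ 3 * T + E := by
    have h1 := Finset.sum_nonneg hmin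
    have h2 := Finset.sum_nonneg hexp
    rw [← Finset.mul_sum] at h1
    linarith
  refine (mul_le_mul_right (add_le_add le_rfl (add_le_add hmid htail)) _).trans (le_of_eq ?_)
  rw [← ENNReal.ofReal_add (by positivity) (by positivity),
    ← ENNReal.ofReal_add (by positivity) (by positivity), ← ENNReal.ofReal_ofNat 15,
    ← ENNReal.ofReal_mul (by norm_num)]
  congr 1
  ring

/-- Relative to `τ₁ ≥ K₃ ε x^{-3/4}` on the resolved band, aliasing has size `x⁻¹ x^{3/4}` and the
variance `2^{j₀} x^{-1/4}`. Both are negligible against the tail `2^{-2 j₀ s*}`, which is of order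
`(ln x)^{-2s*/β}`. -/
lemma superSmooth_risk_le {w : ℝ → ℝ} (hw : IsMeyerAuxiliary w) {K₁ K₂ K₃ K₄ β : ℝ}
    (hK₂ : 0 < K₂) (hK₃ : 0 < K₃) (hK₄ : 0 < K₄) (hβ : 0 < β)
    {ν₁ ν₂ lam₁ lam₂ α₁ α₂ : ℝ} (hα₁ : 0 < α₁) (hα₂ : 0 < α₂) {ε : ℕ → ℝ}
    (hA1 : D.AssumptionA1 K₁ K₂) (hA2 : D.AssumptionA2 ε K₃ K₄ ν₁ ν₂ lam₁ lam₂ α₁ α₂ β)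
    (hx : Tendsto (D.nStar ε) atTop atTop)
    (hN : Tendsto (fun k => (2 : ℝ) ^ coarseLevel α₁ β (D.nStar ε k) / (D.N k : ℝ)) atTop (𝓝 0))
    (μ : ℝ) {s A : ℝ} {p q : ℝ≥0∞} (hp : 1 ≤ p) (hq : 1 ≤ q) (hA : 0 < A)
    (hs : ((min p 2)⁻¹).toReal < s) :
    ∃ C : ℝ, 0 < C ∧ ∀ᶠ k in atTop, ∀ ℓ ≤ coarseLevel α₁ β (D.nStar ε k),
      ⨆ f ∈ besovBall w ℓ s p q A, D.risk k (D.estimator w ε μ ν₁ lam₁ α₁ β k) f ≤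
        ENNReal.ofReal (C * superRate β s p (D.nStar ε k)) := by
  obtain ⟨hε, hA2m, hA2s⟩ := hA2
  have hs0 := half_lt_sStar hs
  set σ := sStar s p with hσdef
  obtain ⟨κ, hκ, hκs⟩ := exists_between hs0
  have hR := residueConst_pos hκ
  have hDc := decayConst_pos hκs
  have hgeo : (2 : ℝ) ^ (-(2 * σ)) < 1 :=
    Real.rpow_lt_one_of_one_lt_of_neg (by norm_num) (by linarith)
  have hgeo' : 0 < (1 - (2 : ℝ) ^ (-(2 * σ)))⁻¹ := inv_pos.mpr (by linarith)
  set c₁ : ℝ := 3 / (8 * Real.pi) * ((2 * α₁) ^ (1 / β))⁻¹ / 2 with hc₁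
  have hc₁0 : 0 < c₁ := by positivity
  set Ca : ℝ := 50 * residueConst κ * decayConst κ σ * A ^ 2 * (K₄ / K₃) with hCa
  set Cb : ℝ := 32 * (25 * K₂ / K₃) with hCb
  set Cc : ℝ := A ^ 2 * (1 - (2 : ℝ) ^ (-(2 * σ)))⁻¹ * c₁ ^ (-(2 * σ)) with hCc
  refine ⟨15 * ((Ca + Cb) + Cc), by positivity, ?_⟩
  have hratio : ∀ R : ℝ, 0 < R → ∀ᶠ k in atTop,
      R * (2 : ℝ) ^ coarseLevel α₁ β (D.nStar ε k) ≤ D.N k := fun R hR => by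
    filter_upwards [hN.eventually_le_const (by positivity : (0 : ℝ) < R⁻¹)] with k hk
    have hN0 : (0 : ℝ) < D.N k := by exact_mod_cast D.N_pos k
    rw [div_le_iff₀ hN0] at hk
    calc R * (2 : ℝ) ^ coarseLevel α₁ β (D.nStar ε k) ≤ R * (R⁻¹ * D.N k) := by gcongr
      _ = D.N k := by field_simp
  obtain ⟨T₀, hT₀⟩ := eventually_atTop.mp (eventually_super_upper hα₂ hβ ν₂ lam₂)
  -- Chosen so that `N ≥ R₁ 2^{j₀}` forces `(α₂/2)|m'|^β ≥ ln x` at the unresolved frequencies `|m'|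
  -- ≥ N/3`, hence `τ₁(m') ≤ K₄ ε x⁻¹`.
  set R₁ : ℝ := 16 * Real.pi * (4 * α₁ / α₂) ^ (1 / β) with hR₁
  filter_upwards [hx.eventually (eventually_super_lower hα₁ hβ ν₁ lam₁),
    hx.eventually ((tendsto_superScale hα₁ hβ).eventually_ge_atTop 1),
    hx.eventually_gt_atTop 1,
    hx.eventually (eventually_superScale_rpow_le (β := β) hα₁ 1 1 (2 * σ / β)
      (by norm_num : (0 : ℝ) < 1 / 4)),
    hratio 2 (by norm_num), hratio (3 * (|T₀| + 2)) (by positivity),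
    hratio R₁ (by positivity), D.eventually_log_n_ge 1] with k hlow hy hx1 hpoly hN2 hNT hNR hL ℓ hℓ
  refine iSup₂_le fun f hf => ?_
  set x := D.nStar ε k with hxdef
  set j₀ := coarseLevel α₁ β x with hj₀
  set y := superScale α₁ β x with hydef
  obtain ⟨hy1, hy2⟩ := coarseLevel_spec hα₁ hy
  rw [← hj₀, ← hydef] at hy1 hy2
  have hεk := hε k
  have hn := D.n_pos k
  have hx0 : 0 < x := by linarith
  have hlx : 0 < Real.log x := Real.log_pos hx1
  have hj1 : (1 : ℝ) ≤ 2 ^ j₀ := one_le_pow₀ (by norm_num)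
  have hN0 : (1 : ℝ) ≤ D.N k := by linarith
  have hxpow : x ^ (-(3 / 4 : ℝ)) ≤ 1 := Real.rpow_le_one_of_one_le_of_nonpos hx1.le (by norm_num)
  have hτ : ∀ m : ℤ, 3 * |(m : ℝ)| < 2 * 2 ^ j₀ →
      K₃ * ε k * x ^ (-(3 / 4 : ℝ)) ≤ D.tau k m := fun m hm => by
    rcases lt_or_ge |m| 2 with h2 | h2
    · refine le_trans ?_ (hA2s k m (by omega))
      exact mul_le_of_le_one_right (by positivity) hxpow
    · have h3 : (2 : ℝ) ≤ |(m : ℝ)| := by exact_mod_cast h2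
      refine le_trans ?_ (hA2m k m h2).1
      have h4 := hlow _ h3 (by linarith)
      rw [mul_assoc (K₃ * ε k), mul_assoc (K₃ * ε k)]
      gcongr
  have hτ' : ∀ m' : ℤ, (D.N k : ℝ) ≤ 3 * |(m' : ℝ)| → D.tau k m' ≤ K₄ * ε k * x⁻¹ := by
    intro m' hm'
    have h3 : |T₀| + 2 ≤ |(m' : ℝ)| := by nlinarith [abs_nonneg T₀]
    have h4 : (2 : ℝ) ≤ |(m' : ℝ)| := by linarith [abs_nonneg T₀]
    refine (hA2m k m' (by exact_mod_cast h4)).2.trans ?_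
    rw [mul_assoc (K₄ * ε k), mul_assoc (K₄ * ε k)]
    gcongr
    refine (hT₀ _ (by linarith [le_abs_self T₀])).trans ?_
    rw [← Real.exp_log hx0, ← Real.exp_neg, Real.exp_le_exp, neg_le_neg_iff]
    have h5 : R₁ * (y / 6) ≤ |(m' : ℝ)| := by
      have : R₁ * (y / 2) ≤ R₁ * 2 ^ j₀ := by
        have : 0 < R₁ := by positivity
        gcongr
        linarith
      linarith
    have h6 : R₁ * (y / 6) = (4 * α₁ / α₂ * (Real.log x / (2 * α₁))) ^ (1 / β) := by
      rw [Real.mul_rpow (by positivity) (by positivity), hR₁, hydef, superScale]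
      have := Real.pi_pos.ne'
      field_simp
      ring
    rw [h6] at h5
    have h7 := Real.rpow_le_rpow (by positivity) h5 hβ.le
    rw [← Real.rpow_mul (by positivity), one_div_mul_cancel hβ.ne', Real.rpow_one] at h7
    calc Real.log x = α₂ / 2 * (4 * α₁ / α₂ * (Real.log x / (2 * α₁))) := by field_simp; ring
      _ ≤ _ := by gcongr
  have hτ0 : 0 < K₃ * ε k * x ^ (-(3 / 4 : ℝ)) := by positivity
  have hfloor : 0 < ⌊Real.log (D.n k)⌋₊ := Nat.floor_pos.mpr hL
  -- Here `J = j₀`: the range of wavelet levels is empty, and the data attached to it (`V`, `T`,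
  -- `E`) are placeholders.
  have hmain := D.risk_besov_le hw hp hq hA hs hℓ le_rfl hf hK₂ hκ hκs hA1 hfloor
    (thr := threshold μ ν₁ lam₁ x) (k := k) (V₀ := (K₃ * ε k * x ^ (-(3 / 4 : ℝ)))⁻¹)
    (V := fun _ => 1) (U := K₄ * ε k * x⁻¹) (T := 0) (E := 0) (by simp) (by positivity) (by simp)
    (by positivity) (by exact_mod_cast hN2)
    (by
      have : (2 : ℝ) ^ j₀ ≤ D.N k := by linarith
      exact_mod_cast this)
    (fun m hm => ⟨hτ0.trans_le (hτ m hm), inv_anti₀ hτ0 (hτ m hm)⟩) (by simp) hτ' (by simp)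
    (by simp) (by simp)
  have hest : D.estimator w ε μ ν₁ lam₁ α₁ β k =
      D.blockEstimator w j₀ j₀ ⌊Real.log (D.n k)⌋₊ (threshold μ ν₁ lam₁ x) k := by
    funext yy
    rw [estimator, fineLevel, if_neg hα₁.ne']
  rw [hest]
  refine hmain.trans (ENNReal.ofReal_le_ofReal ?_)
  rw [mul_assoc 15]
  refine mul_le_mul_of_nonneg_left ?_ (by norm_num)
  rw [superRate, ← hσdef, add_mul, add_mul]
  have hrate : 0 ≤ Real.log x ^ (-(2 * σ / β)) := by positivity
  have hyr : y * x ^ (-(1 / 4 : ℝ)) ≤ Real.log x ^ (-(2 * σ / β)) := by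
    rw [one_mul, Real.rpow_one] at hpoly
    rw [Real.rpow_neg hx0.le, Real.rpow_neg hlx.le, ← div_eq_mul_inv, div_le_iff₀ (by positivity),
      ← div_eq_inv_mul, le_div_iff₀ (by positivity)]
    exact hpoly
  have hxr : x ^ (-(1 / 4 : ℝ)) ≤ Real.log x ^ (-(2 * σ / β)) :=
    (le_mul_of_one_le_left (by positivity) hy).trans hyr
  rw [mul_zero, add_zero, add_zero]
  gcongr ?_ + ?_ + ?_
  · have h1 : K₄ * ε k * x⁻¹ * (K₃ * ε k * x ^ (-(3 / 4 : ℝ)))⁻¹ =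
        K₄ / K₃ * x ^ (-(1 / 4 : ℝ)) := by
      have h2 : x ^ (-(1 / 4 : ℝ)) = x⁻¹ * (x ^ (-(3 / 4 : ℝ)))⁻¹ := by
        rw [← Real.rpow_neg_one, ← Real.rpow_neg hx0.le, ← Real.rpow_add hx0]; norm_num
      rw [h2]
      field_simp
    calc 2 * (D.aliasConst κ σ A (K₄ * ε k * x⁻¹) k * (K₃ * ε k * x ^ (-(3 / 4 : ℝ)))⁻¹)
        = 50 * residueConst κ * decayConst κ σ * A ^ 2 * (K₄ / K₃ * x ^ (-(1 / 4 : ℝ))) *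
          (D.N k : ℝ) ^ (-(2 * κ)) := by
          rw [← h1, aliasConst]; ring
      _ ≤ 50 * residueConst κ * decayConst κ σ * A ^ 2 * (K₄ / K₃ * x ^ (-(1 / 4 : ℝ))) * 1 := by
          gcongr
          exact Real.rpow_le_one_of_one_le_of_nonpos hN0 (by linarith)
      _ = Ca * x ^ (-(1 / 4 : ℝ)) := by rw [hCa]; ring
      _ ≤ _ := by gcongr
  · calc 32 * 2 ^ j₀ * D.noiseLevel K₂ k (K₃ * ε k * x ^ (-(3 / 4 : ℝ)))⁻¹
        = Cb * (2 ^ j₀ * x ^ (-(1 / 4 : ℝ))) := by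
          have h1 : x ^ (-(1 / 4 : ℝ)) = x⁻¹ * (x ^ (-(3 / 4 : ℝ)))⁻¹ := by
            rw [← Real.rpow_neg_one, ← Real.rpow_neg hx0.le, ← Real.rpow_add hx0]; norm_num
          rw [h1, hxdef, nStar, noiseLevel, hCb]
          field_simp
      _ ≤ Cb * (y * x ^ (-(1 / 4 : ℝ))) := by gcongr
      _ ≤ _ := by gcongr
  · rw [hCc, mul_assoc (A ^ 2 * _)]
    gcongr
    have h1 : c₁ * Real.log x ^ (1 / β) ≤ 2 ^ j₀ := by
      have h2 := superScale_eq (β := β) hα₁ hx1.le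
      rw [← hydef] at h2
      have h3 : c₁ * Real.log x ^ (1 / β) = y / 2 := by rw [h2, hc₁]; ring
      linarith
    calc (2 : ℝ) ^ (-(2 * j₀ * σ)) = ((2 : ℝ) ^ j₀) ^ (-(2 * σ)) := by
          rw [← Real.rpow_natCast, ← Real.rpow_mul (by norm_num)]; congr 1; ring
      _ ≤ (c₁ * Real.log x ^ (1 / β)) ^ (-(2 * σ)) :=
          Real.rpow_le_rpow_of_nonpos (by positivity) h1 (by linarith)
      _ = _ := by
          rw [Real.mul_rpow hc₁0.le (by positivity), ← Real.rpow_mul hlx.le]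
          congr 2
          ring

end Model

/-! ### Splitting sums over levels at the optimal resolution -/

/-- The monomial `x^α (log x)^γ`. -/
def logMono (α γ x : ℝ) : ℝ := x ^ α * Real.log x ^ γ

lemma logMono_pos {x : ℝ} (hx : 1 < x) (α γ : ℝ) : 0 < logMono α γ x := by
  have := Real.log_pos hx
  unfold logMono
  positivity

lemma logMono_mul {x : ℝ} (hx : 1 < x) (α γ α' γ' : ℝ) :
    logMono α γ x * logMono α' γ' x = logMono (α + α') (γ + γ') x := by
  unfold logMono
  rw [Real.rpow_add (by linarith), Real.rpow_add (Real.log_pos hx)]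
  ring

lemma logMono_rpow {x : ℝ} (hx : 1 < x) (α γ δ : ℝ) :
    logMono α γ x ^ δ = logMono (α * δ) (γ * δ) x := by
  have := Real.log_pos hx
  unfold logMono
  rw [Real.mul_rpow (by positivity) (by positivity), ← Real.rpow_mul (by linarith),
    ← Real.rpow_mul this.le]

lemma eventually_logMono_le {α α' : ℝ} (h : α < α') (γ γ' C : ℝ) :
    ∀ᶠ x in atTop, C * logMono α γ x ≤ logMono α' γ' x := by
  filter_upwards [eventually_mul_log_rpow_le C (γ - γ') (sub_pos.mpr h), eventually_gt_atTop 1]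
    with x hx hx1
  have h1 : logMono α γ x = Real.log x ^ (γ - γ') * logMono α γ' x := by
    have h2 : Real.log x ^ (γ - γ') = logMono 0 (γ - γ') x := by simp [logMono]
    rw [h2, logMono_mul hx1]
    congr 1 <;> ring
  have h3 : logMono α' γ' x = x ^ (α' - α) * logMono α γ' x := by
    have h2 : x ^ (α' - α) = logMono (α' - α) 0 x := by simp [logMono]
    rw [h2, logMono_mul hx1]
    congr 1 <;> ring
  rw [h1, h3, ← mul_assoc]
  exact mul_le_mul_of_nonneg_right hx (logMono_pos hx1 _ _).le

/-- The logarithm of `(x (log x)^c)^{1/D}` is `(log x + c log log x)/D`, and the second term is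
eventually at most half of the first. -/
lemma eventually_log_logMono {D : ℝ} (hD : 0 < D) (c : ℝ) :
    ∀ᶠ x in atTop, 4 ≤ logMono (1 / D) (c / D) x ∧
      ∀ γ : ℝ, Real.log (logMono (1 / D) (c / D) x) ^ γ ≤
        (2 * D + 2 / D) ^ |γ| * Real.log x ^ γ := by
  have h1 := (Real.isLittleO_log_id_atTop.comp_tendsto Real.tendsto_log_atTop).def
    (c := (2 * (|c| + 1))⁻¹) (by positivity)
  filter_upwards [h1, eventually_gt_atTop 1,
    Real.tendsto_log_atTop.eventually_ge_atTop (2 * D * Real.log 4)] with x hx hx1 hx4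
  have hl : 0 < Real.log x := Real.log_pos hx1
  simp only [Function.comp, id, Real.norm_eq_abs] at hx
  rw [abs_of_pos hl, ← div_eq_inv_mul, le_div_iff₀ (by positivity)] at hx
  have h2 : |c * Real.log (Real.log x)| ≤ Real.log x / 2 := by
    rw [abs_mul]
    nlinarith [abs_nonneg c, abs_nonneg (Real.log (Real.log x))]
  obtain ⟨h3, h4⟩ := abs_le.mp h2
  have h5 : Real.log (logMono (1 / D) (c / D) x) =
      (Real.log x + c * Real.log (Real.log x)) / D := by
    unfold logMono
    rw [Real.log_mul (by positivity) (by positivity), Real.log_rpow (by linarith),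
      Real.log_rpow hl]
    ring
  have hlo : Real.log x / (2 * D) ≤ Real.log (logMono (1 / D) (c / D) x) := by
    rw [h5, div_le_div_iff₀ (by positivity) hD]
    nlinarith
  have hhi : Real.log (logMono (1 / D) (c / D) x) ≤ 2 / D * Real.log x := by
    rw [h5, div_le_iff₀ hD]
    have : 2 / D * Real.log x * D = 2 * Real.log x := by field_simp
    linarith
  have hpos : 0 < Real.log (logMono (1 / D) (c / D) x) := lt_of_lt_of_le (by positivity) hlo
  refine ⟨?_, fun γ => ?_⟩
  · rw [← Real.log_le_log_iff (by norm_num) (logMono_pos hx1 _ _)]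
    refine le_trans ?_ hlo
    rw [le_div_iff₀ (by positivity)]
    linarith
  · refine rpow_le_of_comparable hpos hl ?_ ?_ γ
    · have : 0 < 2 * D * Real.log x := by positivity
      nlinarith
    · rw [div_le_iff₀ (by positivity)] at hlo
      have : 0 < 2 / D * Real.log (logMono (1 / D) (c / D) x) := by positivity
      nlinarith

/-- Two-zone estimate, split at `2^j ≈ (x (log x)^c)^{1/D}`, in terms of monomials. -/
lemma exists_sum_levels_le {δ₁ δ₂ D : ℝ} (hδ₁ : 0 < δ₁) (hδ₂ : 0 < δ₂) (hD : 0 < D)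
    {γ₁ γ₂ c α₁ g₁ α₂ g₂ e g C₁ C₂ : ℝ} (hC₁ : 0 ≤ C₁) (hC₂ : 0 ≤ C₂)
    (he₁ : α₁ + δ₁ / D = e) (hg₁ : g₁ + c * δ₁ / D + γ₁ = g)
    (he₂ : α₂ - δ₂ / D = e) (hg₂ : g₂ - c * δ₂ / D + γ₂ = g) :
    ∃ C : ℝ, 0 ≤ C ∧ ∀ᶠ x in atTop, ∀ (S : Finset ℕ) (T : ℕ → ℝ), (∀ j ∈ S, 1 ≤ j) →
      (∀ j ∈ S, T j ≤ C₁ * logMono α₁ g₁ x * ((2 : ℝ) ^ ((j : ℝ) * δ₁) * (j : ℝ) ^ γ₁)) →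
      (∀ j ∈ S, T j ≤ C₂ * logMono α₂ g₂ x * ((2 : ℝ) ^ (-((j : ℝ) * δ₂)) * (j : ℝ) ^ γ₂)) →
      ∑ j ∈ S, T j ≤ C * logMono e g x := by
  have hz1 := zoneConst_nonneg δ₁ γ₁
  have hz2 := zoneConst_nonneg δ₂ γ₂
  refine ⟨zoneConst δ₁ γ₁ * 2 ^ |γ₁| * (C₁ * (2 * D + 2 / D) ^ |γ₁|) +
    zoneConst δ₂ γ₂ * 2 ^ |γ₂| * 2 ^ δ₂ * (C₂ * (2 * D + 2 / D) ^ |γ₂|), by positivity, ?_⟩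
  filter_upwards [eventually_log_logMono hD c, eventually_gt_atTop 1] with x hx hx1 S T hS h1 h2
  obtain ⟨hy, hγ⟩ := hx
  have hm := fun α γ => (logMono_pos hx1 α γ).le
  refine (sum_two_zones_le hδ₁ hδ₂ γ₁ γ₂ (mul_nonneg hC₁ (hm α₁ g₁)) (mul_nonneg hC₂ (hm α₂ g₂))
    hy hS h1 h2).trans ?_
  have hlog : ∀ γ : ℝ, Real.log x ^ γ = logMono 0 γ x := fun γ => by simp [logMono]
  rw [add_mul, logMono_rpow hx1, logMono_rpow hx1]
  gcongr ?_ + ?_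
  · calc _ ≤ zoneConst δ₁ γ₁ * 2 ^ |γ₁| * (C₁ * logMono α₁ g₁ x *
          (logMono (1 / D * δ₁) (c / D * δ₁) x * ((2 * D + 2 / D) ^ |γ₁| * logMono 0 γ₁ x))) := by
          rw [← hlog]
          have := hm α₁ g₁
          have := hm (1 / D * δ₁) (c / D * δ₁)
          gcongr
          exact hγ γ₁
      _ = zoneConst δ₁ γ₁ * 2 ^ |γ₁| * (C₁ * (2 * D + 2 / D) ^ |γ₁|) *
          (logMono α₁ g₁ x * logMono (1 / D * δ₁) (c / D * δ₁) x * logMono 0 γ₁ x) := by ring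
      _ = _ := by
          rw [logMono_mul hx1, logMono_mul hx1, ← he₁, ← hg₁]
          congr 2 <;> ring
  · calc _ ≤ zoneConst δ₂ γ₂ * 2 ^ |γ₂| * 2 ^ δ₂ * (C₂ * logMono α₂ g₂ x *
          (logMono (1 / D * -δ₂) (c / D * -δ₂) x *
            ((2 * D + 2 / D) ^ |γ₂| * logMono 0 γ₂ x))) := by
          rw [← hlog]
          have := hm α₂ g₂
          have := hm (1 / D * -δ₂) (c / D * -δ₂)
          gcongr
          exact hγ γ₂
      _ = zoneConst δ₂ γ₂ * 2 ^ |γ₂| * 2 ^ δ₂ * (C₂ * (2 * D + 2 / D) ^ |γ₂|) *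
          (logMono α₂ g₂ x * logMono (1 / D * -δ₂) (c / D * -δ₂) x * logMono 0 γ₂ x) := by ring
      _ = _ := by
          rw [logMono_mul hx1, logMono_mul hx1, ← he₂, ← hg₂]
          congr 2 <;> ring

/-- Dense zone: the noise dominates up to the optimal level, the coefficients above it. -/
lemma exists_sum_dense_le {ν s r lam : ℝ} (hν : 0 < ν) (hr : 1 ≤ r)
    (hs : 0 < s) (hd : 0 < r * (s + 1 / 2 - 1 / r) - ν * (2 - r)) {C₁ C₂ : ℝ} (hC₁ : 0 ≤ C₁)
    (hC₂ : 0 ≤ C₂) :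
    ∃ C : ℝ, 0 ≤ C ∧ ∀ᶠ x in atTop, ∀ (S : Finset ℕ) (T : ℕ → ℝ), (∀ j ∈ S, 1 ≤ j) →
      (∀ j ∈ S, T j ≤ C₁ * logMono (-1) 0 x *
        ((2 : ℝ) ^ ((j : ℝ) * (2 * ν + 1)) * (j : ℝ) ^ lam)) →
      (∀ j ∈ S, T j ≤ C₂ * logMono (-(1 - r / 2)) (1 - r / 2) x *
        ((2 : ℝ) ^ (-((j : ℝ) * (r * (s + 1 / 2 - 1 / r) - ν * (2 - r)))) *
          (j : ℝ) ^ (lam * (1 - r / 2)))) →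
      ∑ j ∈ S, T j ≤ C * logMono (-(2 * s / (2 * s + 2 * ν + 1)))
        ((2 * ν + 1) * (2 / r - 1) / (2 * s + 2 * ν + 1) +
          2 * s * lam / (2 * s + 2 * ν + 1)) x := by
  have hD : 0 < 2 * s + 2 * ν + 1 := by linarith
  have hr0 : r ≠ 0 := by linarith
  -- The two bounds coincide at `2^j = y` with `y^{2s+2ν+1} = x (log x)^{2/r - 1 - lam}`; this fixes
  -- `c` and `D`.
  refine exists_sum_levels_le (c := 2 / r - 1 - lam) (by linarith) hd hD hC₁ hC₂ ?_ ?_ ?_ ?_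
  · field_simp; ring
  · field_simp; ring
  · field_simp; ring
  · field_simp; ring

/-- Sparse zone. -/
lemma exists_sum_sparse_le {ν σ r lam : ℝ} (hν : 0 < ν) (hσ : 0 < σ)
    (hd : 0 < ν * (2 - r) - r * σ) {C₁ C₂ : ℝ} (hC₁ : 0 ≤ C₁) (hC₂ : 0 ≤ C₂) :
    ∃ C : ℝ, 0 ≤ C ∧ ∀ᶠ x in atTop, ∀ (S : Finset ℕ) (T : ℕ → ℝ), (∀ j ∈ S, 1 ≤ j) →
      (∀ j ∈ S, T j ≤ C₁ * logMono (-(1 - r / 2)) (1 - r / 2) x *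
        ((2 : ℝ) ^ ((j : ℝ) * (ν * (2 - r) - r * σ)) * (j : ℝ) ^ (lam * (1 - r / 2)))) →
      (∀ j ∈ S, T j ≤ C₂ * logMono 0 0 x *
        ((2 : ℝ) ^ (-((j : ℝ) * (2 * σ))) * (j : ℝ) ^ (0 : ℝ))) →
      ∑ j ∈ S, T j ≤ C * logMono (-(2 * σ / (2 * σ + 2 * ν)))
        (2 * σ / (2 * σ + 2 * ν) + 2 * σ * lam / (2 * σ + 2 * ν)) x := by
  have hD : 0 < 2 * σ + 2 * ν := by linarith
  -- The thresholded and the `ℓ²` bound coincide at `y^{2σ+2ν} = x (log x)^{-(1 + lam)}`.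
  refine exists_sum_levels_le (c := -(1 + lam)) hd (by linarith) hD hC₁ hC₂ ?_ ?_ ?_ ?_
  · field_simp; ring
  · field_simp; ring
  · field_simp; ring
  · field_simp; ring

/-- Boundary between the dense and sparse zones: all levels of order `log x` contribute. -/
lemma exists_sum_critical_le {ν e lam θ A Λ : ℝ} (hν : 0 < ν) (he : e < 1)
    (hθ : 0 ≤ θ) (hA : 0 ≤ A) (hΛ : 0 ≤ Λ) {C₁ C₂ : ℝ} (hC₁ : 0 ≤ C₁) (hC₂ : 0 ≤ C₂) :
    ∃ C : ℝ, 0 ≤ C ∧ ∀ᶠ x in atTop, ∀ (S : Finset ℕ) (T c : ℕ → ℝ),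
      (∀ j ∈ S, 1 ≤ j ∧ (j : ℝ) ≤ Λ * Real.log x) → (∀ j ∈ S, 0 ≤ c j) →
      (∀ S' ⊆ S, ∑ j ∈ S', c j ≤ A * (S'.card : ℝ) ^ θ) →
      (∀ j ∈ S, T j ≤ C₁ * logMono (-1) 0 x *
        ((2 : ℝ) ^ ((j : ℝ) * (2 * ν + 1)) * (j : ℝ) ^ lam)) →
      (∀ j ∈ S, T j ≤ C₂ * logMono (-e) e x * ((j : ℝ) ^ (lam * e) * c j)) →
      ∑ j ∈ S, T j ≤ C * logMono (-e) (e + θ + lam * e) x := by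
  -- With the cut at `2^j ≈ x^{1/D}` the noise bound of the lower levels is `x^{-1+(1-e)/2}` up to
  -- logarithms, a power smaller than `x^{-e}`.
  set D : ℝ := 2 * (2 * ν + 1) / (1 - e) with hDdef
  have hD : 0 < D := div_pos (by linarith) (by linarith)
  have hz := zoneConst_nonneg (2 * ν + 1) lam
  set K : ℝ := 2 * (2 * D + 2 / D) with hK
  have hK0 : 0 < K := by positivity
  refine ⟨1 + C₂ * (K + Λ) ^ |lam * e| * A * Λ ^ θ, by positivity, ?_⟩
  have hlt : -1 + (2 * ν + 1) / D < -e := by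
    rw [hDdef]
    have : (2 * ν + 1) / (2 * (2 * ν + 1) / (1 - e)) = (1 - e) / 2 := by
      field_simp
    rw [this]; linarith
  filter_upwards [eventually_log_logMono hD 0, eventually_gt_atTop 1,
    eventually_logMono_le hlt lam (e + θ + lam * e)
      (C₁ * zoneConst (2 * ν + 1) lam * K ^ |lam|)] with x hx hx1 hsmall S T c hS hc hsum h1 h2
  obtain ⟨hy, hγ⟩ := hx
  have hl : 0 < Real.log x := Real.log_pos hx1
  set y := logMono (1 / D) (0 / D) x with hydef
  set m := ⌊Real.logb 2 y⌋₊ with hm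
  obtain ⟨hm1, hm2, hm3⟩ := floor_logb_comparable hy
  obtain ⟨hm4, hm5⟩ := floor_logb_spec (by linarith : 1 ≤ y)
  rw [← hm] at hm1 hm2 hm3 hm4 hm5
  have hm0 : (0 : ℝ) < m := by exact_mod_cast hm1
  have hly : 0 < Real.log y := Real.log_pos (by linarith)
  have hy1 : Real.log y ≤ (2 * D + 2 / D) * Real.log x := by
    have := hγ 1
    simpa using this
  have hy2 : Real.log x ≤ (2 * D + 2 / D) * Real.log y := by
    have := hγ (-1)
    rw [abs_neg, abs_one, Real.rpow_one, Real.rpow_neg_one, Real.rpow_neg_one,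
      ← div_eq_mul_inv, ← one_div, div_le_div_iff₀ hly hl, one_mul] at this
    exact this
  have hm6 : (m : ℝ) ≤ K * Real.log x := by rw [hK]; nlinarith
  have hm7 : Real.log x ≤ K * m := by
    rw [hK]
    have : 0 < 2 * D + 2 / D := by positivity
    nlinarith
  have hmono : 0 ≤ logMono (-1) 0 x := (logMono_pos hx1 _ _).le
  have hmono' : 0 ≤ logMono (-e) e x := (logMono_pos hx1 _ _).le
  rw [← Finset.sum_filter_add_sum_filter_not S (fun j => j ≤ m), add_mul]
  gcongr ?_ + ?_
  · rw [one_mul]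
    refine le_trans ?_ hsmall
    calc ∑ j ∈ S.filter (fun j => j ≤ m), T j
        ≤ ∑ j ∈ S.filter (fun j => j ≤ m), C₁ * logMono (-1) 0 x *
            ((2 : ℝ) ^ ((j : ℝ) * (2 * ν + 1)) * (j : ℝ) ^ lam) :=
          Finset.sum_le_sum fun j hj => h1 j (Finset.mem_filter.mp hj).1
      _ ≤ C₁ * logMono (-1) 0 x * (zoneConst (2 * ν + 1) lam *
            ((2 : ℝ) ^ ((m : ℝ) * (2 * ν + 1)) * (m : ℝ) ^ lam)) := by
          rw [← Finset.mul_sum]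
          gcongr
          exact sum_low_levels_le (by linarith) lam fun j hj =>
            ⟨(hS j (Finset.mem_filter.mp hj).1).1, (Finset.mem_filter.mp hj).2⟩
      _ ≤ C₁ * logMono (-1) 0 x * (zoneConst (2 * ν + 1) lam *
            (logMono ((2 * ν + 1) / D) 0 x * (K ^ |lam| * logMono 0 lam x))) := by
          have h3 : (2 : ℝ) ^ ((m : ℝ) * (2 * ν + 1)) ≤ logMono ((2 * ν + 1) / D) 0 x := by
            have h4 : logMono ((2 * ν + 1) / D) 0 x = y ^ (2 * ν + 1) := by
              rw [hydef, logMono_rpow hx1]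
              congr 1 <;> ring
            rw [h4, Real.rpow_mul (by norm_num), Real.rpow_natCast]
            exact Real.rpow_le_rpow (by positivity) hm4 (by linarith)
          have h5 : (m : ℝ) ^ lam ≤ K ^ |lam| * logMono 0 lam x := by
            simp only [logMono, Real.rpow_zero, one_mul]
            exact rpow_le_of_comparable hm0 hl hm6 hm7 lam
          have h6 : 0 ≤ logMono ((2 * ν + 1) / D) 0 x := (logMono_pos hx1 _ _).le
          gcongr
      _ = C₁ * zoneConst (2 * ν + 1) lam * K ^ |lam| *
            (logMono (-1) 0 x * logMono ((2 * ν + 1) / D) 0 x * logMono 0 lam x) := by ring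
      _ = _ := by
          rw [logMono_mul hx1, logMono_mul hx1]
          congr 2 <;> ring
  -- Above the cut `j` is comparable to `log x`, so `j^{lam e}` can be pulled out, and at most `Λ
  -- log x` levels remain, giving `(log x)^θ`.
  · set S' := S.filter (fun j => ¬ j ≤ m) with hS'
    have hsub : S' ⊆ S := Finset.filter_subset _ _
    have hcard : (S'.card : ℝ) ≤ Λ * Real.log x := by
      have h3 : S' ⊆ Finset.Icc 1 ⌊Λ * Real.log x⌋₊ := fun j hj => by
        rw [Finset.mem_Icc]
        exact ⟨(hS j (hsub hj)).1, Nat.le_floor (hS j (hsub hj)).2⟩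
      have h4 := Finset.card_le_card h3
      rw [Nat.card_Icc, Nat.add_sub_cancel] at h4
      exact (Nat.cast_le.mpr h4).trans (Nat.floor_le (by positivity))
    calc ∑ j ∈ S', T j
        ≤ ∑ j ∈ S', C₂ * logMono (-e) e x *
            ((K + Λ) ^ |lam * e| * Real.log x ^ (lam * e)) * c j := by
          refine Finset.sum_le_sum fun j hj => (h2 j (hsub hj)).trans ?_
          rw [mul_assoc (C₂ * _)]
          have h3 := hc j (hsub hj)
          gcongr
          have hj1 : (1 : ℝ) ≤ j := by exact_mod_cast (hS j (hsub hj)).1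
          have hj2 : (m : ℝ) ≤ j := by exact_mod_cast (not_le.mp (Finset.mem_filter.mp hj).2).le
          have hj3 := (hS j (hsub hj)).2
          refine rpow_le_of_comparable (by linarith) hl ?_ ?_ _
          · nlinarith
          · nlinarith
      _ ≤ C₂ * logMono (-e) e x * ((K + Λ) ^ |lam * e| * Real.log x ^ (lam * e)) *
            (A * (Λ * Real.log x) ^ θ) := by
          rw [← Finset.mul_sum]
          gcongr
          exact (hsum S' hsub).trans (by gcongr)
      _ = C₂ * (K + Λ) ^ |lam * e| * A * Λ ^ θ *
            (logMono (-e) e x * logMono 0 (lam * e) x * logMono 0 θ x) := by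
          rw [Real.mul_rpow hΛ hl.le]
          simp only [logMono, Real.rpow_zero, one_mul]
          ring
      _ = _ := by
          rw [logMono_mul hx1, logMono_mul hx1]
          congr 2 <;> ring

/-! ### Rates in the regular-smooth case -/

lemma threshold_rpow {μ ν lam x : ℝ} (hx : 1 < x) (j : ℕ) (a : ℝ) :
    threshold μ ν lam x j ^ a = (μ ^ 2) ^ a * logMono (-a) a x *
      ((2 : ℝ) ^ ((j : ℝ) * (2 * ν * a)) * (j : ℝ) ^ (lam * a)) := by
  have hl := Real.log_pos hx
  have hx0 : 0 < x := by linarith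
  rw [threshold, Real.mul_rpow (by positivity) (by positivity),
    Real.mul_rpow (by positivity) (by positivity), Real.mul_rpow (by positivity) hl.le,
    Real.mul_rpow (by positivity) (by positivity), ← Real.rpow_mul (by norm_num),
    ← Real.rpow_mul (Nat.cast_nonneg j), logMono, Real.rpow_neg hx0.le, Real.inv_rpow hx0.le,
    show 2 * ν * (j : ℝ) * a = (j : ℝ) * (2 * ν * a) by ring]
  ring

lemma minExp_of_le {p : ℝ≥0∞} (h : p ≤ 2) : minExp p = p.toReal := by
  rw [minExp, min_eq_left h]

lemma minExp_of_ge {p : ℝ≥0∞} (h : 2 ≤ p) : minExp p = 2 := by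
  rw [minExp, min_eq_right h]; simp

lemma toReal_inv_le_half {p : ℝ≥0∞} (h : 2 ≤ p) : 2 * (p⁻¹).toReal - 1 ≤ 0 := by
  have h1 := ENNReal.toReal_mono (by norm_num : (2 : ℝ≥0∞)⁻¹ ≠ ∞) (ENNReal.inv_le_inv.mpr h)
  rw [ENNReal.toReal_inv 2] at h1
  norm_num at h1
  rw [ENNReal.toReal_inv]
  linarith

/-- Connects the exponent `p' = min(p, 2)`, which governs the level bounds, with the positive part
`(2 - p)₊ / p` in the stated rate. -/
lemma two_div_minExp {p : ℝ≥0∞} (hp : 1 ≤ p) :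
    2 / minExp p - 1 = max 0 (2 * (p⁻¹).toReal - 1) := by
  obtain ⟨h1, h2⟩ := minExp_mem hp
  rcases le_total p 2 with h | h
  · rw [minExp_of_le h] at h1 h2 ⊢
    rw [ENNReal.toReal_inv, max_eq_right]
    · ring
    · rw [sub_nonneg, ← div_eq_mul_inv, le_div_iff₀ (by linarith)]
      linarith
  · rw [minExp_of_ge h, max_eq_left (toReal_inv_le_half h)]
    norm_num

/-- Admissible families of level losses: `T j` is bounded by the noise level, by the thresholded
`ℓ^{p'}` norm and by the `ℓ²` norm of the coefficients of level `j`. -/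
structure IsLevelLoss (w : ℝ → ℝ) (ν lam μ x : ℝ) (p : ℝ≥0∞) (f : ℝ → ℝ) (S : Finset ℕ)
    (T : ℕ → ℝ) : Prop where
  one_le : ∀ j ∈ S, 1 ≤ j
  le_log : ∀ j ∈ S, (j : ℝ) ≤ 2 * Real.log x
  le_noise : ∀ j ∈ S, T j ≤ 6 * μ ^ 2 * logMono (-1) 0 x *
    ((2 : ℝ) ^ ((j : ℝ) * (2 * ν + 1)) * (j : ℝ) ^ lam)
  le_rpow : ∀ j ∈ S, T j ≤ threshold μ ν lam x j ^ (1 - minExp p / 2) *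
    ∑ k ∈ Finset.range (2 ^ j), ‖innerCoef f (psi w j k)‖ ^ minExp p
  le_sq : ∀ j ∈ S, T j ≤ ∑ k ∈ Finset.range (2 ^ j), ‖innerCoef f (psi w j k)‖ ^ 2

/-- Over a Besov ball the exponent of `2^j` becomes `ν(2 - p') - p' s*`, and its sign separates the
dense from the sparse zone. -/
lemma IsLevelLoss.le_rpow' {w : ℝ → ℝ} {ν lam μ x : ℝ} {p q : ℝ≥0∞} {f : ℝ → ℝ} {S : Finset ℕ}
    {T : ℕ → ℝ} (h : IsLevelLoss w ν lam μ x p f S T) (hx : 1 < x) (hp : 1 ≤ p) (hq : 1 ≤ q)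
    {A s : ℝ} (hA : 0 ≤ A) {ℓ : ℕ} (hf : f ∈ besovBall w ℓ s p q A) (hℓ : ∀ j ∈ S, ℓ ≤ j) (j : ℕ)
    (hj : j ∈ S) :
    T j ≤ (μ ^ 2) ^ (1 - minExp p / 2) * A ^ minExp p *
      logMono (-(1 - minExp p / 2)) (1 - minExp p / 2) x *
      ((2 : ℝ) ^ ((j : ℝ) * (ν * (2 - minExp p) - minExp p * sStar s p)) *
        (j : ℝ) ^ (lam * (1 - minExp p / 2))) := by
  have hm := (logMono_pos hx (-(1 - minExp p / 2)) (1 - minExp p / 2)).le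
  refine (h.le_rpow j hj).trans ?_
  rw [threshold_rpow hx]
  have h1 := sum_rpow_minExp_le hp hq hA hf (hℓ j hj)
  refine (mul_le_mul_of_nonneg_left h1 (by positivity)).trans (le_of_eq ?_)
  have h2 : (2 : ℝ) ^ ((j : ℝ) * (ν * (2 - minExp p) - minExp p * sStar s p)) =
      (2 : ℝ) ^ ((j : ℝ) * (2 * ν * (1 - minExp p / 2))) *
        (2 : ℝ) ^ (-((j : ℝ) * sStar s p * minExp p)) := by
    rw [← Real.rpow_add (by norm_num)]; congr 1; ring
  rw [h2]
  ring

/-- The exponents `e`, `g` of the rate `x^{-e} (log n)^g`, and the bound for the sum over levels. -/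
lemma exists_rate_bound (w : ℝ → ℝ) {ν : ℝ} (hν : 0 < ν) (lam : ℝ) {s A : ℝ} {p q : ℝ≥0∞}
    (hp : 1 ≤ p) (hq : 1 ≤ q) (hA : 0 < A) (hs : ((min p 2)⁻¹).toReal < s) (μ : ℝ) :
    ∃ e g C : ℝ, 0 ≤ C ∧ e < 1 ∧ e < 2 * sStar s p / (2 * ν + 1) ∧
      (∀ n x : ℝ, 1 < n → 0 < x →
        regularRate ν lam s p q n x = x ^ (-e) * Real.log n ^ g) ∧
      ∀ᶠ x in atTop, ∀ (S : Finset ℕ) (T : ℕ → ℝ) (ℓ : ℕ), (∀ j ∈ S, ℓ ≤ j) →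
        ∀ f ∈ besovBall w ℓ s p q A, IsLevelLoss w ν lam μ x p f S T →
          ∑ j ∈ S, T j ≤ C * logMono (-e) g x := by
  obtain ⟨hr1, hr2⟩ := minExp_mem hp
  set r := minExp p with hr
  have hr0 : 0 < r := by linarith
  have hσ := half_lt_sStar hs
  have hσeq := sStar_eq s p
  rw [← hr] at hσeq
  set σ := sStar s p with hσdef
  have hμ2 : 0 ≤ μ ^ 2 := sq_nonneg μ
  have hmax := two_div_minExp hp
  rw [← hr] at hmax
  by_cases hd : ν * (2 * (p⁻¹).toReal - 1) < σ
  · have hd' : ν * (2 / r - 1) < σ := by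
      rw [hmax]
      rcases le_total 0 (2 * (p⁻¹).toReal - 1) with h | h
      · rwa [max_eq_right h]
      · rw [max_eq_left h]; linarith
    have hδ : 0 < r * (s + 1 / 2 - 1 / r) - ν * (2 - r) := by
      rw [← hσeq]
      have h1 : r * (ν * (2 / r - 1)) = ν * (2 - r) := by field_simp
      nlinarith
    have hinv : 1 / 2 ≤ 1 / r ∧ 1 / r ≤ 1 := by
      constructor
      · rw [div_le_div_iff₀ (by norm_num) hr0]; linarith
      · rw [div_le_one hr0]; exact hr1
    have hs0 : 0 < s := by linarith [hinv.1]
    have hD : 0 < 2 * s + 2 * ν + 1 := by linarith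
    obtain ⟨C, hC, hev⟩ := exists_sum_dense_le (lam := lam) hν hr1 hs0 hδ
      (C₁ := 6 * μ ^ 2) (C₂ := (μ ^ 2) ^ (1 - r / 2) * A ^ r) (by positivity) (by positivity)
    refine ⟨2 * s / (2 * s + 2 * ν + 1), (2 * ν + 1) * (2 / r - 1) / (2 * s + 2 * ν + 1) +
      2 * s * lam / (2 * s + 2 * ν + 1), C, hC, ?_, ?_, ?_, ?_⟩
    · rw [div_lt_one hD]; linarith
    -- With `δ = 1/r - 1/2` and `s = σ + δ` the claim is `δ(2ν + 1) < 2σ² + 2σδ`. It follows from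
    -- `2νδ < σ`, the dense-zone condition, and `σ > 1/2`.
    · rw [div_lt_div_iff₀ hD (by linarith)]
      have h1 : ν * (2 / r) = 2 * ν * (1 / r) := by ring
      have h2 : 2 * ν * (1 / r - 1 / 2) < σ := by linarith
      have h3 : s = σ + (1 / r - 1 / 2) := by linarith
      have h4 : 0 ≤ 1 / r - 1 / 2 := by linarith [hinv.1]
      nlinarith
    · intro n x _ _
      rw [regularRate, if_pos hd, rho, if_pos hd, hmax]
    · filter_upwards [hev, eventually_gt_atTop 1] with x hx hx1 S T ℓ hℓ f hf hT
      refine hx S T hT.one_le hT.le_noise fun j hj => ?_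
      refine (hT.le_rpow' hx1 hp hq hA.le hf hℓ j hj).trans (le_of_eq ?_)
      rw [← hσdef, hσeq, ← hr]
      congr 3
      ring
  · push Not at hd
    have hp2 : p ≤ 2 := by
      by_contra h
      have h1 := toReal_inv_le_half (not_le.mp h).le
      nlinarith
    have hrp : r = p.toReal := minExp_of_le hp2
    have hp' : p ≠ ∞ := (lt_of_le_of_lt hp2 (by norm_num)).ne
    have hinv : (p⁻¹).toReal = 1 / r := by rw [ENNReal.toReal_inv, hrp, one_div]
    have hD : 0 < 2 * σ + 2 * ν := by linarith
    have he1 : 2 * σ / (2 * σ + 2 * ν) < 1 := by rw [div_lt_one hD]; linarith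
    -- This is again `σ > 1/2`, as `2ν + 1 < 2σ + 2ν`.
    have he2 : 2 * σ / (2 * σ + 2 * ν) < 2 * σ / (2 * ν + 1) := by
      refine div_lt_div_of_pos_left (by linarith) (by linarith) (by linarith)
    have hrate : ∀ n x : ℝ, 1 < n → 0 < x → regularRate ν lam s p q n x =
        x ^ (-(2 * σ / (2 * σ + 2 * ν))) * Real.log n ^
          (2 * σ / (2 * σ + 2 * ν) + rho ν s p q + 2 * σ * lam / (2 * σ + 2 * ν)) := by
      intro n x hn hx
      have hl := Real.log_pos hn
      rw [regularRate, if_neg (not_lt.mpr hd), ← hσdef, Real.div_rpow hl.le hx.le,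
        add_assoc, Real.rpow_add hl (2 * σ / (2 * σ + 2 * ν)), Real.rpow_neg hx.le]
      ring
    rcases hd.lt_or_eq with hlt | heq
    · have hδ : 0 < ν * (2 - r) - r * σ := by
        rw [hinv] at hlt
        have h1 : r * (ν * (2 * (1 / r) - 1)) = ν * (2 - r) := by field_simp
        nlinarith
      obtain ⟨C, hC, hev⟩ := exists_sum_sparse_le (lam := lam) hν (by linarith : 0 < σ) hδ
        (C₁ := (μ ^ 2) ^ (1 - r / 2) * A ^ r) (C₂ := A ^ 2) (by positivity) (by positivity)
      refine ⟨_, _, C, hC, he1, he2, hrate, ?_⟩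
      have hrho : rho ν s p q = 0 := by
        rw [rho, if_neg (not_lt.mpr hd), if_neg hlt.ne']
      rw [hrho, add_zero]
      filter_upwards [hev, eventually_gt_atTop 1] with x hx hx1 S T ℓ hℓ f hf hT
      refine hx S T hT.one_le (hT.le_rpow' hx1 hp hq hA.le hf hℓ) fun j hj => ?_
      refine (hT.le_sq j hj).trans ((sum_sq_besov_le hp hq hA.le hf (hℓ j hj)).trans (le_of_eq ?_))
      rw [← hσdef]
      simp only [logMono, Real.rpow_zero, mul_one]
      congr 2
      ring
    -- On the boundary the thresholded bound does not depend on `2^j`: what is left of level `j` is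
    -- the `p`-th power of its Besov level norm, and the sum of these over levels brings in `q`.
    · have hνr : ν * (2 - r) = r * σ := by
        rw [hinv] at heq
        rw [heq]
        field_simp
      have he : 2 * σ / (2 * σ + 2 * ν) = 1 - r / 2 := by
        rw [div_eq_iff hD.ne']
        nlinarith
      obtain ⟨C, hC, hev⟩ := exists_sum_critical_le (lam := lam) (e := 1 - r / 2)
        (θ := max 0 (1 - p.toReal * (q⁻¹).toReal)) (A := A ^ p.toReal) (Λ := 2) hν
        (by rw [← he]; exact he1) (le_max_left _ _) (by positivity) (by norm_num)
        (C₁ := 6 * μ ^ 2) (C₂ := (μ ^ 2) ^ (1 - r / 2)) (by positivity) (by positivity)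
      refine ⟨_, _, C, hC, he1, he2, hrate, ?_⟩
      have hrho : rho ν s p q = max 0 (1 - p.toReal * (q⁻¹).toReal) := by
        rw [rho, if_neg (not_lt.mpr hd), if_pos heq.symm]
      have hlam : 2 * σ * lam / (2 * σ + 2 * ν) = lam * (1 - r / 2) := by rw [← he]; ring
      rw [hrho, he, hlam]
      filter_upwards [hev, eventually_gt_atTop 1] with x hx hx1 S T ℓ hℓ f hf hT
      refine hx S T (fun j => levelNorm w s p f j ^ p.toReal)
        (fun j hj => ⟨hT.one_le j hj, hT.le_log j hj⟩)
        (fun j _ => Real.rpow_nonneg (levelNorm_nonneg w s p f j) _)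
        (fun S' hS' => sum_levelNorm_rpow_le hp hp' hq hA.le hf fun j hj => hℓ j (hS' hj))
        hT.le_noise fun j hj => ?_
      refine (hT.le_rpow j hj).trans (le_of_eq ?_)
      have hsP : sPrime s p = σ := by rw [hσdef, sStar, sPrime, min_eq_left hp2]
      rw [threshold_rpow hx1, levelNorm_rpow w s hp hp', hsP, ← hr, ← hrp]
      have h2 : (j : ℝ) * (2 * ν * (1 - r / 2)) = (j : ℝ) * σ * r := by
        have : 2 * ν * (1 - r / 2) = r * σ := by linarith
        rw [this]; ring
      rw [h2]
      ring

/-! ### The regular-smooth case -/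

namespace Model

variable (D : Model.{v})

/-- Relations between the sample size `n`, the effective sample size `n*` and the levels of the
estimator that hold for large samples. -/
structure RegularScale (ε : ℕ → ℝ) (ν β h₁ : ℝ) (k : ℕ) : Prop where
  log_ge : 16 ≤ Real.log (D.nStar ε k)
  one_lt : 1 < D.nStar ε k
  log_le : Real.log (D.nStar ε k) ≤ 2 * Real.log (D.n k)
  le_log : (1 - h₁) * Real.log (D.n k) ≤ Real.log (D.nStar ε k)
  coarse_le : (2 : ℝ) ^ coarseLevel 0 β (D.nStar ε k) ≤ Real.log (D.nStar ε k)
  lt_coarse : Real.log (D.nStar ε k) < 2 * (2 : ℝ) ^ coarseLevel 0 β (D.nStar ε k)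
  fine_le : (2 : ℝ) ^ fineLevel ν 0 β (D.nStar ε k) ≤ D.nStar ε k ^ (1 / (2 * ν + 1))
  lt_fine : D.nStar ε k ^ (1 / (2 * ν + 1)) < 2 * (2 : ℝ) ^ fineLevel ν 0 β (D.nStar ε k)
  fine_le_N : 2 ^ fineLevel ν 0 β (D.nStar ε k) ≤ D.N k
  coarse_le_N : 2 * 2 ^ coarseLevel 0 β (D.nStar ε k) ≤ D.N k
  coarse_le_fine : coarseLevel 0 β (D.nStar ε k) ≤ fineLevel ν 0 β (D.nStar ε k)
  one_le_fine : 1 ≤ fineLevel ν 0 β (D.nStar ε k)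
  fine_le_log : (fineLevel ν 0 β (D.nStar ε k) : ℝ) ≤ 2 * Real.log (D.nStar ε k)
  log_le_fine : Real.log (D.nStar ε k) ≤
    2 * (2 * ν + 1) * (fineLevel ν 0 β (D.nStar ε k) : ℝ)

lemma tendsto_nStar {ε : ℕ → ℝ} (hε : ∀ k, 0 < ε k) {h₁ : ℝ} (hh₁ : h₁ < 1)
    (h : ∀ᶠ k in atTop, -h₁ * Real.log (D.n k) ≤ Real.log (ε k)) :
    Tendsto (D.nStar ε) atTop atTop := by
  have h1 : Tendsto (fun k => (1 - h₁) * Real.log (D.n k)) atTop atTop :=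
    Tendsto.const_mul_atTop (by linarith) (Real.tendsto_log_atTop.comp D.tendsto_n)
  have h2 : Tendsto (fun k => Real.log (D.nStar ε k)) atTop atTop := by
    refine tendsto_atTop_mono' _ ?_ h1
    filter_upwards [h] with k hk
    rw [nStar, Real.log_mul (D.n_pos k).ne' (hε k).ne']
    linarith
  refine (Real.tendsto_exp_atTop.comp h2).congr fun k => ?_
  exact Real.exp_log (mul_pos (D.n_pos k) (hε k))

lemma eventually_regularScale {ε : ℕ → ℝ} (hε : ∀ k, 0 < ε k) {ν h₁ h₂ : ℝ} (β : ℝ) (hν : 0 < ν)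
    (hh₁ : h₁ < 1) (hh₂ : h₂ < 1)
    (h : ∀ᶠ k in atTop, -h₁ * Real.log (D.n k) ≤ Real.log (ε k) ∧
      Real.log (ε k) ≤ h₂ * Real.log (D.n k))
    (hJ : ∀ᶠ k in atTop, 2 ^ fineLevel ν 0 β (D.nStar ε k) ≤ D.N k) :
    ∀ᶠ k in atTop, D.RegularScale ε ν β h₁ k := by
  have hx := D.tendsto_nStar hε hh₁ (h.mono fun k hk => hk.1)
  have hD : 0 < 2 * ν + 1 := by linarith
  filter_upwards [h, hJ, D.eventually_log_n_ge 1, hx.eventually_gt_atTop 1,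
    (Real.tendsto_log_atTop.comp hx).eventually_ge_atTop 16,
    hx.eventually (eventually_mul_log_rpow_le 4 1 (by positivity : 0 < 1 / (2 * ν + 1))),
    hx.eventually ((tendsto_rpow_atTop (by positivity : 0 < 1 / (2 * ν + 1))).eventually_ge_atTop 4)]
    with k hk hJk hn hx1 hl h4 hy
  simp only [Function.comp] at hl
  set x := D.nStar ε k with hxdef
  rw [Real.rpow_one] at h4
  have hx0 : 0 < x := by linarith
  have hlog : Real.log x = Real.log (D.n k) + Real.log (ε k) :=
    Real.log_mul (D.n_pos k).ne' (hε k).ne'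
  have hc : coarseLevel 0 β x = ⌊Real.logb 2 (Real.log x)⌋₊ := by rw [coarseLevel, if_pos rfl]
  have hf : fineLevel ν 0 β x = ⌊Real.logb 2 (x ^ (1 / (2 * ν + 1)))⌋₊ := by
    rw [fineLevel, if_pos rfl]
  obtain ⟨c1, c2⟩ := floor_logb_spec (by linarith : 1 ≤ Real.log x)
  obtain ⟨f1, f2⟩ := floor_logb_spec (by linarith : 1 ≤ x ^ (1 / (2 * ν + 1)))
  obtain ⟨f3, f4, f5⟩ := floor_logb_comparable hy
  rw [← hc] at c1 c2
  rw [← hf] at f1 f2 f3 f4 f5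
  have hly : Real.log (x ^ (1 / (2 * ν + 1))) * (2 * ν + 1) = Real.log x := by
    rw [Real.log_rpow hx0]; field_simp
  have hly0 : 0 < Real.log (x ^ (1 / (2 * ν + 1))) := Real.log_pos (by linarith)
  refine ⟨hl, hx1, ?_, ?_, c1, c2, f1, f2, hJk, ?_, ?_, f3, ?_, ?_⟩
  · nlinarith [hk.2]
  · nlinarith [hk.1]
  · have h5 : (2 : ℝ) ^ fineLevel ν 0 β x ≤ D.N k := by exact_mod_cast hJk
    have h6 : (2 : ℝ) * 2 ^ coarseLevel 0 β x ≤ D.N k := by linarith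
    exact_mod_cast h6
  · rw [hc, hf]
    refine Nat.floor_mono (Real.logb_le_logb_of_le (by norm_num) (by linarith) (by linarith))
  · nlinarith
  · nlinarith

/-- The bound for `τ₁⁻¹` on the band of wavelet level `j`. -/
def bandVariance (K₃ ν lam : ℝ) (e : ℝ) (j : ℕ) : ℝ :=
  K₃⁻¹ * (4 / 3) ^ (2 * ν) * 4 ^ |lam| * e⁻¹ * ((2 : ℝ) ^ (2 * ν * j) * (j : ℝ) ^ lam)

/-- On the band of level `j`, `log |m|` differs from `j log 2` by at most `log 4`, which `j ≥ 4`
turns into comparability. -/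
lemma log_band {j : ℕ} (hj : 4 ≤ j) {t : ℝ} (h1 : (2 : ℝ) ^ j < 3 * t) (h2 : 3 * t < 4 * 2 ^ j) :
    2 ≤ t ∧ Real.log t ≤ 4 * j ∧ (j : ℝ) ≤ 4 * Real.log t := by
  have hj' : (4 : ℝ) ≤ j := by exact_mod_cast hj
  have hp : (16 : ℝ) ≤ 2 ^ j := by
    calc (16 : ℝ) = 2 ^ 4 := by norm_num
      _ ≤ 2 ^ j := pow_le_pow_right₀ (by norm_num) hj
  have hl2 := Real.log_two_gt_d9
  have hl2' := Real.log_two_lt_d9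
  have hlp : Real.log ((2 : ℝ) ^ j) = j * Real.log 2 := Real.log_pow 2 j
  have ht : 2 ≤ t := by linarith
  have h3 : Real.log t ≤ Real.log (2 * 2 ^ j) := Real.log_le_log (by linarith) (by linarith)
  have h4 : Real.log (2 ^ j / 4) ≤ Real.log t := Real.log_le_log (by positivity) (by linarith)
  rw [Real.log_mul (by norm_num) (by positivity), hlp] at h3
  rw [Real.log_div (by positivity) (by norm_num), hlp,
    show (4 : ℝ) = 2 ^ 2 by norm_num, Real.log_pow] at h4
  push_cast at h4
  refine ⟨ht, by nlinarith, by nlinarith⟩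

/-- The lower bound in A2, with `|m| < 4/3 * 2^j` in the power and `log |m|` replaced by `j` up to
the factor `4^{|λ₁|}`. -/
lemma inv_tau_le_bandVariance {ε : ℕ → ℝ} {K₃ K₄ ν lam₁ lam₂ β : ℝ} (hK₃ : 0 < K₃) (hν : 0 < ν)
    (hA2 : D.AssumptionA2 ε K₃ K₄ ν ν lam₁ lam₂ 0 0 β) {k j : ℕ} (hj : 4 ≤ j) {m : ℤ}
    (h1 : (2 : ℝ) ^ j < 3 * |(m : ℝ)|) (h2 : 3 * |(m : ℝ)| < 4 * 2 ^ j) :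
    0 < D.tau k m ∧ (D.tau k m)⁻¹ ≤ bandVariance K₃ ν lam₁ (ε k) j := by
  obtain ⟨ht, hlo, hhi⟩ := log_band hj h1 h2
  have hε := hA2.1 k
  have hj0 : (0 : ℝ) < j := by
    have : 0 < j := by omega
    exact_mod_cast this
  have hlt : 0 < Real.log |(m : ℝ)| := by linarith
  have hm := (hA2.2.1 k m (by exact_mod_cast ht)).1
  rw [neg_zero, zero_mul, Real.exp_zero, mul_one] at hm
  set t := |(m : ℝ)| with htdef
  have hpow : (((4 / 3 : ℝ)) ^ (2 * ν) * (2 : ℝ) ^ (2 * ν * j))⁻¹ ≤ t ^ (-2 * ν) := by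
    have h3 : ((4 / 3 : ℝ)) ^ (2 * ν) * (2 : ℝ) ^ (2 * ν * j) = (4 / 3 * 2 ^ j) ^ (2 * ν) := by
      rw [Real.mul_rpow (by norm_num) (by positivity), mul_comm (2 * ν) (j : ℝ),
        Real.rpow_mul (by norm_num : (0 : ℝ) ≤ 2) (j : ℝ), Real.rpow_natCast]
    rw [h3, neg_mul, Real.rpow_neg (by linarith)]
    exact inv_anti₀ (by positivity) (Real.rpow_le_rpow (by linarith) (by linarith) (by linarith))
  have hlog : (4 ^ |lam₁| * (j : ℝ) ^ lam₁)⁻¹ ≤ Real.log t ^ (-lam₁) := by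
    rw [Real.rpow_neg hlt.le]
    exact inv_anti₀ (by positivity) (rpow_le_of_comparable hlt hj0 hlo hhi lam₁)
  have hlow : (bandVariance K₃ ν lam₁ (ε k) j)⁻¹ ≤ D.tau k m := by
    refine le_trans ?_ hm
    calc (bandVariance K₃ ν lam₁ (ε k) j)⁻¹ = K₃ * ε k *
          ((((4 / 3 : ℝ)) ^ (2 * ν) * (2 : ℝ) ^ (2 * ν * j))⁻¹ *
            (4 ^ |lam₁| * (j : ℝ) ^ lam₁)⁻¹) := by
          rw [bandVariance]
          simp only [mul_inv, inv_inv]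
          ring
      _ ≤ K₃ * ε k * (t ^ (-2 * ν) * Real.log t ^ (-lam₁)) := by gcongr
      _ = _ := by ring
  have hV : 0 < bandVariance K₃ ν lam₁ (ε k) j := by unfold bandVariance; positivity
  have hτ : 0 < D.tau k m := (inv_pos.mpr hV).trans_le hlow
  exact ⟨hτ, by rw [inv_le_comm₀ hτ hV]; exact hlow⟩

/-- The bound for `τ₁⁻¹` on the band of the scaling functions. -/
lemma inv_tau_le_of_le_log {ε : ℕ → ℝ} {K₃ K₄ ν lam₁ lam₂ β R : ℝ} (hK₃ : 0 < K₃) (hR : 1 ≤ R)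
    (hA2 : D.AssumptionA2 ε K₃ K₄ ν ν lam₁ lam₂ 0 0 β) {k : ℕ} {m : ℤ} (h : |(m : ℝ)| ≤ R) :
    0 < D.tau k m ∧
      (D.tau k m)⁻¹ ≤ K₃⁻¹ * (ε k)⁻¹ * (2 ^ |lam₁| * R ^ (2 * |ν| + |lam₁|)) := by
  have hε := hA2.1 k
  have h2 : (1 : ℝ) ≤ 2 ^ |lam₁| := Real.one_le_rpow (by norm_num) (abs_nonneg _)
  have hRp : (1 : ℝ) ≤ R ^ (2 * |ν| + |lam₁|) := Real.one_le_rpow hR (by positivity)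
  have hlow : K₃ * ε k * (2 ^ |lam₁| * R ^ (2 * |ν| + |lam₁|))⁻¹ ≤ D.tau k m := by
    rcases lt_or_ge |m| 2 with hm | hm
    · refine le_trans ?_ (hA2.2.2 k m (by omega))
      refine mul_le_of_le_one_right (by positivity) (inv_le_one_of_one_le₀ ?_)
      nlinarith
    · have hm' : (2 : ℝ) ≤ |(m : ℝ)| := by exact_mod_cast hm
      have h3 := (hA2.2.1 k m hm).1
      rw [neg_zero, zero_mul, Real.exp_zero, mul_one] at h3
      refine le_trans ?_ h3
      rw [mul_assoc (K₃ * ε k)]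
      gcongr
      refine le_trans ?_ (rpow_mul_log_rpow_ge hm' ν lam₁)
      refine inv_anti₀ (by positivity) ?_
      gcongr
  have hτ : 0 < D.tau k m := lt_of_lt_of_le (by positivity) hlow
  refine ⟨hτ, ?_⟩
  rw [inv_le_comm₀ hτ (by positivity)]
  refine le_trans (le_of_eq ?_) hlow
  simp only [mul_inv, inv_inv]

lemma eventually_rpow_mul_log_rpow_le {ν ν' : ℝ} (h : ν' < ν) (lam : ℝ) :
    ∀ᶠ t : ℝ in atTop, t ^ (-2 * ν) * Real.log t ^ (-lam) ≤ t ^ (-2 * ν') := by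
  filter_upwards [eventually_logMono_le (by linarith : -2 * ν < -2 * ν') (-lam) 0 1] with t ht
  simpa [logMono] using ht

/-- An exponent `ν'` slightly below `ν` swallows the logarithm of A2, of unknown sign; the bound is
then decreasing in `|m| ≥ N/3`. -/
lemma tau_le_of_unresolved {ε : ℕ → ℝ} {K₃ K₄ ν ν' lam₁ lam₂ β T₀ : ℝ} (hK₄ : 0 < K₄)
    (hν' : 0 ≤ ν') (hA2 : D.AssumptionA2 ε K₃ K₄ ν ν lam₁ lam₂ 0 0 β)
    (hT₀ : ∀ t, T₀ ≤ t → t ^ (-2 * ν) * Real.log t ^ (-lam₂) ≤ t ^ (-2 * ν')) {k : ℕ}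
    (hN : 3 * (|T₀| + 2) ≤ D.N k) {m : ℤ} (hm : (D.N k : ℝ) ≤ 3 * |(m : ℝ)|) :
    D.tau k m ≤ K₄ * ε k * ((D.N k : ℝ) / 3) ^ (-2 * ν') := by
  have hε := hA2.1 k
  have h1 : |T₀| + 2 ≤ |(m : ℝ)| := by linarith
  have h2 : (2 : ℝ) ≤ |(m : ℝ)| := by linarith [abs_nonneg T₀]
  have h3 := (hA2.2.1 k m (by exact_mod_cast h2)).2
  rw [neg_zero, zero_mul, Real.exp_zero, mul_one] at h3
  refine h3.trans ?_
  rw [mul_assoc (K₄ * ε k)]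
  gcongr
  refine (hT₀ _ (by linarith [le_abs_self T₀])).trans ?_
  have hN0 : (0 : ℝ) < D.N k := by exact_mod_cast D.N_pos k
  exact Real.rpow_le_rpow_of_nonpos (by positivity) (by linarith) (by linarith)

lemma noiseLevel_eq (ε : ℕ → ℝ) (k : ℕ) (K₂ c : ℝ) :
    D.noiseLevel K₂ k (c * (ε k)⁻¹) = 25 * K₂ * c * (D.nStar ε k)⁻¹ := by
  rw [noiseLevel, nStar, mul_inv, div_eq_mul_inv]
  ring

/-- The constant of the noise level of the wavelet coefficients. -/
def noiseConst (K₂ K₃ ν lam : ℝ) : ℝ := 25 * K₂ * (K₃⁻¹ * (4 / 3) ^ (2 * ν) * 4 ^ |lam|)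

lemma noiseLevel_bandVariance (ε : ℕ → ℝ) (k : ℕ) (K₂ K₃ ν lam : ℝ) (j : ℕ) :
    D.noiseLevel K₂ k (bandVariance K₃ ν lam (ε k) j) = noiseConst K₂ K₃ ν lam *
      (D.nStar ε k)⁻¹ * ((2 : ℝ) ^ (2 * ν * j) * (j : ℝ) ^ lam) := by
  rw [noiseLevel, nStar, bandVariance, noiseConst, mul_inv, div_eq_mul_inv]
  ring

variable {D}

lemma RegularScale.four_le {ε : ℕ → ℝ} {ν β h₁ : ℝ} {k : ℕ} (h : D.RegularScale ε ν β h₁ k) :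
    4 ≤ coarseLevel 0 β (D.nStar ε k) := by
  by_contra hlt
  have h1 : (2 : ℝ) ^ coarseLevel 0 β (D.nStar ε k) ≤ 2 ^ 3 :=
    pow_le_pow_right₀ (by norm_num) (by omega)
  linarith [h.lt_coarse, h.log_ge]

/-- The noise bound uses block length of order `ln n`: there are at most `6 * 2^j / ln n*` blocks,
and the denominator cancels the logarithm in the threshold. -/
lemma RegularScale.isLevelLoss {ε : ℕ → ℝ} {ν β h₁ : ℝ} {k : ℕ} (h : D.RegularScale ε ν β h₁ k)
    (w : ℝ → ℝ) (lam μ : ℝ) {p : ℝ≥0∞} (hp : 1 ≤ p) (f : ℝ → ℝ) :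
    IsLevelLoss w ν lam μ (D.nStar ε k) p f
      (Finset.Ico (coarseLevel 0 β (D.nStar ε k)) (fineLevel ν 0 β (D.nStar ε k)))
      (fun j => ∑ r ∈ blockIndices ⌊Real.log (D.n k)⌋₊ j,
        min (∑ i ∈ block ⌊Real.log (D.n k)⌋₊ j r, ‖innerCoef f (psi w j i)‖ ^ 2)
          (threshold μ ν lam (D.nStar ε k) j)) := by
  have hx1 := h.one_lt
  have hlx := h.log_ge
  have hln := h.log_le
  have h4 := h.four_le
  have hc := h.lt_coarse
  have hJ := h.fine_le_log
  set x := D.nStar ε k with hx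
  set L := ⌊Real.log (D.n k)⌋₊ with hLdef
  have hL : Real.log x / 4 ≤ L := by
    have := Nat.lt_floor_add_one (Real.log (D.n k))
    rw [← hLdef] at this
    linarith
  have hL0 : 0 < L := by
    have : (0 : ℝ) < L := by linarith
    exact_mod_cast this
  have hL0' : (0 : ℝ) < L := by exact_mod_cast hL0
  have hx0 : 0 < x := by linarith
  have hl0 : 0 < Real.log x := by linarith
  have hthr : ∀ j, 0 ≤ threshold μ ν lam x j := fun j => by unfold threshold; positivity
  obtain ⟨hr1, hr2⟩ := minExp_mem hp
  constructor
  · intro j hj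
    have := (Finset.mem_Ico.mp hj).1
    omega
  · intro j hj
    have h5 : (j : ℝ) ≤ fineLevel ν 0 β x := by exact_mod_cast (Finset.mem_Ico.mp hj).2.le
    linarith
  · intro j hj
    refine (sum_min_block_le_card L j _ (hthr j)).trans ?_
    have hj2 : (2 : ℝ) ^ coarseLevel 0 β x ≤ 2 ^ j :=
      pow_le_pow_right₀ (by norm_num) (Finset.mem_Ico.mp hj).1
    have h5 : (2 : ℝ) ^ j / L + 1 ≤ 6 * 2 ^ j / Real.log x := by
      have h6 : (2 : ℝ) ^ j / L ≤ 4 * 2 ^ j / Real.log x := by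
        rw [div_le_div_iff₀ hL0' hl0]
        nlinarith [pow_pos (two_pos (α := ℝ)) j]
      have h7 : 1 ≤ 2 * 2 ^ j / Real.log x := by
        rw [le_div_iff₀ hl0]; linarith
      calc (2 : ℝ) ^ j / L + 1 ≤ 4 * 2 ^ j / Real.log x + 2 * 2 ^ j / Real.log x := by linarith
        _ = _ := by ring
    calc ((2 : ℝ) ^ j / L + 1) * threshold μ ν lam x j
        ≤ 6 * 2 ^ j / Real.log x * threshold μ ν lam x j := by
          gcongr
          exact hthr j
      _ = _ := by
          have h8 : (2 : ℝ) ^ ((j : ℝ) * (2 * ν + 1)) = 2 ^ j * (2 : ℝ) ^ (2 * ν * j) := by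
            rw [← Real.rpow_natCast, ← Real.rpow_add (by norm_num)]; congr 1; ring
          rw [threshold, logMono, h8, Real.rpow_zero, Real.rpow_neg_one]
          field_simp
  · intro j _
    exact sum_min_block_le_rpow hL0 j _ (hthr j) hr1 hr2
  · intro j _
    exact sum_min_block_le_sq hL0 j _ _

/-- The contribution of large deviations of the noise is negligible when `μ` is large. -/
lemma RegularScale.sum_deviation_le {ε : ℕ → ℝ} {ν β h₁ : ℝ} {k : ℕ}
    (h : D.RegularScale ε ν β h₁ k) (hν : 0 < ν) (hh₁ : h₁ < 1) {K₂ K₃ lam μ : ℝ}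
    (hK₂ : 0 < K₂) (hK₃ : 0 < K₃)
    (hμ : 128 * noiseConst K₂ K₃ ν lam * (1 / (1 - h₁) + 2) ≤ μ ^ 2) :
    ∑ j ∈ Finset.Ico (coarseLevel 0 β (D.nStar ε k)) (fineLevel ν 0 β (D.nStar ε k)),
      432 * 2 ^ ⌊Real.log (D.n k)⌋₊ * 2 ^ j *
        D.noiseLevel K₂ k (bandVariance K₃ ν lam (ε k) j) *
        Real.exp (-(threshold μ ν lam (D.nStar ε k) j /
          (128 * D.noiseLevel K₂ k (bandVariance K₃ ν lam (ε k) j)))) ≤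
      432 * noiseConst K₂ K₃ ν lam * zoneConst (2 * ν + 1) lam * (2 * (2 * ν + 1)) ^ |lam| *
        logMono (-2) lam (D.nStar ε k) := by
  have hx1 := h.one_lt
  have h4 := h.four_le
  have hl0 : 0 < Real.log (D.nStar ε k) := by linarith [h.log_ge]
  have hle := h.le_log
  have hln := h.log_le
  have hJ1 := h.fine_le_log
  have hJ2 := h.log_le_fine
  have hJ0 := h.one_le_fine
  have hJ3 := h.fine_le
  set x := D.nStar ε k with hx
  set J := fineLevel ν 0 β x with hJ
  set L := ⌊Real.log (D.n k)⌋₊ with hLdef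
  have hx0 : 0 < x := by linarith
  have hC0 : 0 < noiseConst K₂ K₃ ν lam := by unfold noiseConst; positivity
  set C₀ := noiseConst K₂ K₃ ν lam with hC₀
  have hh : 0 < 1 - h₁ := by linarith
  have hz := zoneConst_nonneg (2 * ν + 1) lam
  -- Here `2^L ≤ e^L ≤ n ≤ (n*)^{1/(1-h₁)}`; the lower bound on `μ` provides this power and two
  -- more.
  have hexp : (2 : ℝ) ^ L * Real.exp (-(μ ^ 2 * Real.log x / (128 * C₀))) ≤ x ^ (-2 : ℝ) := by
    have h1 : (2 : ℝ) ^ L ≤ Real.exp (1 / (1 - h₁) * Real.log x) := by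
      calc (2 : ℝ) ^ L ≤ Real.exp 1 ^ L := by
            gcongr
            linarith [Real.add_one_le_exp (1 : ℝ)]
        _ = Real.exp L := by rw [← Real.exp_nat_mul, mul_one]
        _ ≤ _ := by
            refine Real.exp_le_exp.mpr ((Nat.floor_le (by linarith)).trans ?_)
            rw [one_div, ← div_eq_inv_mul, le_div_iff₀ hh]
            linarith
    have h2 : (1 / (1 - h₁) + 2) * Real.log x ≤ μ ^ 2 * Real.log x / (128 * C₀) := by
      rw [le_div_iff₀ (by positivity)]
      nlinarith
    calc (2 : ℝ) ^ L * Real.exp (-(μ ^ 2 * Real.log x / (128 * C₀)))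
        ≤ Real.exp (1 / (1 - h₁) * Real.log x) *
          Real.exp (-((1 / (1 - h₁) + 2) * Real.log x)) := by gcongr
      _ = x ^ (-2 : ℝ) := by
          rw [← Real.exp_add, Real.rpow_def_of_pos hx0]; congr 1; ring
  have hterm : ∀ j ∈ Finset.Ico (coarseLevel 0 β x) J,
      432 * 2 ^ L * 2 ^ j * D.noiseLevel K₂ k (bandVariance K₃ ν lam (ε k) j) *
        Real.exp (-(threshold μ ν lam x j /
          (128 * D.noiseLevel K₂ k (bandVariance K₃ ν lam (ε k) j)))) ≤
      432 * C₀ * x⁻¹ * x ^ (-2 : ℝ) *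
        ((2 : ℝ) ^ ((j : ℝ) * (2 * ν + 1)) * (j : ℝ) ^ lam) := by
    intro j hj
    have hj0 : (0 : ℝ) < j := by
      have := (Finset.mem_Ico.mp hj).1
      have : 0 < j := by omega
      exact_mod_cast this
    rw [D.noiseLevel_bandVariance, ← hx, ← hC₀]
    -- The thresholds grow with `j` like the noise level, so the ratio is the same on every level.
    have h5 : threshold μ ν lam x j / (128 * (C₀ * x⁻¹ * ((2 : ℝ) ^ (2 * ν * j) *
        (j : ℝ) ^ lam))) = μ ^ 2 * Real.log x / (128 * C₀) := by
      rw [threshold]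
      have : (0 : ℝ) < (2 : ℝ) ^ (2 * ν * j) := by positivity
      have : (0 : ℝ) < (j : ℝ) ^ lam := by positivity
      field_simp
    have h8 : (2 : ℝ) ^ ((j : ℝ) * (2 * ν + 1)) = 2 ^ j * (2 : ℝ) ^ (2 * ν * j) := by
      rw [← Real.rpow_natCast, ← Real.rpow_add (by norm_num)]; congr 1; ring
    rw [h5, h8]
    calc _ = 432 * C₀ * x⁻¹ * ((2 : ℝ) ^ L * Real.exp (-(μ ^ 2 * Real.log x / (128 * C₀)))) *
          (2 ^ j * (2 : ℝ) ^ (2 * ν * j) * (j : ℝ) ^ lam) := by ring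
      _ ≤ _ := by gcongr
  refine (Finset.sum_le_sum hterm).trans ?_
  rw [← Finset.mul_sum]
  have hJr : (0 : ℝ) < J := by exact_mod_cast hJ0
  have h6 : (2 : ℝ) ^ ((J : ℝ) * (2 * ν + 1)) ≤ x := by
    rw [Real.rpow_mul (by norm_num), Real.rpow_natCast]
    refine (Real.rpow_le_rpow (by positivity) hJ3 (by linarith)).trans (le_of_eq ?_)
    rw [← Real.rpow_mul hx0.le, one_div_mul_cancel (by positivity), Real.rpow_one]
  have h7 : (J : ℝ) ^ lam ≤ (2 * (2 * ν + 1)) ^ |lam| * Real.log x ^ lam :=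
    rpow_le_of_comparable hJr hl0 (by nlinarith) hJ2 lam
  calc 432 * C₀ * x⁻¹ * x ^ (-2 : ℝ) * ∑ j ∈ Finset.Ico (coarseLevel 0 β x) J,
        (2 : ℝ) ^ ((j : ℝ) * (2 * ν + 1)) * (j : ℝ) ^ lam
      ≤ 432 * C₀ * x⁻¹ * x ^ (-2 : ℝ) * (zoneConst (2 * ν + 1) lam *
          (x * ((2 * (2 * ν + 1)) ^ |lam| * Real.log x ^ lam))) := by
        gcongr
        refine (sum_low_levels_le (by linarith : 0 < 2 * ν + 1) lam (m := J) fun j hj => ?_).trans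
          (by gcongr)
        have := Finset.mem_Ico.mp hj
        omega
    _ = _ := by
        rw [logMono]
        field_simp

/-- The aliasing constant is of the order of the inverse sample size. -/
lemma RegularScale.aliasConst_le {ε : ℕ → ℝ} {ν β h₁ : ℝ} {k : ℕ}
    (h : D.RegularScale ε ν β h₁ k) (hε : 0 < ε k) (hν : 0 < ν) {K₄ κ ν' σ : ℝ} (hK₄ : 0 < K₄)
    (hκ : 1 / 2 < κ) (hκσ : κ < σ) (hν' : 2 * κ + 2 * ν' = 2 * ν + 1) (A : ℝ) :
    D.aliasConst κ σ A (K₄ * ε k * ((D.N k : ℝ) / 3) ^ (-2 * ν')) k ≤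
      25 * residueConst κ * decayConst κ σ * A ^ 2 * K₄ * 3 ^ (2 * ν') * 2 ^ (2 * ν + 1) *
        (ε k * (D.nStar ε k)⁻¹) := by
  have hR := residueConst_pos hκ
  have hDc := decayConst_pos hκσ
  have hx1 := h.one_lt
  have hfl := h.lt_fine
  have hfN : (2 : ℝ) ^ fineLevel ν 0 β (D.nStar ε k) ≤ D.N k := by exact_mod_cast h.fine_le_N
  set x := D.nStar ε k with hx
  have hx0 : 0 < x := by linarith
  have hN0 : (0 : ℝ) < D.N k := by exact_mod_cast D.N_pos k
  -- From `N ≥ 2^J > (n*)^{1/(2ν+1)} / 2`; the exponents `2κ` and `2ν'` were matched to add up to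
  -- `2ν + 1`.
  have h1 : (D.N k : ℝ) ^ (-(2 * ν + 1)) ≤ 2 ^ (2 * ν + 1) * x⁻¹ := by
    calc (D.N k : ℝ) ^ (-(2 * ν + 1)) ≤ (x ^ (1 / (2 * ν + 1)) / 2) ^ (-(2 * ν + 1)) :=
          Real.rpow_le_rpow_of_nonpos (by positivity) (by linarith) (by linarith)
      _ = 2 ^ (2 * ν + 1) * x⁻¹ := by
          rw [Real.div_rpow (by positivity) (by norm_num), ← Real.rpow_mul hx0.le,
            Real.rpow_neg (by norm_num : (0 : ℝ) ≤ 2),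
            show 1 / (2 * ν + 1) * -(2 * ν + 1) = -1 by field_simp, Real.rpow_neg_one]
          field_simp
  have h2 : ((D.N k : ℝ) / 3) ^ (-2 * ν') * (D.N k : ℝ) ^ (-(2 * κ)) =
      3 ^ (2 * ν') * (D.N k : ℝ) ^ (-(2 * ν + 1)) := by
    rw [Real.div_rpow hN0.le (by norm_num), ← hν', neg_mul,
      Real.rpow_neg (by norm_num : (0 : ℝ) ≤ 3), neg_add, Real.rpow_add hN0]
    field_simp
  calc D.aliasConst κ σ A (K₄ * ε k * ((D.N k : ℝ) / 3) ^ (-2 * ν')) k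
      = 25 * residueConst κ * decayConst κ σ * A ^ 2 * K₄ * ε k *
          (((D.N k : ℝ) / 3) ^ (-2 * ν') * (D.N k : ℝ) ^ (-(2 * κ))) := by
        rw [aliasConst]; ring
    _ ≤ 25 * residueConst κ * decayConst κ σ * A ^ 2 * K₄ * ε k *
          (3 ^ (2 * ν') * (2 ^ (2 * ν + 1) * x⁻¹)) := by
        rw [h2]; gcongr
    _ = _ := by ring

end Model

/-! ### Risk bound in the regular-smooth case. -/

namespace Model

variable (D : Model.{v})

set_option maxHeartbeats 1000000 in
lemma regularSmooth_risk_le {w : ℝ → ℝ} (hw : IsMeyerAuxiliary w)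
    {K₁ K₂ K₃ K₄ β ν lam₁ lam₂ h₁ h₂ : ℝ} (hK₂ : 0 < K₂) (hK₃ : 0 < K₃) (hK₄ : 0 < K₄)
    (hν : 0 < ν) (hh₁ : h₁ < 1) (hh₂ : h₂ < 1) {ε : ℕ → ℝ} (hA1 : D.AssumptionA1 K₁ K₂)
    (hA2 : D.AssumptionA2 ε K₃ K₄ ν ν lam₁ lam₂ 0 0 β)
    (h : ∀ᶠ k in atTop, -h₁ * Real.log (D.n k) ≤ Real.log (ε k) ∧
      Real.log (ε k) ≤ h₂ * Real.log (D.n k))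
    (hJ : ∀ᶠ k in atTop, 2 ^ fineLevel ν 0 β (D.nStar ε k) ≤ D.N k) {μ : ℝ} (hμ0 : 0 < μ)
    (hμ : 128 * noiseConst K₂ K₃ ν lam₁ * (1 / (1 - h₁) + 2) ≤ μ ^ 2) {s A : ℝ} {p q : ℝ≥0∞}
    (hp : 1 ≤ p) (hq : 1 ≤ q) (hA : 0 < A) (hs : ((min p 2)⁻¹).toReal < s) :
    ∃ C : ℝ, 0 < C ∧ ∀ᶠ k in atTop, ∀ ℓ ≤ coarseLevel 0 β (D.nStar ε k),
      ⨆ f ∈ besovBall w ℓ s p q A, D.risk k (D.estimator w ε μ ν lam₁ 0 β k) f ≤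
        ENNReal.ofReal (C * regularRate ν lam₁ s p q (D.n k) (D.nStar ε k)) := by
  have hε := hA2.1
  have hs0 := half_lt_sStar hs
  obtain ⟨e, g, CT, hCT, he1, he2, hrate, hsum⟩ := exists_rate_bound w hν lam₁ hp hq hA hs μ
  set σ := sStar s p with hσdef
  -- `κ < σ` keeps the weighted Fourier norm finite; `1/2 < κ < 1/2 + ν` puts `ν' = ν + 1/2 - κ`
  -- strictly between `0` and `ν`, leaving room for the logarithm.
  obtain ⟨κ, hκ, hκ'⟩ := exists_between (lt_min hs0 (by linarith : 1 / 2 < 1 / 2 + ν))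
  have hκσ : κ < σ := hκ'.trans_le (min_le_left _ _)
  have hκν : κ < 1 / 2 + ν := hκ'.trans_le (min_le_right _ _)
  have hR := residueConst_pos hκ
  have hDc := decayConst_pos hκσ
  have hgeo : (2 : ℝ) ^ (-(2 * σ)) < 1 :=
    Real.rpow_lt_one_of_one_lt_of_neg (by norm_num) (by linarith)
  have hgeo' : 0 < (1 - (2 : ℝ) ^ (-(2 * σ)))⁻¹ := inv_pos.mpr (by linarith)
  set ν' : ℝ := ν + 1 / 2 - κ with hν'
  obtain ⟨T₀, hT₀⟩ := eventually_atTop.mp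
    (eventually_rpow_mul_log_rpow_le (by linarith : ν' < ν) lam₂)
  set CQ : ℝ := 25 * residueConst κ * decayConst κ σ * A ^ 2 * K₄ * 3 ^ (2 * ν') *
    2 ^ (2 * ν + 1) with hCQ
  have hCQ0 : 0 < CQ := by positivity
  set cV : ℝ := K₃⁻¹ * (4 / 3) ^ (2 * ν) * 4 ^ |lam₁| with hcV
  set γ : ℝ := 2 * |ν| + |lam₁| with hγ
  have hh : 0 < 1 - h₁ := by linarith
  -- The growth condition on `ε_n` makes `ln n` and `ln n*` comparable up to this factor, so powers
  -- of one may replace powers of the other in the rate.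
  set K : ℝ := 2 + 1 / (1 - h₁) with hK
  have hK0 : 0 < K := by positivity
  have hx := D.tendsto_nStar hε hh₁ (h.mono fun k hk => hk.1)
  refine ⟨15 * (4 + 3 * CT) * K ^ |g|, by positivity, ?_⟩
  filter_upwards [D.eventually_regularScale hε β hν hh₁ hh₂ h hJ, hx.eventually hsum,
    hx.eventually (eventually_logMono_le (by linarith : -1 < -e) γ g
      (2 * CQ * K₃⁻¹ * 2 ^ |lam₁|)),
    hx.eventually (eventually_logMono_le (by linarith : -1 < -e) (1 + γ) g
      (32 * (25 * K₂ * (K₃⁻¹ * 2 ^ |lam₁|)))),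
    hx.eventually (eventually_logMono_le (by linarith : -2 < -e) lam₁ g
      (432 * noiseConst K₂ K₃ ν lam₁ * zoneConst (2 * ν + 1) lam₁ * (2 * (2 * ν + 1)) ^ |lam₁|)),
    hx.eventually (eventually_logMono_le (by linarith : -(2 * σ / (2 * ν + 1)) < -e) 0 g
      (A ^ 2 * (1 - (2 : ℝ) ^ (-(2 * σ)))⁻¹ * 2 ^ (2 * σ))),
    (Real.tendsto_log_atTop.comp hx).eventually_ge_atTop (16 * CQ * cV / μ ^ 2),
    hx.eventually ((tendsto_rpow_atTop
      (by positivity : 0 < 1 / (2 * ν + 1))).eventually_ge_atTop (6 * (|T₀| + 2)))]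
    with k hreg hmain ha hb hd htail hlogx hNT ℓ hℓ
  refine iSup₂_le fun f hf => ?_
  have hεk := hε k
  have hlln := hreg.log_le
  have hlle := hreg.le_log
  have hl16 := hreg.log_ge
  have hx1 := hreg.one_lt
  have hc1 := hreg.coarse_le
  have hJ1 := hreg.lt_fine
  have hN1 : (2 : ℝ) ^ fineLevel ν 0 β (D.nStar ε k) ≤ D.N k := by exact_mod_cast hreg.fine_le_N
  have h4 := hreg.four_le
  have hQ := hreg.aliasConst_le hεk hν hK₄ hκ hκσ (ν' := ν') (by rw [hν']; ring) A
  have hdev := hreg.sum_deviation_le hν hh₁ hK₂ hK₃ hμ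
  have hT := hmain _ _ ℓ (fun j hj => hℓ.trans (Finset.mem_Ico.mp hj).1) f hf
    (hreg.isLevelLoss w lam₁ μ hp f)
  have hnpos := D.n_pos k
  rw [← hCQ] at hQ
  simp only [Function.comp] at hlogx
  set x := D.nStar ε k with hxdef
  have hx0 : 0 < x := by linarith
  have hlx : 0 < Real.log x := by linarith
  have hln : 0 < Real.log (D.n k) := by linarith
  have hn1 : 1 < D.n k := by
    by_contra hle
    linarith [Real.log_nonpos hnpos.le (not_lt.mp hle)]
  have hj0 : ∀ j ∈ Finset.Ico (coarseLevel 0 β x) (fineLevel ν 0 β x), 4 ≤ j := fun j hj =>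
    h4.trans (Finset.mem_Ico.mp hj).1
  have hjr : ∀ j ∈ Finset.Ico (coarseLevel 0 β x) (fineLevel ν 0 β x), (0 : ℝ) < j :=
    fun j hj => by
      have := hj0 j hj
      have : 0 < j := by omega
      exact_mod_cast this
  have hN0 : (0 : ℝ) < D.N k := by exact_mod_cast D.N_pos k
  have hrisk := D.risk_besov_le hw hp hq hA hs hℓ hreg.coarse_le_fine hf hK₂ hκ hκσ hA1
    (L := ⌊Real.log (D.n k)⌋₊) (Nat.floor_pos.mpr (by linarith))
    (thr := threshold μ ν lam₁ x) (V := bandVariance K₃ ν lam₁ (ε k))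
    (V₀ := K₃⁻¹ * (ε k)⁻¹ * (2 ^ |lam₁| * Real.log x ^ γ))
    (U := K₄ * ε k * ((D.N k : ℝ) / 3) ^ (-2 * ν'))
    (fun j _ => by unfold threshold; positivity) (by positivity)
    (fun j hj => by
      have := hjr j hj
      unfold bandVariance
      positivity)
    (by positivity) hreg.coarse_le_N hreg.fine_le_N
    (fun m hm => D.inv_tau_le_of_le_log hK₃ (by linarith) hA2
      (by linarith [abs_nonneg (m : ℝ)]))
    (fun j hj m hm1 hm2 => D.inv_tau_le_bandVariance hK₃ hν hA2 (hj0 j hj) hm1 hm2)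
    (fun m' hm' => D.tau_le_of_unresolved hK₄ (by linarith) hA2 hT₀ (by linarith) hm')
    -- The aliasing energy is of order `(n*)⁻¹ 2^{2νj} j^{λ₁}`; the threshold carries an extra `ln
    -- n*`, which eventually exceeds all constants.
    (fun j hj => by
      have hjj := hjr j hj
      set B : ℝ := (2 : ℝ) ^ (2 * ν * j) * (j : ℝ) ^ lam₁ with hB
      have hB0 : 0 < B := by positivity
      calc D.aliasConst κ σ A (K₄ * ε k * ((D.N k : ℝ) / 3) ^ (-2 * ν')) k *
            bandVariance K₃ ν lam₁ (ε k) j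
          ≤ CQ * (ε k * x⁻¹) * (cV * (ε k)⁻¹ * B) := by
            rw [bandVariance, ← hcV, ← hB]
            gcongr
        _ = 16 * CQ * cV * (x⁻¹ * B / 16) := by field_simp
        _ ≤ μ ^ 2 * Real.log x * (x⁻¹ * B / 16) := by
            rw [div_le_iff₀ (by positivity)] at hlogx
            exact mul_le_mul_of_nonneg_right (by linarith) (by positivity)
        _ = threshold μ ν lam₁ x j / 16 := by rw [threshold, hB]; ring)
    hT hdev
  have hest : D.estimator w ε μ ν lam₁ 0 β k = D.blockEstimator w (coarseLevel 0 β x)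
      (fineLevel ν 0 β x) ⌊Real.log (D.n k)⌋₊ (threshold μ ν lam₁ x) k := rfl
  rw [hest]
  refine hrisk.trans (ENNReal.ofReal_le_ofReal ?_)
  have hA' : 2 * (D.aliasConst κ σ A (K₄ * ε k * ((D.N k : ℝ) / 3) ^ (-2 * ν')) k *
      (K₃⁻¹ * (ε k)⁻¹ * (2 ^ |lam₁| * Real.log x ^ γ))) ≤ logMono (-e) g x := by
    refine le_trans ?_ ha
    calc _ ≤ 2 * (CQ * (ε k * x⁻¹) * (K₃⁻¹ * (ε k)⁻¹ * (2 ^ |lam₁| * Real.log x ^ γ))) := by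
          gcongr
      _ = _ := by
          rw [logMono, Real.rpow_neg_one]
          field_simp
  have hB' : 32 * 2 ^ coarseLevel 0 β x *
      D.noiseLevel K₂ k (K₃⁻¹ * (ε k)⁻¹ * (2 ^ |lam₁| * Real.log x ^ γ)) ≤
      logMono (-e) g x := by
    refine le_trans ?_ hb
    rw [show K₃⁻¹ * (ε k)⁻¹ * (2 ^ |lam₁| * Real.log x ^ γ) =
      (K₃⁻¹ * (2 ^ |lam₁| * Real.log x ^ γ)) * (ε k)⁻¹ by ring, noiseLevel_eq, ← hxdef]
    calc _ ≤ 32 * Real.log x * (25 * K₂ * (K₃⁻¹ * (2 ^ |lam₁| * Real.log x ^ γ)) * x⁻¹) := by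
          gcongr
      _ = _ := by
          rw [logMono, Real.rpow_neg_one, Real.rpow_add hlx 1 γ, Real.rpow_one]
          ring
  have hE' : A ^ 2 * (1 - (2 : ℝ) ^ (-(2 * σ)))⁻¹ *
      (2 : ℝ) ^ (-(2 * (fineLevel ν 0 β x : ℝ) * σ)) ≤ logMono (-e) g x := by
    refine le_trans ?_ htail
    rw [mul_assoc (A ^ 2 * _)]
    gcongr
    calc (2 : ℝ) ^ (-(2 * (fineLevel ν 0 β x : ℝ) * σ)) =
          ((2 : ℝ) ^ fineLevel ν 0 β x) ^ (-(2 * σ)) := by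
          rw [← Real.rpow_natCast, ← Real.rpow_mul (by norm_num)]; congr 1; ring
      _ ≤ (x ^ (1 / (2 * ν + 1)) / 2) ^ (-(2 * σ)) :=
          Real.rpow_le_rpow_of_nonpos (by positivity) (by linarith) (by linarith)
      _ = _ := by
          rw [Real.div_rpow (by positivity) (by norm_num), ← Real.rpow_mul hx0.le,
            Real.rpow_neg (by norm_num : (0 : ℝ) ≤ 2), logMono, Real.rpow_zero, mul_one,
            show 1 / (2 * ν + 1) * -(2 * σ) = -(2 * σ / (2 * ν + 1)) by ring]
          field_simp
  have hfin : logMono (-e) g x ≤ K ^ |g| * regularRate ν lam₁ s p q (D.n k) x := by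
    rw [hrate _ _ hn1 hx0, logMono]
    have h5 : Real.log x ^ g ≤ K ^ |g| * Real.log (D.n k) ^ g := by
      have h6 : 0 < 1 / (1 - h₁) := by positivity
      refine rpow_le_of_comparable hlx hln ?_ ?_ g
      · rw [hK]; nlinarith
      · have h7 : Real.log (D.n k) ≤ 1 / (1 - h₁) * Real.log x := by
          rw [one_div, ← div_eq_inv_mul, le_div_iff₀ hh]; linarith
        rw [hK]; linarith
    calc x ^ (-e) * Real.log x ^ g ≤ x ^ (-e) * (K ^ |g| * Real.log (D.n k) ^ g) := by gcongr
      _ = _ := by ring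
  calc _ ≤ 15 * (logMono (-e) g x + logMono (-e) g x +
        (3 * (CT * logMono (-e) g x) + logMono (-e) g x) + logMono (-e) g x) := by gcongr
    _ = 15 * (4 + 3 * CT) * logMono (-e) g x := by ring
    _ ≤ 15 * (4 + 3 * CT) * (K ^ |g| * regularRate ν lam₁ s p q (D.n k) x) := by gcongr
    _ = _ := by ring

end Model

end MultichannelDeconvolution

end

/-! ### The two cases of the theorem. -/

open MultichannelDeconvolution in
theorem theorem2 (w : ℝ → ℝ) (hw : IsMeyerAuxiliary w) (K₁ K₂ K₃ K₄ β : ℝ)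
    (hK₁ : 0 < K₁) (hK₁₂ : K₁ ≤ K₂) (hK₃ : 0 < K₃) (hK₄ : 0 < K₄) (hβ : 0 < β) :
    -- the regular-smooth case
    (∀ ν lam₁ lam₂ h₁ h₂ : ℝ, 0 < ν → 0 < h₁ → h₁ < 1 → 0 < h₂ → h₂ < 1 →
      ∃ μ₀ : ℝ, 0 < μ₀ ∧ ∀ (D : Model.{v}) (ε : ℕ → ℝ),
        D.AssumptionA1 K₁ K₂ →
        D.AssumptionA2 ε K₃ K₄ ν ν lam₁ lam₂ 0 0 β →
        (∀ᶠ k in atTop, -h₁ * Real.log (D.n k) ≤ Real.log (ε k) ∧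
          Real.log (ε k) ≤ h₂ * Real.log (D.n k)) →
        (∀ᶠ k in atTop, 2 ^ fineLevel ν 0 β (D.nStar ε k) ≤ D.N k) →
        ∀ μ : ℝ, μ₀ ≤ μ → ∀ (s A : ℝ) (p q : ℝ≥0∞), 1 ≤ p → 1 ≤ q → 0 < A →
          ((min p 2)⁻¹).toReal < s →
          ∃ C : ℝ, 0 < C ∧ ∀ᶠ k in atTop, ∀ ℓ ≤ coarseLevel 0 β (D.nStar ε k),
            ⨆ f ∈ besovBall w ℓ s p q A, D.risk k (D.estimator w ε μ ν lam₁ 0 β k) f ≤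
              ENNReal.ofReal (C * regularRate ν lam₁ s p q (D.n k) (D.nStar ε k))) ∧
    -- the super-smooth case
    (∀ ν₁ ν₂ lam₁ lam₂ α₁ α₂ : ℝ, 0 < α₁ → 0 < α₂ → ∀ (D : Model.{v}) (ε : ℕ → ℝ),
        D.AssumptionA1 K₁ K₂ →
        D.AssumptionA2 ε K₃ K₄ ν₁ ν₂ lam₁ lam₂ α₁ α₂ β →
        Tendsto (D.nStar ε) atTop atTop →
        Tendsto (fun k => (2 : ℝ) ^ coarseLevel α₁ β (D.nStar ε k) / (D.N k : ℝ)) atTop (𝓝 0) →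
        ∀ (μ s A : ℝ) (p q : ℝ≥0∞), 1 ≤ p → 1 ≤ q → 0 < A →
          ((min p 2)⁻¹).toReal < s →
          ∃ C : ℝ, 0 < C ∧ ∀ᶠ k in atTop, ∀ ℓ ≤ coarseLevel α₁ β (D.nStar ε k),
            ⨆ f ∈ besovBall w ℓ s p q A, D.risk k (D.estimator w ε μ ν₁ lam₁ α₁ β k) f ≤
              ENNReal.ofReal (C * superRate β s p (D.nStar ε k))) := by
  have hK₂ : 0 < K₂ := hK₁.trans_le hK₁₂
  refine ⟨fun ν lam₁ lam₂ h₁ h₂ hν _ hh₁ _ hh₂ => ?_, ?_⟩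
  · have hC₀ : 0 < Model.noiseConst K₂ K₃ ν lam₁ := by unfold Model.noiseConst; positivity
    have hh : 0 < 1 - h₁ := by linarith
    have hpos : 0 < 128 * Model.noiseConst K₂ K₃ ν lam₁ * (1 / (1 - h₁) + 2) := by positivity
    -- This `μ₀` is the smallest value for which the deviation bound gains the power `(n*)^{-2}`; it
    -- does not involve `s`, `p`, `q` or `A`.
    refine ⟨√(128 * Model.noiseConst K₂ K₃ ν lam₁ * (1 / (1 - h₁) + 2)), Real.sqrt_pos.mpr hpos,
      fun D ε hA1 hA2 hε hJ μ hμ s A p q hp hq hA hs => ?_⟩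
    exact D.regularSmooth_risk_le hw hK₂ hK₃ hK₄ hν hh₁ hh₂ hA1 hA2 hε hJ
      ((Real.sqrt_pos.mpr hpos).trans_le hμ) (Real.sqrt_le_iff.mp hμ).2 hp hq hA hs
  · intro ν₁ ν₂ lam₁ lam₂ α₁ α₂ hα₁ hα₂ D ε hA1 hA2 hx hN μ s A p q hp hq hA hs
    exact D.superSmooth_risk_le hw hK₂ hK₃ hK₄ hβ hα₁ hα₂ hA1 hA2 hx hN μ hp hq hA hs
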